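/- Let $k,l\ge 0$ and let $\mathcal H_A=(\mathbb C^2)^{\otimes 2k}$, $\mathcal H_B=(\mathbb C^2)^{\otimes 2l}$ be the Hilbert spaces of $2k$ and $2l$ spin-$\tfrac12$ systems. Let $|j,m,a\rangle$ ($0\le j\le k$, $-j\le m\le j$, $1\le a\le d^A_j$) and $|j,m,b\rangle$ ($0\le j\le l$, $-j\le m\le j$, $1\le b\le d^B_j$) be angular momentum bases of $\mathcal H_A$ and $\mathcal H_B$, i.e. orthonormal bases on which the total angular momentum operators act by $J_z|j,m,\cdot\rangle=m|j,m,\cdot\rangle$ and $J_\pm|j,m,\cdot\rangle=\sqrt{j(j+1)-m(m\pm1)}\,|j,m\pm1,\cdot\rangle$; here $d^A_j,d^B_j$ are the multiplicities of the spin-$j$ representation of $\mathrm{SU}(2)$. For $0\le j\le\min(k,l)$, $1\le a\le d^A_j$, $1\le b\le d^B_j$ consider the zero-spin state $$|j,a,b\rangle=\frac1{\sqrt{2j+1}}\sum_{m=-j}^{j}(-1)^{j-m}|j,-m,a\rangle\otimes|j,m,b\rangle ,$$ which, with $\mathcal H_{A}=\bigoplus_j V^j\otimes D^j_{A}$ and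 $\mathcal H_{B}=\bigoplus_j V^j\otimes D^j_{B}$, is the product $|j\rangle_{AB}\otimes|a\rangle_{D^j_A}\otimes|b\rangle_{D^j_B}$ of the singlet of $V^j\otimes V^j$ with degeneracy basis vectors. Let $w^{(j)}_{a,b}\ge 0$ with $\sum_{j,a,b}w^{(j)}_{a,b}=1$ and $$\rho=\sum_{j,a,b}w^{(j)}_{a,b}\,|j,a,b\rangle\langle j,a,b| .$$ Then all measures of entanglement of $\rho$ between $A$ and $B$ are equal to $$E(\rho)=\sum_{j,a,b}w^{(j)}_{a,b}\log(2j+1).$$ Precisely, this number (logarithms are natural throughout, also in entropies and rates) is 1. the entanglement of formation of $\rho$: the minimum of $\sum_i p_i\,S(\mathrm{tr}_B|\Psi_i\rangle\langle\Psi_i|)$ over all finite decompositions $\rho=\sum_i p_i|\Psi_i\rangle\langle\Psi_i|$ into unit vectors with $p_i>0$, $\sum_i p_i=1$, where $S$ is the von Neumann entropy; 2. the distillable entanglement of $\rho$: the supremum of the rates $r$ such that, for every $\varepsilon>0$ and all large $n$, a protocol of local operations and classical communication (LOCC) takes $\rho^{\otimes n}$ to a state of fidelity at least $1-\varepsilon$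 with a maximally entangled state of Schmidt rank $M$, $\log M\ge n(r-\varepsilon)$; 3. the entanglement cost of $\rho$: the infimum of the rates $r$ such that, for every $\varepsilon>0$ and all large $n$, an LOCC protocol takes a maximally entangled state of some Schmidt rank $M$, $\log M\le n(r+\varepsilon)$, to a state within trace-norm distance $\varepsilon$ of $\rho^{\otimes n}$; 4. the relative entropy of entanglement of $\rho$: the minimum of $\mathrm{tr}\,\rho(\log\rho-\log\sigma)$ over separable states $\sigma$ with $\ker\sigma\subseteq\ker\rho$; 5. the value $E(\rho)$ of every normalized convex entanglement monotone $E$, i.e. of every real function $E$ of the states of finite-dimensional bipartite systems that is convex, does not increase on average under LOCC, and on pure states equals the entropy of the reduced density matrix. -/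

import Mathlib

open scoped Matrix Kronecker ComplexOrder

namespace SpinEntanglement

noncomputable section

/-! ### Bipartite states

A finite-dimensional Hilbert space with a distinguished orthonormal basis `α` is `α → ℂ`; operators
are matrices. A bipartite system has basis `α × β`. All logarithms are natural, in the entropies as
well as in the rates. -/

/-- Density matrices. -/
def IsState {α : Type} [Fintype α] (ρ : Matrix α α ℂ) : Prop :=
  ρ.PosSemidef ∧ ρ.trace = 1

/-- Unit vectors. -/
def IsUnitVector {α : Type} [Fintype α] (ψ : α → ℂ) : Prop :=
  star ψ ⬝ᵥ ψ = 1

/-- The rank one operator `|ψ⟩⟨ψ|`. -/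
def pureState {α : Type} (ψ : α → ℂ) : Matrix α α ℂ :=
  Matrix.vecMulVec ψ (star ψ)

/-- The partial trace over the second subsystem. -/
def partialTraceB {α β : Type} [Fintype β] (ρ : Matrix (α × β) (α × β) ℂ) : Matrix α α ℂ :=
  Matrix.of fun i i' => ∑ b, ρ (i, b) (i', b)

/-- The von Neumann entropy `- tr ρ log ρ`, through the functional calculus of `x ↦ - x log x`. -/
def entropy {α : Type} [Fintype α] [DecidableEq α] (ρ : Matrix α α ℂ) : ℝ :=
  (Matrix.trace (cfc Real.negMulLog ρ)).re

/-- The degree of entanglement of a pure state: the entropy of its reduced density matrix. -/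
def pureEntanglement {α β : Type} [Fintype α] [DecidableEq α] [Fintype β] (ψ : α × β → ℂ) : ℝ :=
  entropy (partialTraceB (pureState ψ))

/-- Separable states: finite mixtures of product states. -/
def IsSeparable {α β : Type} [Fintype α] [Fintype β] (σ : Matrix (α × β) (α × β) ℂ) : Prop :=
  ∃ (n : ℕ) (p : Fin n → ℝ) (σA : Fin n → Matrix α α ℂ) (σB : Fin n → Matrix β β ℂ),
    (∀ i, 0 < p i) ∧ ∑ i, p i = 1 ∧ (∀ i, IsState (σA i)) ∧ (∀ i, IsState (σB i)) ∧
      σ = ∑ i, (p i : ℂ) • (σA i ⊗ₖ σB i)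

/-! ### Local operations and classical communication -/

/-- `IsLOCC A B`: the product Kraus operators `A i ⊗ B i`, where `i` runs over the complete
classical records, are those of an LOCC protocol with finitely many rounds. In each round one of the
parties applies a local measurement (a family of Kraus operators `K` with `∑ Kᴴ K = 1`, possibly
changing the local Hilbert space) that may depend on the whole record so far, and the outcome is
added to the record, which both parties know. Forgetting information amounts to summing over
records. -/
inductive IsLOCC {α β : Type} [DecidableEq α] [DecidableEq β] :
    {ι α' β' : Type} → (ι → Matrix α' α ℂ) → (ι → Matrix β' β ℂ) → Prop
  | start : IsLOCC (fun _ : Unit => (1 : Matrix α α ℂ)) (fun _ : Unit => (1 : Matrix β β ℂ))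
  | alice {ι κ α' α'' β' : Type} [Fintype κ] [Fintype α'] [DecidableEq α'] [Fintype α'']
      {A : ι → Matrix α' α ℂ} {B : ι → Matrix β' β ℂ} (h : IsLOCC A B)
      (K : ι → κ → Matrix α'' α' ℂ) (hK : ∀ i, ∑ k, (K i k)ᴴ * K i k = 1) :
      IsLOCC (fun x : ι × κ => K x.1 x.2 * A x.1) (fun x : ι × κ => B x.1)
  | bob {ι κ α' β' β'' : Type} [Fintype κ] [Fintype β'] [DecidableEq β'] [Fintype β'']
      {A : ι → Matrix α' α ℂ} {B : ι → Matrix β' β ℂ} (h : IsLOCC A B)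
      (K : ι → κ → Matrix β'' β' ℂ) (hK : ∀ i, ∑ k, (K i k)ᴴ * K i k = 1) :
      IsLOCC (fun x : ι × κ => A x.1) (fun x : ι × κ => K x.1 x.2 * B x.1)

/-- The unnormalized state after the record with Kraus operator `A ⊗ B`. -/
def branch {α β α' β' : Type} [Fintype α] [Fintype β] (A : Matrix α' α ℂ) (B : Matrix β' β ℂ)
    (ρ : Matrix (α × β) (α × β) ℂ) : Matrix (α' × β') (α' × β') ℂ :=
  (A ⊗ₖ B) * ρ * (A ⊗ₖ B)ᴴ

/-- `τ` can be produced from `ρ` by an LOCC protocol. -/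
def LOCCConvertible {α β α' β' : Type} [Fintype α] [DecidableEq α] [Fintype β] [DecidableEq β]
    (ρ : Matrix (α × β) (α × β) ℂ) (τ : Matrix (α' × β') (α' × β') ℂ) : Prop :=
  ∃ (ι : Type) (_ : Fintype ι) (A : ι → Matrix α' α ℂ) (B : ι → Matrix β' β ℂ),
    IsLOCC A B ∧ τ = ∑ i, branch (A i) (B i) ρ

/-! ### Measures of entanglement -/

/-- The average pure-state entanglement of all ensembles of pure states that realize `ρ`; the
entanglement of formation is the minimum of this set. -/
def formationValues {α β : Type} [Fintype α] [DecidableEq α] [Fintype β]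
    (ρ : Matrix (α × β) (α × β) ℂ) : Set ℝ :=
  {r | ∃ (n : ℕ) (p : Fin n → ℝ) (ψ : Fin n → α × β → ℂ),
    (∀ i, 0 < p i) ∧ ∑ i, p i = 1 ∧ (∀ i, IsUnitVector (ψ i)) ∧
      ρ = ∑ i, (p i : ℂ) • pureState (ψ i) ∧ r = ∑ i, p i * pureEntanglement (ψ i)}

/-- The finite values of the relative entropy `tr ρ (log ρ - log σ)` over separable states `σ` (it is
finite exactly if the kernel of `σ` is contained in that of `ρ`); the relative entropy of
entanglement is the minimum of this set. -/
def relativeEntropyValues {α β : Type} [Fintype α] [DecidableEq α] [Fintype β] [DecidableEq β]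
    (ρ : Matrix (α × β) (α × β) ℂ) : Set ℝ :=
  {r | ∃ σ : Matrix (α × β) (α × β) ℂ, IsSeparable σ ∧ (∀ v, σ *ᵥ v = 0 → ρ *ᵥ v = 0) ∧
    r = (Matrix.trace (ρ * (cfc Real.log ρ - cfc Real.log σ))).re}

/-- `n` copies of `ρ`, regrouped as a bipartite state. -/
def copies {α β : Type} (ρ : Matrix (α × β) (α × β) ℂ) (n : ℕ) :
    Matrix ((Fin n → α) × (Fin n → β)) ((Fin n → α) × (Fin n → β)) ℂ :=
  Matrix.of fun x y => ∏ t, ρ (x.1 t, x.2 t) (y.1 t, y.2 t)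

/-- The maximally entangled vector of Schmidt rank `M`. -/
def maxEntangled (M : ℕ) : Fin M × Fin M → ℂ :=
  fun x => if x.1 = x.2 then ((1 / √(M : ℝ) : ℝ) : ℂ) else 0

/-- The trace norm of a Hermitian matrix. -/
def traceNorm {α : Type} [Fintype α] [DecidableEq α] (X : Matrix α α ℂ) : ℝ :=
  (Matrix.trace (cfc (fun x : ℝ => |x|) X)).re

/-- The rates at which maximal entanglement can be distilled from many copies of `ρ` by LOCC with
fidelity tending to one; the distillable entanglement is the supremum of this set. -/
def distillationRates {α β : Type} [Fintype α] [DecidableEq α] [Fintype β] [DecidableEq β]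
    (ρ : Matrix (α × β) (α × β) ℂ) : Set ℝ :=
  {r | ∀ ε : ℝ, 0 < ε → ∀ᶠ n : ℕ in Filter.atTop, ∃ M : ℕ, 0 < M ∧ n * (r - ε) ≤ Real.log M ∧
    ∃ τ : Matrix (Fin M × Fin M) (Fin M × Fin M) ℂ, LOCCConvertible (copies ρ n) τ ∧
      1 - ε ≤ (star (maxEntangled M) ⬝ᵥ (τ *ᵥ maxEntangled M)).re}

/-- The rates at which maximal entanglement suffices to prepare many copies of `ρ` by LOCC with
error tending to zero in trace norm; the entanglement cost is the infimum of this set. -/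
def costRates {α β : Type} [Fintype α] [DecidableEq α] [Fintype β] [DecidableEq β]
    (ρ : Matrix (α × β) (α × β) ℂ) : Set ℝ :=
  {r | ∀ ε : ℝ, 0 < ε → ∀ᶠ n : ℕ in Filter.atTop, ∃ M : ℕ, 0 < M ∧ Real.log M ≤ n * (r + ε) ∧
    ∃ τ : Matrix ((Fin n → α) × (Fin n → β)) ((Fin n → α) × (Fin n → β)) ℂ,
      LOCCConvertible (pureState (maxEntangled M)) τ ∧ traceNorm (τ - copies ρ n) ≤ ε}

/-- A real function of the states of all finite-dimensional bipartite systems is a (normalized,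
convex) entanglement measure if it is an entanglement monotone, i.e. convex and not increasing on
average under LOCC, and gives the degree of entanglement on pure states. -/
structure IsEntanglementMeasure
    (E : ∀ {α β : Type} [Fintype α] [DecidableEq α] [Fintype β] [DecidableEq β],
      Matrix (α × β) (α × β) ℂ → ℝ) : Prop where
  pure_eq : ∀ {α β : Type} [Fintype α] [DecidableEq α] [Fintype β] [DecidableEq β]
    (ψ : α × β → ℂ), IsUnitVector ψ → E (pureState ψ) = pureEntanglement ψ
  convex : ∀ {α β : Type} [Fintype α] [DecidableEq α] [Fintype β] [DecidableEq β]
    (n : ℕ) (p : Fin n → ℝ) (ρ : Fin n → Matrix (α × β) (α × β) ℂ),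
    (∀ i, 0 ≤ p i) → ∑ i, p i = 1 → (∀ i, IsState (ρ i)) →
      E (∑ i, (p i : ℂ) • ρ i) ≤ ∑ i, p i * E (ρ i)
  /-- With `q i = tr (branch i)` the probability of record `i`, the average of the measure over the
  normalized states after the protocol is at most its value before. -/
  locc_le : ∀ {α β α' β' ι : Type} [Fintype α] [DecidableEq α] [Fintype β] [DecidableEq β]
    [Fintype α'] [DecidableEq α'] [Fintype β'] [DecidableEq β'] [Fintype ι]
    (ρ : Matrix (α × β) (α × β) ℂ) (A : ι → Matrix α' α ℂ) (B : ι → Matrix β' β ℂ),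
    IsState ρ → IsLOCC A B →
      ∑ i, (branch (A i) (B i) ρ).trace.re *
        E ((branch (A i) (B i) ρ).trace⁻¹ • branch (A i) (B i) ρ) ≤ E ρ

/-! ### Qubits, angular momentum and zero-spin states -/

/-- Basis labels of `(V^{1/2})^{⊗ N}`: at each site `0` is spin up and `1` is spin down. -/
abbrev Qubits (N : ℕ) : Type := Fin N → Fin 2

/-- The total `J_z`. -/
def spinZ {N : ℕ} (v : Qubits N → ℂ) : Qubits N → ℂ :=
  fun x => (∑ i, if x i = 0 then (1 / 2 : ℂ) else -(1 / 2)) * v x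

/-- The total raising operator `J_+ = J_x + i J_y`. -/
def spinPlus {N : ℕ} (v : Qubits N → ℂ) : Qubits N → ℂ :=
  fun x => ∑ i, if x i = 0 then v (Function.update x i 1) else 0

/-- The total lowering operator `J_- = J_x - i J_y`. -/
def spinMinus {N : ℕ} (v : Qubits N → ℂ) : Qubits N → ℂ :=
  fun x => ∑ i, if x i = 1 then v (Function.update x i 0) else 0

/-- An angular momentum basis `|j, m, a_j⟩` of the Hilbert space of `2 k` qubits. The vector
`vec ⟨j, i, a⟩` is `|j, m, a⟩` with `m = i - j`; `mult j` is the multiplicity of the spin `j`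
representation (the fields force it to vanish for `k < j`). -/
structure AngularMomentumBasis (k : ℕ) where
  mult : ℕ → ℕ
  vec : (Σ j : ℕ, Fin (2 * j + 1) × Fin (mult j)) → Qubits (2 * k) → ℂ
  orthonormal : ∀ s t, star (vec s) ⬝ᵥ vec t = if s = t then 1 else 0
  complete : Submodule.span ℂ (Set.range vec) = ⊤
  spinZ_vec : ∀ (j : ℕ) (i : Fin (2 * j + 1)) (a : Fin (mult j)),
    spinZ (vec ⟨j, i, a⟩) = ((i : ℂ) - (j : ℂ)) • vec ⟨j, i, a⟩
  /-- `J_+ |j, m⟩ = √((j - m) (j + m + 1)) |j, m + 1⟩` -/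
  spinPlus_vec : ∀ (j : ℕ) (i : Fin (2 * j)) (a : Fin (mult j)),
    spinPlus (vec ⟨j, i.castSucc, a⟩) =
      ((√((2 * (j : ℝ) - i) * (i + 1)) : ℝ) : ℂ) • vec ⟨j, i.succ, a⟩
  spinPlus_last : ∀ (j : ℕ) (a : Fin (mult j)), spinPlus (vec ⟨j, Fin.last (2 * j), a⟩) = 0
  /-- `J_- |j, m + 1⟩ = √((j - m) (j + m + 1)) |j, m⟩` -/
  spinMinus_vec : ∀ (j : ℕ) (i : Fin (2 * j)) (a : Fin (mult j)),
    spinMinus (vec ⟨j, i.succ, a⟩) =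
      ((√((2 * (j : ℝ) - i) * (i + 1)) : ℝ) : ℂ) • vec ⟨j, i.castSucc, a⟩
  spinMinus_zero : ∀ (j : ℕ) (a : Fin (mult j)), spinMinus (vec ⟨j, 0, a⟩) = 0

/-- The zero-spin state
`|j, a, b⟩ = (2j+1)^{-1/2} ∑_m (-1)^{j-m} |j, -m, a⟩ ⊗ |j, m, b⟩`. -/
def zeroSpin {k l : ℕ} (𝓐 : AngularMomentumBasis k) (𝓑 : AngularMomentumBasis l) (j : ℕ)
    (a : Fin (𝓐.mult j)) (b : Fin (𝓑.mult j)) : Qubits (2 * k) × Qubits (2 * l) → ℂ :=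
  fun x => ((1 / √(2 * (j : ℝ) + 1) : ℝ) : ℂ) *
    ∑ i : Fin (2 * j + 1),
      (-1 : ℂ) ^ (2 * j - (i : ℕ)) * 𝓐.vec ⟨j, i.rev, a⟩ x.1 * 𝓑.vec ⟨j, i, b⟩ x.2

/-- The mixture of the zero-spin states with weights `w j a b`. -/
def zeroSpinMixture {k l : ℕ} (𝓐 : AngularMomentumBasis k) (𝓑 : AngularMomentumBasis l)
    (w : (j : ℕ) → Fin (𝓐.mult j) → Fin (𝓑.mult j) → ℝ) :
    Matrix (Qubits (2 * k) × Qubits (2 * l)) (Qubits (2 * k) × Qubits (2 * l)) ℂ :=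
  ∑ j ∈ Finset.range (min k l + 1), ∑ a, ∑ b, (w j a b : ℂ) • pureState (zeroSpin 𝓐 𝓑 j a b)

end

end SpinEntanglement

/-! The subspaces V^j ⊗ |a⟩ of A, and likewise V^j ⊗ |b⟩ of B, are mutually orthogonal "sectors",
and |j,a,b⟩ is a maximally entangled vector of two sectors of equal dimension d = 2j+1: indexing A's
basis by -m and absorbing the signs into B's turns it into d^{-1/2} ∑_t |t⟩ ⊗ |t⟩ (`ent_sectors`).
Everything is therefore proved for mixtures ρ = ∑ w_s |s⟩⟨s| of such vectors (`SectorBasis`,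
`SectorWeights`), with value E = ∑ w_s log d_s. This class is closed under taking n copies, which
multiplies E by n (`copies_mixture`, `value_pow`).

Both parties can measure their sectors without disturbing ρ, and the outcome reveals s. Hence a
monotone is at least E on ρ, and by convexity at most E. For the entanglement of formation, every
vector of a decomposition of ρ is a superposition ∑ c_s |s⟩, and the entropy of its reduced matrix
is at least ∑ |c_s|² log d_s (`sum_norm_sq_mul_log_le_pureEntanglement`); the defining ensemble
attains E.

Two converses rest on one estimate: unit product vectors satisfy ∑ d_s |⟨s|a⊗b⟩|² ≤ 1
(`sum_dim_mul_norm_sq_le`). Hence ∑ d_s ⟨s|σ|s⟩ ≤ 1 for separable σ, and tangents of the logarithm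
at w_s/d_s bound the relative entropy below by E; the dephased mixture attains it. For states made
by LOCC from Schmidt rank M the sum is at most M, so they have little weight on sectors with d_s
much larger than M, which bounds the cost. For distillation, the fidelity reached from |s⟩ with
Schmidt rank M is at most min(1, d_s/M) (`fidelity_le`).

Conversely, cutting a sector into blocks of length M distils rank M with fidelity at least
d/(d+M-1), and cutting rank M into blocks of length d prepares |s⟩ up to an error of order d/M. For
n copies log d is a sum of independent terms with mean nE, so Chebyshev's inequality makes both
errors vanish at rates arbitrarily close to E. -/

namespace SpinEntanglement

/-! ### Vectors and rank one operators -/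

section Vectors

variable {α β α' β' : Type}

/-- The squared norm of a vector. -/
noncomputable def sqNorm [Fintype α] (u : α → ℂ) : ℝ := ∑ x, ‖u x‖ ^ 2

/-- The product vector `u ⊗ v`. -/
def tensorVec (u : α → ℂ) (v : β → ℂ) : α × β → ℂ := fun x => u x.1 * v x.2

theorem star_dotProduct_self [Fintype α] (u : α → ℂ) : star u ⬝ᵥ u = (sqNorm u : ℂ) := by
  simp only [dotProduct, sqNorm, Pi.star_apply, RCLike.star_def, Complex.conj_mul']
  push_cast; rfl

theorem sqNorm_nonneg [Fintype α] (u : α → ℂ) : 0 ≤ sqNorm u :=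
  Finset.sum_nonneg fun _ _ => by positivity

theorem sqNorm_eq_zero [Fintype α] {u : α → ℂ} (h : sqNorm u = 0) : u = 0 := by
  funext x
  have := (Finset.sum_eq_zero_iff_of_nonneg (fun _ _ => by positivity)).1 h x (Finset.mem_univ x)
  simpa using this

theorem isUnitVector_iff [Fintype α] (u : α → ℂ) : IsUnitVector u ↔ sqNorm u = 1 := by
  rw [IsUnitVector, star_dotProduct_self]; norm_cast

theorem sqNorm_smul [Fintype α] (c : ℂ) (u : α → ℂ) : sqNorm (c • u) = ‖c‖ ^ 2 * sqNorm u := by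
  simp [sqNorm, mul_pow, Finset.mul_sum]

theorem norm_dotProduct_comm [Fintype α] (u v : α → ℂ) :
    ‖star u ⬝ᵥ v‖ = ‖star v ⬝ᵥ u‖ := by
  rw [← norm_star (star v ⬝ᵥ u), Matrix.star_dotProduct]

theorem norm_sum_mul_sq_le {ι : Type} (s : Finset ι) (a b : ι → ℂ) :
    ‖∑ i ∈ s, a i * b i‖ ^ 2 ≤ (∑ i ∈ s, ‖a i‖ ^ 2) * ∑ i ∈ s, ‖b i‖ ^ 2 := by
  refine le_trans ?_ (Finset.sum_mul_sq_le_sq_mul_sq s (fun i => ‖a i‖) fun i => ‖b i‖)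
  gcongr
  simpa using norm_sum_le s fun i => a i * b i

theorem norm_sum_sq_le {ι : Type} (s : Finset ι) (a : ι → ℂ) :
    ‖∑ i ∈ s, a i‖ ^ 2 ≤ s.card * ∑ i ∈ s, ‖a i‖ ^ 2 := by
  simpa using norm_sum_mul_sq_le s (fun _ => 1) a

theorem pureState_mulVec [Fintype α] (ψ φ : α → ℂ) :
    pureState ψ *ᵥ φ = (star ψ ⬝ᵥ φ) • ψ := by
  rw [pureState, Matrix.vecMulVec_mulVec]; ext; simp [mul_comm]

theorem expect_pureState [Fintype α] (ψ φ : α → ℂ) :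
    star φ ⬝ᵥ (pureState ψ *ᵥ φ) = ((‖star φ ⬝ᵥ ψ‖ ^ 2 : ℝ) : ℂ) := by
  rw [pureState_mulVec, dotProduct_smul, smul_eq_mul,
    show star ψ ⬝ᵥ φ = star (star φ ⬝ᵥ ψ) by
      rw [Matrix.star_dotProduct],
    RCLike.star_def, Complex.conj_mul']
  push_cast; rfl

theorem trace_mul_pureState [Fintype α] (Y : Matrix α α ℂ) (ψ : α → ℂ) :
    (Y * pureState ψ).trace = star ψ ⬝ᵥ (Y *ᵥ ψ) := by
  rw [pureState, Matrix.mul_vecMulVec, Matrix.trace_vecMulVec, dotProduct_comm]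

theorem trace_pureState_mul [Fintype α] (Y : Matrix α α ℂ) (ψ : α → ℂ) :
    (pureState ψ * Y).trace = star ψ ⬝ᵥ (Y *ᵥ ψ) := by
  rw [Matrix.trace_mul_comm, trace_mul_pureState]

theorem trace_pureState [Fintype α] (ψ : α → ℂ) : (pureState ψ).trace = (sqNorm ψ : ℂ) := by
  rw [pureState, Matrix.trace_vecMulVec, dotProduct_comm, star_dotProduct_self]

theorem posSemidef_pureState [Fintype α] (ψ : α → ℂ) : (pureState ψ).PosSemidef :=
  Matrix.posSemidef_vecMulVec_self_star ψ

theorem pureState_smul (c : ℂ) (ψ : α → ℂ) :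
    pureState (c • ψ) = ((‖c‖ ^ 2 : ℝ) : ℂ) • pureState ψ := by
  ext i j
  have := Complex.mul_conj' c
  simp only [pureState, Matrix.vecMulVec_apply, Pi.smul_apply, Pi.star_apply, smul_eq_mul,
    Matrix.smul_apply, star_mul', RCLike.star_def]
  push_cast
  rw [← this]; ring

theorem pureState_zero : pureState (0 : α → ℂ) = 0 := by
  ext; simp [pureState, Matrix.vecMulVec_apply]

theorem isState_pureState [Fintype α] {ψ : α → ℂ} (h : IsUnitVector ψ) : IsState (pureState ψ) :=
  ⟨posSemidef_pureState ψ, by rw [trace_pureState, (isUnitVector_iff ψ).1 h]; simp⟩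

theorem star_tensorVec_dotProduct [Fintype α] [Fintype β] (a c : α → ℂ) (b d : β → ℂ) :
    star (tensorVec a b) ⬝ᵥ tensorVec c d = (star a ⬝ᵥ c) * (star b ⬝ᵥ d) := by
  simp only [dotProduct, tensorVec, Fintype.sum_prod_type, Finset.sum_mul_sum, Pi.star_apply,
    star_mul']
  exact Finset.sum_congr rfl fun _ _ => Finset.sum_congr rfl fun _ _ => by ring

theorem sqNorm_tensorVec [Fintype α] [Fintype β] (a : α → ℂ) (b : β → ℂ) :
    sqNorm (tensorVec a b) = sqNorm a * sqNorm b := by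
  have := star_tensorVec_dotProduct a a b b
  simp only [star_dotProduct_self] at this
  exact_mod_cast this

theorem kronecker_mulVec_tensorVec [Fintype α] [Fintype β] (A : Matrix α' α ℂ) (B : Matrix β' β ℂ)
    (a : α → ℂ) (b : β → ℂ) :
    (A ⊗ₖ B) *ᵥ tensorVec a b = tensorVec (A *ᵥ a) (B *ᵥ b) := by
  ext x
  simp only [Matrix.mulVec, dotProduct, tensorVec, Matrix.kroneckerMap_apply,
    Fintype.sum_prod_type, Finset.sum_mul_sum]
  exact Finset.sum_congr rfl fun _ _ => Finset.sum_congr rfl fun _ _ => by ring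

theorem pureState_tensorVec (a : α → ℂ) (b : β → ℂ) :
    pureState (tensorVec a b) = pureState a ⊗ₖ pureState b := by
  ext x y
  simp only [pureState, Matrix.vecMulVec_apply, tensorVec, Matrix.kroneckerMap_apply,
    Pi.star_apply, star_mul']
  ring

theorem mul_pureState_mul [Fintype α] (A : Matrix α' α ℂ) (ψ : α → ℂ) :
    A * pureState ψ * Aᴴ = pureState (A *ᵥ ψ) := by
  rw [pureState, Matrix.mul_vecMulVec, Matrix.vecMulVec_mul, ← Matrix.star_mulVec, pureState]

theorem branch_pureState [Fintype α] [Fintype β] (A : Matrix α' α ℂ) (B : Matrix β' β ℂ)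
    (ψ : α × β → ℂ) : branch A B (pureState ψ) = pureState ((A ⊗ₖ B) *ᵥ ψ) :=
  mul_pureState_mul _ _

theorem branch_sum_smul [Fintype α] [Fintype β] {ι : Type} (s : Finset ι) (A : Matrix α' α ℂ)
    (B : Matrix β' β ℂ) (c : ι → ℂ) (ρ : ι → Matrix (α × β) (α × β) ℂ) :
    branch A B (∑ i ∈ s, c i • ρ i) = ∑ i ∈ s, c i • branch A B (ρ i) := by
  simp [branch, Matrix.mul_sum, Matrix.sum_mul]

theorem dotProduct_sum_smul_mulVec [Fintype α] {ι : Type} (s : Finset ι) (c : ι → ℂ)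
    (ρ : ι → Matrix α α ℂ) (u v : α → ℂ) :
    u ⬝ᵥ ((∑ i ∈ s, c i • ρ i) *ᵥ v) = ∑ i ∈ s, c i * (u ⬝ᵥ (ρ i *ᵥ v)) := by
  simp [Matrix.sum_mulVec, dotProduct_sum, Matrix.smul_mulVec]

/-- Only a resolution of the identity is asked of `u`; zero vectors are allowed, so the padded
families of `SectorBasis` qualify. -/
theorem sum_expect_eq_trace [Fintype α] [DecidableEq α] {ι : Type} [Fintype ι]
    {u : ι → α → ℂ} (hu : ∑ i, pureState (u i) = 1) (Y : Matrix α α ℂ) :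
    ∑ i, star (u i) ⬝ᵥ (Y *ᵥ u i) = Y.trace := by
  simp only [← trace_mul_pureState, ← Matrix.trace_sum, ← Matrix.mul_sum, hu, mul_one]

theorem sum_norm_dotProduct_sq [Fintype α] [DecidableEq α] {ι : Type} [Fintype ι]
    {u : ι → α → ℂ} (hu : ∑ i, pureState (u i) = 1) (φ : α → ℂ) :
    ∑ i, ‖star (u i) ⬝ᵥ φ‖ ^ 2 = sqNorm φ := by
  have := sum_expect_eq_trace hu (pureState φ)
  simp only [expect_pureState, trace_pureState] at this
  exact_mod_cast this

end Vectors

/-! ### Spectral decomposition -/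

section Spectral

theorem expect_eigenvector {α : Type} [Fintype α] {X : Matrix α α ℂ} {c : ℝ} {u : α → ℂ} (h : X *ᵥ u = (c : ℂ) • u)
    (hu : sqNorm u = 1) : star u ⬝ᵥ (X *ᵥ u) = c := by
  rw [h, dotProduct_smul, star_dotProduct_self, hu]; simp

theorem eigenvalue_nonneg {α : Type} [Fintype α] {X : Matrix α α ℂ} (hX : X.PosSemidef) {c : ℝ} {u : α → ℂ}
    (h : X *ᵥ u = (c : ℂ) • u) (hu : sqNorm u = 1) : 0 ≤ c := by
  have := hX.dotProduct_mulVec_nonneg u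
  rw [expect_eigenvector h hu] at this
  exact_mod_cast this

variable {α : Type} [Fintype α] [DecidableEq α]

/-- Every Hermitian matrix has an orthonormal eigenbasis, in which its functional calculus is
computed. -/
theorem exists_eigenbasis {X : Matrix α α ℂ} (hX : X.IsHermitian) :
    ∃ (ev : α → ℝ) (u : α → α → ℂ), (∀ i, X *ᵥ u i = (ev i : ℂ) • u i) ∧
      (∀ i, sqNorm (u i) = 1) ∧ ∑ i, pureState (u i) = 1 ∧
      ∀ f : ℝ → ℝ, cfc f X = ∑ i, ((f (ev i) : ℝ) : ℂ) • pureState (u i) := by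
  have key : ∀ f : ℝ → ℝ, cfc f X =
      ∑ i, ((f (hX.eigenvalues i) : ℝ) : ℂ) • pureState (hX.eigenvectorBasis i : α → ℂ) := by
    intro f
    rw [hX.cfc_eq f, Matrix.IsHermitian.cfc, Unitary.conjStarAlgAut_apply]
    ext a b
    rw [Matrix.mul_apply]
    simp only [Matrix.mul_diagonal, Matrix.sum_apply, Matrix.smul_apply,
      pureState, Matrix.vecMulVec_apply, Matrix.star_apply, Function.comp_apply,
      Matrix.IsHermitian.eigenvectorUnitary_apply, Pi.star_apply, smul_eq_mul]
    refine Finset.sum_congr rfl fun i _ => ?_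
    simp; ring
  refine ⟨hX.eigenvalues, fun i => hX.eigenvectorBasis i, ?_, ?_, ?_, key⟩
  · intro i
    simpa using hX.mulVec_eigenvectorBasis i
  · intro i
    have := (hX.eigenvectorBasis).orthonormal.1 i
    rw [EuclideanSpace.norm_eq, Real.sqrt_eq_one] at this
    exact this
  -- Completeness of the eigenbasis is the functional calculus of the constant function 1.
  · have := key (fun _ => 1)
    rw [cfc_const_one ℝ X hX.isSelfAdjoint] at this
    simpa using this.symm

theorem eq_sum_of_cfc {X : Matrix α α ℂ} (hX : X.IsHermitian) {ev : α → ℝ} {u : α → α → ℂ}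
    (h : ∀ f : ℝ → ℝ, cfc f X = ∑ i, ((f (ev i) : ℝ) : ℂ) • pureState (u i)) :
    X = ∑ i, (ev i : ℂ) • pureState (u i) := by
  have := h id
  rwa [cfc_id ℝ X hX.isSelfAdjoint] at this

/-- The functional calculus acts on eigenvectors through the eigenvalue. -/
theorem cfc_mulVec_eigenvector {X : Matrix α α ℂ} (hX : X.IsHermitian) (f : ℝ → ℝ) {c : ℝ}
    {v : α → ℂ} (h : X *ᵥ v = (c : ℂ) • v) : cfc f X *ᵥ v = ((f c : ℝ) : ℂ) • v := by
  obtain ⟨ev, u, hu, -, h1, hf⟩ := exists_eigenbasis hX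
  -- `v` has no component along eigenvectors of eigenvalue other than `c`, so `f (ev i)` may be
  -- replaced by `f c` in every component.
  have hv : ∀ i, (star (u i) ⬝ᵥ v) * ((f (ev i) : ℝ) : ℂ) =
      (star (u i) ⬝ᵥ v) * ((f c : ℝ) : ℂ) := by
    intro i
    have e : (ev i : ℂ) * (star (u i) ⬝ᵥ v) = c * (star (u i) ⬝ᵥ v) := by
      have h2 : star (u i) ⬝ᵥ (X *ᵥ v) = star (X *ᵥ u i) ⬝ᵥ v := by
        rw [Matrix.star_mulVec, hX.eq, Matrix.dotProduct_mulVec]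
      rw [h, hu, dotProduct_smul, star_smul, smul_dotProduct] at h2
      simpa using h2.symm
    by_cases h0 : star (u i) ⬝ᵥ v = 0
    · simp [h0]
    · rw [show ev i = c by exact_mod_cast mul_right_cancel₀ h0 e]
  have hv1 : v = ∑ i, (star (u i) ⬝ᵥ v) • u i := by
    conv_lhs => rw [← Matrix.one_mulVec v, ← h1, Matrix.sum_mulVec]
    simp [pureState_mulVec]
  rw [hf, Matrix.sum_mulVec]
  conv_rhs => rw [hv1, Finset.smul_sum]
  refine Finset.sum_congr rfl fun i _ => ?_
  rw [Matrix.smul_mulVec, pureState_mulVec, smul_smul, smul_smul, mul_comm, hv, mul_comm]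

theorem traceNorm_eq_sum {X : Matrix α α ℂ} {ev : α → ℝ} {u : α → α → ℂ}
    (hu1 : ∀ i, sqNorm (u i) = 1)
    (h : ∀ f : ℝ → ℝ, cfc f X = ∑ i, ((f (ev i) : ℝ) : ℂ) • pureState (u i)) :
    traceNorm X = ∑ i, |ev i| := by
  simp [traceNorm, h, Matrix.trace_sum, trace_pureState, hu1]

theorem entropy_eq_sum {X : Matrix α α ℂ} {ev : α → ℝ} {u : α → α → ℂ}
    (hu1 : ∀ i, sqNorm (u i) = 1)
    (h : ∀ f : ℝ → ℝ, cfc f X = ∑ i, ((f (ev i) : ℝ) : ℂ) • pureState (u i)) :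
    entropy X = ∑ i, Real.negMulLog (ev i) := by
  simp [entropy, h, Matrix.trace_sum, trace_pureState, hu1]

/-- In an eigenbasis of `X - Y` each eigenvalue is a difference of two nonnegative expectations,
whose absolute value is at most their sum. -/
theorem traceNorm_sub_le {X Y : Matrix α α ℂ} (hX : X.PosSemidef) (hY : Y.PosSemidef) :
    traceNorm (X - Y) ≤ X.trace.re + Y.trace.re := by
  obtain ⟨ev, u, hu, hu1, h1, hf⟩ := exists_eigenbasis (hX.isHermitian.sub hY.isHermitian)
  rw [traceNorm_eq_sum hu1 hf, ← sum_expect_eq_trace h1 X, ← sum_expect_eq_trace h1 Y,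
    Complex.re_sum, Complex.re_sum, ← Finset.sum_add_distrib]
  refine Finset.sum_le_sum fun i _ => ?_
  have e := congrArg Complex.re (expect_eigenvector (hu i) (hu1 i))
  rw [Matrix.sub_mulVec, dotProduct_sub, Complex.sub_re, Complex.ofReal_re] at e
  have hx := (Complex.le_def.1 (hX.dotProduct_mulVec_nonneg (u i))).1
  have hy := (Complex.le_def.1 (hY.dotProduct_mulVec_nonneg (u i))).1
  simp only [Complex.zero_re] at hx hy
  rw [← e, abs_le]
  constructor <;> linarith

/-- The expectations of a Hermitian matrix, summed over a family of vectors obeying the Bessel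
inequality, differ from zero by at most the trace norm. -/
theorem sum_expect_le_traceNorm {X : Matrix α α ℂ} (hX : X.IsHermitian) {ι : Type} (s : Finset ι)
    (ψ : ι → α → ℂ) (hψ : ∀ φ : α → ℂ, ∑ i ∈ s, ‖star (ψ i) ⬝ᵥ φ‖ ^ 2 ≤ sqNorm φ) :
    -traceNorm X ≤ ∑ i ∈ s, (star (ψ i) ⬝ᵥ (X *ᵥ ψ i)).re := by
  obtain ⟨ev, u, hu, hu1, h1, hf⟩ := exists_eigenbasis hX
  rw [traceNorm_eq_sum hu1 hf]
  have e : ∑ i ∈ s, (star (ψ i) ⬝ᵥ (X *ᵥ ψ i)).re =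
      ∑ n, ev n * ∑ i ∈ s, ‖star (ψ i) ⬝ᵥ u n‖ ^ 2 := by
    simp_rw [Finset.mul_sum]
    rw [Finset.sum_comm]
    refine Finset.sum_congr rfl fun i _ => ?_
    conv_lhs => rw [eq_sum_of_cfc hX hf]
    rw [dotProduct_sum_smul_mulVec]
    simp only [expect_pureState, ← Complex.ofReal_mul, ← Complex.ofReal_sum, Complex.ofReal_re]
  -- The sum is now ∑ ev n · p n with 0 ≤ p n ≤ 1, the upper bound being the Bessel inequality for a
  -- unit eigenvector.
  rw [e, ← Finset.sum_neg_distrib]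
  refine Finset.sum_le_sum fun n _ => ?_
  have h2 := hψ (u n)
  rw [hu1] at h2
  have h3 : 0 ≤ ∑ i ∈ s, ‖star (ψ i) ⬝ᵥ u n‖ ^ 2 := Finset.sum_nonneg fun _ _ => by positivity
  nlinarith [neg_abs_le (ev n), abs_nonneg (ev n)]

end Spectral

end SpinEntanglement

namespace SpinEntanglement

/-! ### Protocols -/

section Protocols

variable {α β α' β' : Type}

theorem sum_sqNorm_mulVec [Fintype α] [DecidableEq α] [Fintype α'] {κ : Type} [Fintype κ]
    {K : κ → Matrix α' α ℂ} (hK : ∑ k, (K k)ᴴ * K k = 1) (v : α → ℂ) :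
    ∑ k, sqNorm (K k *ᵥ v) = sqNorm v := by
  have h : star v ⬝ᵥ ((∑ k, (K k)ᴴ * K k) *ᵥ v) = (sqNorm v : ℂ) := by
    rw [hK, Matrix.one_mulVec, star_dotProduct_self]
  rw [Matrix.sum_mulVec, dotProduct_sum] at h
  have h2 : ∀ k, star v ⬝ᵥ (((K k)ᴴ * K k) *ᵥ v) = (sqNorm (K k *ᵥ v) : ℂ) := by
    intro k
    rw [← star_dotProduct_self, Matrix.star_mulVec, ← Matrix.dotProduct_mulVec,
      Matrix.mulVec_mulVec]
  simp only [h2] at h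
  exact_mod_cast h

/-- The constructors do not ask for finiteness of the earlier records; it is recovered so that
inductions can sum over them. -/
theorem IsLOCC.finite [DecidableEq α] [DecidableEq β] {ι : Type} {A : ι → Matrix α' α ℂ}
    {B : ι → Matrix β' β ℂ} (h : IsLOCC A B) : Finite ι := by
  induction h with
  | start => infer_instance
  | alice _ _ _ ih => infer_instance
  | bob _ _ _ ih => infer_instance

theorem sum_kronecker {ι m n m' n' : Type} [Fintype ι] (X : ι → Matrix m n ℂ)
    (Y : Matrix m' n' ℂ) : ∑ i, X i ⊗ₖ Y = (∑ i, X i) ⊗ₖ Y := by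
  ext; simp [Matrix.sum_apply, Finset.sum_mul]

theorem kronecker_sum {ι m n m' n' : Type} [Fintype ι] (X : Matrix m n ℂ)
    (Y : ι → Matrix m' n' ℂ) : ∑ i, X ⊗ₖ Y i = X ⊗ₖ (∑ i, Y i) := by
  ext; simp [Matrix.sum_apply, Finset.mul_sum]

theorem sum_conjTranspose_mul_mul {κ γ δ ε : Type} [Fintype κ] [Fintype γ] [Fintype δ]
    [DecidableEq δ] {K : κ → Matrix γ δ ℂ} (hK : ∑ k, (K k)ᴴ * K k = 1) (A : Matrix δ ε ℂ) :
    ∑ k, (K k * A)ᴴ * (K k * A) = Aᴴ * A := by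
  have : ∀ k, (K k * A)ᴴ * (K k * A) = Aᴴ * ((K k)ᴴ * K k) * A := fun k => by
    rw [Matrix.conjTranspose_mul]; simp only [Matrix.mul_assoc]
  simp only [this, ← Matrix.sum_mul, ← Matrix.mul_sum, hK, Matrix.mul_one]

/-- A round splits each term into terms with the same sum, because the local measurement is
complete. The `Fintype` instances are quantified after the colon since the types they belong to
change along the induction. -/
theorem IsLOCC.sum_eq_one [fα : Fintype α] [DecidableEq α] [fβ : Fintype β] [DecidableEq β]
    {ι : Type} {A : ι → Matrix α' α ℂ} {B : ι → Matrix β' β ℂ} (h : IsLOCC A B) :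
    ∀ [Fintype ι] [Fintype α'] [Fintype β'],
      ∑ i, ((A i)ᴴ * A i) ⊗ₖ ((B i)ᴴ * B i) = 1 := by
  induction h with
  | start =>
    intro _ i2 i3
    obtain rfl : i2 = fα := Subsingleton.elim _ _
    obtain rfl : i3 = fβ := Subsingleton.elim _ _
    simp
  | @alice ι κ α' α'' β' _ _ _ i3 A B h K hK ih =>
    intro i1 i2 _
    have := h.finite
    have := Fintype.ofFinite ι
    obtain rfl : i1 = instFintypeProd ι κ := Subsingleton.elim _ _
    obtain rfl : i2 = i3 := Subsingleton.elim _ _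
    rw [← ih, Fintype.sum_prod_type]
    refine Finset.sum_congr rfl fun i _ => ?_
    change ∑ k, ((K i k * A i)ᴴ * (K i k * A i)) ⊗ₖ ((B i)ᴴ * B i) = _
    rw [sum_kronecker, sum_conjTranspose_mul_mul (hK i)]
  | @bob ι κ α' β' β'' _ _ _ i3 A B h K hK ih =>
    intro i1 _ i2
    have := h.finite
    have := Fintype.ofFinite ι
    obtain rfl : i1 = instFintypeProd ι κ := Subsingleton.elim _ _
    obtain rfl : i2 = i3 := Subsingleton.elim _ _
    rw [← ih, Fintype.sum_prod_type]
    refine Finset.sum_congr rfl fun i _ => ?_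
    change ∑ k, ((A i)ᴴ * A i) ⊗ₖ ((K i k * B i)ᴴ * (K i k * B i)) = _
    rw [kronecker_sum, sum_conjTranspose_mul_mul (hK i)]

/-- An LOCC protocol preserves norms on average. -/
theorem IsLOCC.sum_sqNorm [Fintype α] [DecidableEq α] [Fintype β] [DecidableEq β]
    {ι : Type} {A : ι → Matrix α' α ℂ} {B : ι → Matrix β' β ℂ} (h : IsLOCC A B)
    [Fintype ι] [Fintype α'] [Fintype β'] (ψ : α × β → ℂ) :
    ∑ i, sqNorm ((A i ⊗ₖ B i) *ᵥ ψ) = sqNorm ψ := by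
  refine sum_sqNorm_mulVec ?_ ψ
  rw [← h.sum_eq_one]
  refine Finset.sum_congr rfl fun i _ => ?_
  rw [Matrix.conjTranspose_kronecker, Matrix.mul_kronecker_mul]

/-- A measurement by Alice, followed by a measurement by Bob that depends on her outcome. -/
theorem isLOCC_measurements [Fintype α] [DecidableEq α] [Fintype β] [DecidableEq β]
    [Fintype α'] [Fintype β'] [DecidableEq α'] {κ κ' : Type} [Fintype κ] [Fintype κ']
    (K : κ → Matrix α' α ℂ) (hK : ∑ k, (K k)ᴴ * K k = 1)
    (L : κ → κ' → Matrix β' β ℂ) (hL : ∀ k, ∑ k', (L k k')ᴴ * L k k' = 1) :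
    IsLOCC (fun x : (Unit × κ) × κ' => K x.1.2) (fun x : (Unit × κ) × κ' => L x.1.2 x.2) := by
  have h := (IsLOCC.start (α := α) (β := β)).alice (fun _ => K) (fun _ => hK)
  have h' := h.bob (fun x => L x.2) (fun x => hL x.2)
  simpa only [Matrix.mul_one] using h'

theorem loccConvertible_measurements [Fintype α] [DecidableEq α] [Fintype β] [DecidableEq β]
    [Fintype α'] [Fintype β'] [DecidableEq α'] {κ κ' : Type} [Fintype κ] [Fintype κ']
    (K : κ → Matrix α' α ℂ) (hK : ∑ k, (K k)ᴴ * K k = 1)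
    (L : κ → κ' → Matrix β' β ℂ) (hL : ∀ k, ∑ k', (L k k')ᴴ * L k k' = 1)
    (ρ : Matrix (α × β) (α × β) ℂ) :
    LOCCConvertible ρ (∑ k, ∑ k', branch (K k) (L k k') ρ) :=
  ⟨_, inferInstance, _, _, isLOCC_measurements K hK L hL, by simp [Fintype.sum_prod_type]⟩

theorem posSemidef_branch [Fintype α] [Fintype β] [Fintype α'] [Fintype β']
    (A : Matrix α' α ℂ) (B : Matrix β' β ℂ) {ρ : Matrix (α × β) (α × β) ℂ} (h : ρ.PosSemidef) :
    (branch A B ρ).PosSemidef :=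
  h.mul_mul_conjTranspose_same _

theorem LOCCConvertible.posSemidef [Fintype α] [DecidableEq α] [Fintype β] [DecidableEq β]
    [Fintype α'] [Fintype β'] {ρ : Matrix (α × β) (α × β) ℂ} {τ : Matrix (α' × β') (α' × β') ℂ}
    (h : LOCCConvertible ρ τ) (hρ : ρ.PosSemidef) : τ.PosSemidef := by
  obtain ⟨ι, _, A, B, -, rfl⟩ := h
  exact Matrix.posSemidef_sum _ fun i _ => posSemidef_branch _ _ hρ

end Protocols

/-! ### Ensembles with arbitrary finite index sets -/

section Ensembles

variable {α β : Type} [Fintype α] [DecidableEq α] [Fintype β] [DecidableEq β]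

omit [DecidableEq β] in
theorem mem_formationValues {ι : Type} [Fintype ι] (p : ι → ℝ) (ψ : ι → α × β → ℂ)
    (hp : ∀ i, 0 < p i) (hp1 : ∑ i, p i = 1) (hψ : ∀ i, IsUnitVector (ψ i)) :
    ∑ i, p i * pureEntanglement (ψ i) ∈ formationValues (∑ i, (p i : ℂ) • pureState (ψ i)) := by
  let e := (Fintype.equivFin ι).symm
  refine ⟨Fintype.card ι, p ∘ e, ψ ∘ e, fun i => hp _, ?_, fun i => hψ _, ?_, ?_⟩
  · rw [← hp1]; exact e.sum_comp p
  · exact (e.sum_comp fun i => (p i : ℂ) • pureState (ψ i)).symm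
  · exact (e.sum_comp fun i => p i * pureEntanglement (ψ i)).symm

omit [DecidableEq α] [DecidableEq β] in
theorem isSeparable_sum {ι : Type} [Fintype ι] (p : ι → ℝ) (σA : ι → Matrix α α ℂ)
    (σB : ι → Matrix β β ℂ) (hp : ∀ i, 0 < p i) (hp1 : ∑ i, p i = 1) (hA : ∀ i, IsState (σA i))
    (hB : ∀ i, IsState (σB i)) : IsSeparable (∑ i, (p i : ℂ) • (σA i ⊗ₖ σB i)) := by
  let e := (Fintype.equivFin ι).symm
  refine ⟨Fintype.card ι, p ∘ e, σA ∘ e, σB ∘ e, fun i => hp _, ?_, fun i => hA _,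
    fun i => hB _, ?_⟩
  · rw [← hp1]; exact e.sum_comp p
  · exact (e.sum_comp fun i => (p i : ℂ) • (σA i ⊗ₖ σB i)).symm

theorem IsEntanglementMeasure.sum_le
    {E : ∀ {α β : Type} [Fintype α] [DecidableEq α] [Fintype β] [DecidableEq β],
      Matrix (α × β) (α × β) ℂ → ℝ} (hE : IsEntanglementMeasure E) {ι : Type} [Fintype ι]
    (p : ι → ℝ) (ψ : ι → α × β → ℂ)
    (hp : ∀ i, 0 ≤ p i) (hp1 : ∑ i, p i = 1) (hψ : ∀ i, IsUnitVector (ψ i)) :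
    E (∑ i, (p i : ℂ) • pureState (ψ i)) ≤ ∑ i, p i * pureEntanglement (ψ i) := by
  let e := (Fintype.equivFin ι).symm
  have h := hE.convex (Fintype.card ι) (p ∘ e) (fun i => pureState (ψ (e i))) (fun i => hp _)
    (by rw [← hp1]; exact e.sum_comp p) (fun i => isState_pureState (hψ _))
  have e1 := e.sum_comp fun i => (p i : ℂ) • pureState (ψ i)
  have e2 := e.sum_comp fun i => p i * E (pureState (ψ i))
  simp only [Function.comp_apply] at h
  rw [e1, e2] at h
  simpa only [hE.pure_eq _ (hψ _)] using h

end Ensembles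

end SpinEntanglement

namespace SpinEntanglement

/-! ### Orthonormal families -/

section Orthonormal

variable {α : Type} [Fintype α]

/-- Pythagoras for the projection onto the span. The equality matters beyond Bessel's inequality: a
zero defect shows that `φ` lies in the span. -/
theorem sqNorm_sub_sum {ι : Type} [DecidableEq ι] (s : Finset ι) (ψ : ι → α → ℂ)
    (hψ : ∀ i ∈ s, ∀ j ∈ s, star (ψ i) ⬝ᵥ ψ j = if i = j then 1 else 0) (φ : α → ℂ) :
    sqNorm (φ - ∑ i ∈ s, (star (ψ i) ⬝ᵥ φ) • ψ i) =
      sqNorm φ - ∑ i ∈ s, ‖star (ψ i) ⬝ᵥ φ‖ ^ 2 := by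
  set P := ∑ i ∈ s, (star (ψ i) ⬝ᵥ φ) • ψ i with hP
  have hc : ∀ i, star φ ⬝ᵥ ψ i = star (star (ψ i) ⬝ᵥ φ) := fun i => by
    rw [Matrix.star_dotProduct]
  have h1 : star φ ⬝ᵥ P = ((∑ i ∈ s, ‖star (ψ i) ⬝ᵥ φ‖ ^ 2 : ℝ) : ℂ) := by
    rw [hP, dotProduct_sum]
    push_cast
    refine Finset.sum_congr rfl fun i _ => ?_
    rw [dotProduct_smul, hc, smul_eq_mul, RCLike.star_def, Complex.mul_conj']
  have h2 : star P ⬝ᵥ φ = ((∑ i ∈ s, ‖star (ψ i) ⬝ᵥ φ‖ ^ 2 : ℝ) : ℂ) := by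
    have e := congrArg star h1
    rwa [Matrix.star_dotProduct, star_star, RCLike.star_def, Complex.conj_ofReal] at e
  have h3 : star P ⬝ᵥ P = ((∑ i ∈ s, ‖star (ψ i) ⬝ᵥ φ‖ ^ 2 : ℝ) : ℂ) := by
    conv_lhs => rw [hP]
    rw [star_sum, sum_dotProduct]
    push_cast
    refine Finset.sum_congr rfl fun i hi => ?_
    rw [star_smul, smul_dotProduct, dotProduct_sum, Finset.sum_eq_single i]
    · rw [dotProduct_smul, hψ i hi i hi, if_pos rfl]
      simp only [smul_eq_mul, mul_one, RCLike.star_def, Complex.conj_mul']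
    · intro j hj hne
      rw [dotProduct_smul, hψ i hi j hj, if_neg hne.symm, smul_zero]
    · exact fun h => absurd hi h
  have h4 : ((sqNorm (φ - P) : ℝ) : ℂ) =
      ((sqNorm φ - ∑ i ∈ s, ‖star (ψ i) ⬝ᵥ φ‖ ^ 2 : ℝ) : ℂ) := by
    rw [← star_dotProduct_self, star_sub, sub_dotProduct, dotProduct_sub, dotProduct_sub, h1, h2,
      h3, star_dotProduct_self]
    push_cast; ring
  exact_mod_cast h4

theorem bessel {ι : Type} [DecidableEq ι] (s : Finset ι) (ψ : ι → α → ℂ)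
    (hψ : ∀ i ∈ s, ∀ j ∈ s, star (ψ i) ⬝ᵥ ψ j = if i = j then 1 else 0) (φ : α → ℂ) :
    ∑ i ∈ s, ‖star (ψ i) ⬝ᵥ φ‖ ^ 2 ≤ sqNorm φ := by
  have := sqNorm_nonneg (φ - ∑ i ∈ s, (star (ψ i) ⬝ᵥ φ) • ψ i)
  rw [sqNorm_sub_sum s ψ hψ] at this
  linarith

end Orthonormal

/-! ### Mixtures of maximally entangled states of locally orthogonal sectors -/

/-- An orthonormal basis of `α → ℂ` that is grouped into sectors `i : I`; the basis vectors of
sector `i` are the `vec i t` with `t ∈ supp i`, while `vec i t = 0` for other `t`. -/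
structure SectorBasis (α I T : Type) [Fintype α] [DecidableEq α] [Fintype I] [DecidableEq I]
    [Fintype T] [DecidableEq T] where
  vec : I → T → α → ℂ
  supp : I → Finset T
  inner_vec : ∀ i t i' t', star (vec i t) ⬝ᵥ vec i' t' =
    if i = i' ∧ t = t' ∧ t ∈ supp i then 1 else 0
  complete : ∑ x : I × T, pureState (vec x.1 x.2) = 1

section Sectors

variable {α β I K T : Type} [Fintype α] [DecidableEq α] [Fintype β] [DecidableEq β]
  [Fintype I] [DecidableEq I] [Fintype K] [DecidableEq K] [Fintype T] [DecidableEq T]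

namespace SectorBasis

variable (𝓐 : SectorBasis α I T) (𝓑 : SectorBasis β K T)

theorem vec_eq_zero {i : I} {t : T} (h : t ∉ 𝓐.supp i) : 𝓐.vec i t = 0 := by
  apply sqNorm_eq_zero
  have := 𝓐.inner_vec i t i t
  rw [star_dotProduct_self, if_neg (by simp [h])] at this
  exact_mod_cast this

theorem sqNorm_vec {i : I} {t : T} (h : t ∈ 𝓐.supp i) : sqNorm (𝓐.vec i t) = 1 := by
  have := 𝓐.inner_vec i t i t
  rw [star_dotProduct_self, if_pos ⟨rfl, rfl, h⟩] at this
  exact_mod_cast this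

theorem sum_norm_sq (φ : α → ℂ) : ∑ i, ∑ t, ‖star (𝓐.vec i t) ⬝ᵥ φ‖ ^ 2 = sqNorm φ := by
  rw [← sum_norm_dotProduct_sq 𝓐.complete, Fintype.sum_prod_type]

theorem sum_supp_norm_sq (φ : α → ℂ) :
    ∑ i, ∑ t ∈ 𝓐.supp i, ‖star (𝓐.vec i t) ⬝ᵥ φ‖ ^ 2 = sqNorm φ := by
  rw [← 𝓐.sum_norm_sq]
  refine Finset.sum_congr rfl fun i _ => Finset.sum_subset (Finset.subset_univ _) fun t _ ht => ?_
  simp [𝓐.vec_eq_zero ht]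

/-- The dimension of the sector `s.1`. -/
def dim (s : I × K) : ℕ := (𝓐.supp s.1).card

/-- The maximally entangled vector of the sectors `s.1` of Alice and `s.2` of Bob. -/
noncomputable def ent (s : I × K) : α × β → ℂ :=
  ((1 / √(𝓐.dim s : ℝ) : ℝ) : ℂ) •
    ∑ t ∈ 𝓐.supp s.1, tensorVec (𝓐.vec s.1 t) (𝓑.vec s.2 t)

theorem star_ent_dotProduct (s : I × K) (φ : α × β → ℂ) :
    star (𝓐.ent 𝓑 s) ⬝ᵥ φ = ((1 / √(𝓐.dim s : ℝ) : ℝ) : ℂ) *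
      ∑ t ∈ 𝓐.supp s.1, star (tensorVec (𝓐.vec s.1 t) (𝓑.vec s.2 t)) ⬝ᵥ φ := by
  rw [ent, star_smul, smul_dotProduct, star_sum, sum_dotProduct, RCLike.star_def,
    Complex.conj_ofReal, smul_eq_mul]

theorem norm_inv_sqrt_sq (d : ℕ) : ‖((1 / √(d : ℝ) : ℝ) : ℂ)‖ ^ 2 = 1 / (d : ℝ) := by
  rw [Complex.norm_real, Real.norm_eq_abs, sq_abs, div_pow, Real.sq_sqrt (Nat.cast_nonneg _),
    one_pow]

theorem dim_mul_norm_sq (s : I × K) (φ : α × β → ℂ) :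
    𝓐.dim s * ‖star (𝓐.ent 𝓑 s) ⬝ᵥ φ‖ ^ 2 =
      ‖∑ t ∈ 𝓐.supp s.1, star (tensorVec (𝓐.vec s.1 t) (𝓑.vec s.2 t)) ⬝ᵥ φ‖ ^ 2 := by
  rw [star_ent_dotProduct, norm_mul, mul_pow, norm_inv_sqrt_sq]
  by_cases h : 𝓐.dim s = 0
  · have : 𝓐.supp s.1 = ∅ := Finset.card_eq_zero.1 h
    simp [this]
  · have : (𝓐.dim s : ℝ) ≠ 0 := by exact_mod_cast h
    field_simp

/-- The maximally entangled vectors are almost orthogonal to product vectors. -/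
theorem sum_dim_mul_norm_sq_le (a : α → ℂ) (b : β → ℂ) :
    ∑ s : I × K, 𝓐.dim s * ‖star (𝓐.ent 𝓑 s) ⬝ᵥ tensorVec a b‖ ^ 2 ≤ sqNorm a * sqNorm b := by
  rw [← 𝓐.sum_norm_sq, ← 𝓑.sum_norm_sq, Finset.sum_mul_sum, Fintype.sum_prod_type]
  refine Finset.sum_le_sum fun i _ => Finset.sum_le_sum fun k _ => ?_
  rw [dim_mul_norm_sq]
  simp only [star_tensorVec_dotProduct]
  -- The overlaps factorize, so Cauchy–Schwarz bounds the contribution of a pair of sectors by the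
  -- weight of `a` in one times the weight of `b` in the other.
  refine (norm_sum_mul_sq_le _ _ _).trans ?_
  gcongr <;> exact Finset.subset_univ _

end SectorBasis

/-- Probabilities of pairs of sectors of equal shape. -/
structure SectorWeights (𝓐 : SectorBasis α I T) (𝓑 : SectorBasis β K T) where
  w : I × K → ℝ
  nonneg : ∀ s, 0 ≤ w s
  sum_eq_one : ∑ s, w s = 1
  supp_eq : ∀ s, w s ≠ 0 → 𝓐.supp s.1 = 𝓑.supp s.2
  supp_nonempty : ∀ s, w s ≠ 0 → (𝓐.supp s.1).Nonempty

namespace SectorWeights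

variable {𝓐 : SectorBasis α I T} {𝓑 : SectorBasis β K T} (W : SectorWeights 𝓐 𝓑)

/-- The mixture of the maximally entangled states. -/
noncomputable def mixture : Matrix (α × β) (α × β) ℂ :=
  ∑ s, (W.w s : ℂ) • pureState (𝓐.ent 𝓑 s)

/-- The average degree of entanglement of the maximally entangled states. -/
noncomputable def value : ℝ := ∑ s, W.w s * Real.log (𝓐.dim s)

theorem dim_pos {s : I × K} (hs : W.w s ≠ 0) : 0 < 𝓐.dim s :=
  Finset.card_pos.2 (W.supp_nonempty s hs)

theorem pos {s : I × K} (hs : W.w s ≠ 0) : 0 < W.w s := lt_of_le_of_ne (W.nonneg s) hs.symm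

/-- A nonzero weight makes the two supports agree, so that no term of the diagonal sum is lost on
Bob's side. -/
theorem inner_ent_tensorVec {s : I × K} (hs : W.w s ≠ 0) (i : I) (k : K) (t u : T) :
    star (𝓐.ent 𝓑 s) ⬝ᵥ tensorVec (𝓐.vec i t) (𝓑.vec k u) =
      if s = (i, k) ∧ t = u ∧ t ∈ 𝓐.supp s.1 then ((1 / √(𝓐.dim s : ℝ) : ℝ) : ℂ) else 0 := by
  rw [SectorBasis.star_ent_dotProduct]
  simp only [star_tensorVec_dotProduct, 𝓐.inner_vec, 𝓑.inner_vec, ← W.supp_eq s hs]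
  split_ifs with h
  · obtain ⟨rfl, rfl, h⟩ := h
    rw [Finset.sum_eq_single t]
    · simp [h]
    · intro t' _ hne; simp [hne]
    · exact fun h' => absurd h h'
  · rw [Finset.sum_eq_zero, mul_zero]
    intro t' ht'
    rw [ite_zero_mul_ite_zero, mul_one, if_neg]
    rintro ⟨⟨h1, h2, h3⟩, h4, h5, h6⟩
    exact h ⟨Prod.ext h1 h4, h2.symm.trans h5, h2 ▸ h3⟩

theorem inner_tensorVec_ent {s : I × K} (hs : W.w s ≠ 0) (i : I) (k : K) (t u : T) :
    star (tensorVec (𝓐.vec i t) (𝓑.vec k u)) ⬝ᵥ 𝓐.ent 𝓑 s =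
      if s = (i, k) ∧ t = u ∧ t ∈ 𝓐.supp s.1 then ((1 / √(𝓐.dim s : ℝ) : ℝ) : ℂ) else 0 := by
  rw [Matrix.star_dotProduct, W.inner_ent_tensorVec hs]
  split_ifs <;> simp

/-- A nonzero weight is required of one index only: distinct pairs are orthogonal already through
their sectors. -/
theorem inner_ent {s : I × K} (hs : W.w s ≠ 0) (s' : I × K) :
    star (𝓐.ent 𝓑 s) ⬝ᵥ 𝓐.ent 𝓑 s' = if s = s' then 1 else 0 := by
  nth_rw 2 [SectorBasis.ent]
  rw [dotProduct_smul, dotProduct_sum]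
  simp only [W.inner_ent_tensorVec hs]
  split_ifs with h
  · subst h
    have hd : (0 : ℝ) < 𝓐.dim s := by exact_mod_cast W.dim_pos hs
    rw [Finset.sum_congr rfl fun t ht => if_pos (by simpa using ht), Finset.sum_const, smul_eq_mul,
      nsmul_eq_mul, show ((𝓐.supp s.1).card : ℂ) = ((𝓐.dim s : ℝ) : ℂ) by
        rw [SectorBasis.dim]; simp]
    have e : (1 / √(𝓐.dim s : ℝ)) * (𝓐.dim s * (1 / √(𝓐.dim s : ℝ))) = 1 := by
      have := Real.mul_self_sqrt hd.le
      have h0 : √(𝓐.dim s : ℝ) ≠ 0 := (Real.sqrt_pos.2 hd).ne'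
      field_simp; nlinarith
    rw [← Complex.ofReal_mul, ← Complex.ofReal_mul, e, Complex.ofReal_one]
  · rw [Finset.sum_eq_zero, smul_zero]
    intro t _
    exact if_neg fun h' => h h'.1

theorem isUnitVector_ent {s : I × K} (hs : W.w s ≠ 0) : IsUnitVector (𝓐.ent 𝓑 s) := by
  rw [IsUnitVector, W.inner_ent hs, if_pos rfl]

/-- The pairs of sectors that occur in the mixture. -/
noncomputable def support : Finset (I × K) := by
  classical exact Finset.univ.filter fun s => W.w s ≠ 0

theorem mem_support {s : I × K} : s ∈ W.support ↔ W.w s ≠ 0 := by simp [support]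

theorem sum_support {R : Type} [AddCommMonoid R] (f : I × K → R)
    (h : ∀ s, W.w s = 0 → f s = 0) : ∑ s ∈ W.support, f s = ∑ s, f s :=
  Finset.sum_subset (Finset.subset_univ _) fun s _ hs => h s (by simpa [mem_support] using hs)

theorem bessel (φ : α × β → ℂ) {S : Finset (I × K)} (hS : S ⊆ W.support) :
    ∑ s ∈ S, ‖star (𝓐.ent 𝓑 s) ⬝ᵥ φ‖ ^ 2 ≤ sqNorm φ :=
  SpinEntanglement.bessel _ _ (fun _ hs s' _ => W.inner_ent (W.mem_support.1 (hS hs)) s') φ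

theorem mixture_mulVec_ent {s : I × K} (hs : W.w s ≠ 0) :
    W.mixture *ᵥ 𝓐.ent 𝓑 s = (W.w s : ℂ) • 𝓐.ent 𝓑 s := by
  rw [mixture, Matrix.sum_mulVec, Finset.sum_eq_single s]
  · rw [Matrix.smul_mulVec, pureState_mulVec, W.inner_ent hs, if_pos rfl, one_smul]
  · intro s' _ hne
    rw [Matrix.smul_mulVec]
    by_cases h : W.w s' = 0
    · simp [h]
    · rw [pureState_mulVec, W.inner_ent h, if_neg hne, zero_smul, smul_zero]
  · simp

theorem expect_mixture {s : I × K} (hs : W.w s ≠ 0) :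
    star (𝓐.ent 𝓑 s) ⬝ᵥ (W.mixture *ᵥ 𝓐.ent 𝓑 s) = W.w s := by
  rw [W.mixture_mulVec_ent hs, dotProduct_smul, W.inner_ent hs, if_pos rfl]; simp

theorem posSemidef_mixture : W.mixture.PosSemidef :=
  Matrix.posSemidef_sum _ fun s _ =>
    (posSemidef_pureState _).smul (by exact_mod_cast W.nonneg s)

theorem trace_mixture : W.mixture.trace = 1 := by
  rw [mixture, Matrix.trace_sum, ← Complex.ofReal_one, ← W.sum_eq_one, Complex.ofReal_sum]
  refine Finset.sum_congr rfl fun s _ => ?_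
  by_cases h : W.w s = 0
  · simp [h]
  · rw [Matrix.trace_smul, trace_pureState, (isUnitVector_iff _).1 (W.isUnitVector_ent h)]; simp

theorem isState_mixture : IsState W.mixture := ⟨W.posSemidef_mixture, W.trace_mixture⟩

end SectorWeights

end Sectors

end SpinEntanglement

namespace SpinEntanglement

/-! ### Reduced density matrices -/

section Reduced

variable {α β : Type} [Fintype α] [DecidableEq α] [Fintype β] [DecidableEq β]

omit [Fintype α] [DecidableEq α] [Fintype β] [DecidableEq β] in
theorem tensorVec_sum_left {ι : Type} (s : Finset ι) (c : ι → ℂ) (a : ι → α → ℂ) (b : β → ℂ) :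
    tensorVec (∑ i ∈ s, c i • a i) b = ∑ i ∈ s, c i • tensorVec (a i) b := by
  ext x
  simp [tensorVec, Finset.sum_mul, Finset.sum_apply, mul_assoc]

omit [Fintype α] [DecidableEq α] [DecidableEq β] in
theorem partialTraceB_pureState (Ψ : α × β → ℂ) :
    partialTraceB (pureState Ψ) = ∑ b, pureState fun a => Ψ (a, b) := by
  ext a a'
  simp [partialTraceB, pureState, Matrix.sum_apply, Matrix.vecMulVec_apply]

omit [DecidableEq α] [DecidableEq β] in
theorem posSemidef_partialTraceB_pureState (Ψ : α × β → ℂ) :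
    (partialTraceB (pureState Ψ)).PosSemidef := by
  rw [partialTraceB_pureState]
  exact Matrix.posSemidef_sum _ fun b _ => posSemidef_pureState _

omit [DecidableEq α] [DecidableEq β] in
theorem trace_partialTraceB_pureState (Ψ : α × β → ℂ) :
    (partialTraceB (pureState Ψ)).trace = (sqNorm Ψ : ℂ) := by
  rw [partialTraceB_pureState, Matrix.trace_sum]
  simp only [trace_pureState, sqNorm, Fintype.sum_prod_type_right]
  push_cast; rfl

omit [DecidableEq α] in
/-- Matrix elements of the reduced density matrix through a basis of the other subsystem. -/
theorem dotProduct_partialTraceB_mulVec {ι : Type} [Fintype ι] {u : ι → β → ℂ}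
    (hu : ∑ i, pureState (u i) = 1) (Ψ : α × β → ℂ) (x y : α → ℂ) :
    star x ⬝ᵥ (partialTraceB (pureState Ψ) *ᵥ y) =
      ∑ i, (star (tensorVec x (u i)) ⬝ᵥ Ψ) * star (star (tensorVec y (u i)) ⬝ᵥ Ψ) := by
  have h1 : ∀ (x : α → ℂ) (i : ι), star (tensorVec x (u i)) ⬝ᵥ Ψ =
      star (u i) ⬝ᵥ fun b => ∑ a, star (x a) * Ψ (a, b) := by
    intro x i
    simp only [dotProduct, tensorVec, Pi.star_apply, star_mul', Fintype.sum_prod_type_right,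
      Finset.mul_sum]
    exact Finset.sum_congr rfl fun _ _ => Finset.sum_congr rfl fun _ _ => by ring
  simp only [h1]
  set X : (α → ℂ) → β → ℂ := fun x b => ∑ a, star (x a) * Ψ (a, b) with hX
  have h2 := sum_expect_eq_trace hu (Matrix.vecMulVec (X x) (star (X y)))
  have h3 : ∀ i, star (u i) ⬝ᵥ (Matrix.vecMulVec (X x) (star (X y)) *ᵥ u i) =
      (star (u i) ⬝ᵥ X x) * star (star (u i) ⬝ᵥ X y) := by
    intro i
    rw [Matrix.vecMulVec_mulVec, ← Matrix.star_dotProduct]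
    simp [mul_comm]
  simp only [h3] at h2
  rw [h2, Matrix.trace_vecMulVec, partialTraceB_pureState, Matrix.sum_mulVec, dotProduct_sum]
  refine Finset.sum_congr rfl fun b _ => ?_
  rw [pureState_mulVec, dotProduct_smul, smul_eq_mul, mul_comm]
  congr 1
  simp only [dotProduct, hX, Pi.star_apply, star_sum, star_mul', star_star]
  exact Finset.sum_congr rfl fun _ _ => by ring

end Reduced

section Sectors

variable {α β I K T : Type} [Fintype α] [DecidableEq α] [Fintype β] [DecidableEq β]
  [Fintype I] [DecidableEq I] [Fintype K] [DecidableEq K] [Fintype T] [DecidableEq T]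
  {𝓐 : SectorBasis α I T} {𝓑 : SectorBasis β K T}

namespace SectorBasis

theorem eq_sum (𝓐 : SectorBasis α I T) (φ : α → ℂ) :
    φ = ∑ x : I × T, (star (𝓐.vec x.1 x.2) ⬝ᵥ φ) • 𝓐.vec x.1 x.2 := by
  conv_lhs => rw [← Matrix.one_mulVec φ, ← 𝓐.complete, Matrix.sum_mulVec]
  simp only [pureState_mulVec]

end SectorBasis

namespace SectorWeights

variable (W : SectorWeights 𝓐 𝓑)

/-! ### Entanglement of superpositions -/

/-- A superposition of maximally entangled states. -/
noncomputable def superposition (_ : SectorWeights 𝓐 𝓑) (c : I × K → ℂ) : α × β → ℂ :=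
  ∑ s, c s • 𝓐.ent 𝓑 s

variable {c : I × K → ℂ}

/-- The coefficient matrix of a superposition is diagonal in `t`, with entries c(i,k)/√d_i. -/
theorem inner_vec_superposition (hc : ∀ s, W.w s = 0 → c s = 0) (i : I) (k : K) (t u : T) :
    star (tensorVec (𝓐.vec i t) (𝓑.vec k u)) ⬝ᵥ W.superposition c =
      if t = u ∧ t ∈ 𝓐.supp i then c (i, k) * ((1 / √((𝓐.supp i).card : ℝ) : ℝ) : ℂ) else 0 := by
  have h : ∀ s, star (tensorVec (𝓐.vec i t) (𝓑.vec k u)) ⬝ᵥ (c s • 𝓐.ent 𝓑 s) =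
      if s = (i, k) then (if t = u ∧ t ∈ 𝓐.supp i then
        c (i, k) * ((1 / √((𝓐.supp i).card : ℝ) : ℝ) : ℂ) else 0) else 0 := by
    intro s
    by_cases hs : W.w s = 0
    · rw [hc s hs, zero_smul, dotProduct_zero]
      split_ifs with h1 h2
      · rw [← h1, hc s hs, zero_mul]
      · rfl
      · rfl
    · rw [dotProduct_smul, W.inner_tensorVec_ent hs]
      by_cases h1 : s = (i, k)
      · subst h1; simp [SectorBasis.dim]
      · simp [h1]
  rw [superposition, dotProduct_sum]
  simp only [h, Finset.sum_ite_eq', Finset.mem_univ, if_true]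

theorem inner_superposition (hc : ∀ s, W.w s = 0 → c s = 0) (x : α → ℂ) (k : K) (t : T) :
    star (tensorVec x (𝓑.vec k t)) ⬝ᵥ W.superposition c =
      ∑ i, star (star (𝓐.vec i t) ⬝ᵥ x) * (c (i, k) * ((1 / √((𝓐.supp i).card : ℝ) : ℝ) : ℂ)) := by
  conv_lhs => rw [𝓐.eq_sum x, tensorVec_sum_left, star_sum, sum_dotProduct, Fintype.sum_prod_type]
  refine Finset.sum_congr rfl fun i _ => ?_
  simp only [star_smul, smul_dotProduct, W.inner_vec_superposition hc]
  rw [Finset.sum_eq_single t]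
  · by_cases h : t ∈ 𝓐.supp i
    · simp [h]
    · simp [𝓐.vec_eq_zero h]
  · intro t' _ hne; simp [hne]
  · simp

/-- The reduced matrix is the coefficient matrix times its adjoint. With `inner_superposition` this
expresses the eigenvalue equation in two half steps, without diagonalizing anything. -/
theorem inner_vec_reduced_mulVec (hc : ∀ s, W.w s = 0 → c s = 0) {i : I} {t : T}
    (ht : t ∈ 𝓐.supp i) (x : α → ℂ) :
    star (𝓐.vec i t) ⬝ᵥ (partialTraceB (pureState (W.superposition c)) *ᵥ x) =
      ∑ k, c (i, k) * ((1 / √((𝓐.supp i).card : ℝ) : ℝ) : ℂ) *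
        star (star (tensorVec x (𝓑.vec k t)) ⬝ᵥ W.superposition c) := by
  rw [dotProduct_partialTraceB_mulVec 𝓑.complete, Fintype.sum_prod_type]
  refine Finset.sum_congr rfl fun k _ => ?_
  simp only [W.inner_vec_superposition hc]
  rw [Finset.sum_eq_single t]
  · simp [ht]
  · intro t' _ hne; simp [hne.symm]
  · simp

theorem expect_vec_reduced (hc : ∀ s, W.w s = 0 → c s = 0) {i : I} {t : T}
    (ht : t ∈ 𝓐.supp i) :
    star (𝓐.vec i t) ⬝ᵥ (partialTraceB (pureState (W.superposition c)) *ᵥ 𝓐.vec i t) =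
      ((∑ k, ‖c (i, k)‖ ^ 2 / (𝓐.supp i).card : ℝ) : ℂ) := by
  rw [W.inner_vec_reduced_mulVec hc ht, Complex.ofReal_sum]
  refine Finset.sum_congr rfl fun k _ => ?_
  rw [W.inner_vec_superposition hc, if_pos ⟨rfl, ht⟩, RCLike.star_def, Complex.mul_conj',
    norm_mul, Complex.ofReal_mul, mul_pow, ← Complex.ofReal_pow ‖_‖ 2, ← Complex.ofReal_pow ‖_‖ 2,
    SectorBasis.norm_inv_sqrt_sq]
  push_cast; ring

/-- In the reduced density matrix of a superposition, the average sector dimension in an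
eigenvector is at most the inverse eigenvalue. -/
theorem eigenvalue_mul_sum_le (hc : ∀ s, W.w s = 0 → c s = 0) (hc1 : ∑ s, ‖c s‖ ^ 2 = 1) {ev : ℝ}
    {u : α → ℂ} (hu : partialTraceB (pureState (W.superposition c)) *ᵥ u = (ev : ℂ) • u)
    (hu1 : sqNorm u = 1) :
    ev * ∑ i, ∑ t ∈ 𝓐.supp i, (𝓐.supp i).card * ‖star (𝓐.vec i t) ⬝ᵥ u‖ ^ 2 ≤ 1 := by
  set a : I → T → ℂ := fun i t => star (𝓐.vec i t) ⬝ᵥ u with ha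
  set q : I → ℝ := fun i => 1 / √((𝓐.supp i).card : ℝ) with hq
  set g : K → T → ℂ := fun k t => star (tensorVec u (𝓑.vec k t)) ⬝ᵥ W.superposition c with hg
  -- The dimension can be moved from Alice's sector to Bob's, because coefficients live on pairs of
  -- equal supports.
  have hcq : ∀ i k, (((𝓐.supp i).card : ℝ) : ℂ) * (c (i, k) * q i) =
      ((𝓑.supp k).card : ℂ) * (c (i, k) * q i) := by
    intro i k
    by_cases h : W.w (i, k) = 0
    · simp [hc _ h]
    · rw [show 𝓐.supp i = 𝓑.supp k from W.supp_eq _ h]; simp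
  have hcq' : ∀ i k, ((𝓑.supp k).card : ℝ) * ‖c (i, k)‖ ^ 2 * q i ^ 2 ≤ ‖c (i, k)‖ ^ 2 := by
    intro i k
    by_cases h : W.w (i, k) = 0
    · simp [hc _ h]
    · have e : 𝓐.supp i = 𝓑.supp k := W.supp_eq _ h
      have hd : (0 : ℝ) < (𝓐.supp i).card := by exact_mod_cast W.dim_pos h
      rw [hq]
      simp only
      rw [div_pow, Real.sq_sqrt hd.le, ← e]
      field_simp
      simp
  have hag : ∀ i t, t ∈ 𝓐.supp i → (ev : ℂ) * a i t = ∑ k, c (i, k) * q i * star (g k t) := by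
    intro i t ht
    have := W.inner_vec_reduced_mulVec hc ht u
    rw [hu, dotProduct_smul, smul_eq_mul] at this
    exact this
  have hgk : ∀ k t, g k t = ∑ i, star (a i t) * (c (i, k) * q i) :=
    fun k t => W.inner_superposition hc u k t
  have ha0 : ∀ i t, t ∉ 𝓐.supp i → a i t = 0 := fun i t h => by simp [ha, 𝓐.vec_eq_zero h]
  -- Pair the eigenvalue equation `hag` with conj(a) weighted by d_i, move the weight to Bob with
  -- `hcq`, and recognize `g` by `hgk`.
  have key : ((ev * ∑ i, ∑ t ∈ 𝓐.supp i, (𝓐.supp i).card * ‖a i t‖ ^ 2 : ℝ) : ℂ) =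
      ((∑ k, ∑ t, (𝓑.supp k).card * ‖g k t‖ ^ 2 : ℝ) : ℂ) := by
    have l : ∀ i, ∑ t ∈ 𝓐.supp i, (ev : ℂ) * ((𝓐.supp i).card * (‖a i t‖ : ℂ) ^ 2) =
        ∑ t, ∑ k, ((𝓑.supp k).card : ℂ) * (star (a i t) * (c (i, k) * q i) * star (g k t)) := by
      intro i
      rw [Finset.sum_subset (Finset.subset_univ _) fun t _ ht => by simp [ha0 i t ht]]
      refine Finset.sum_congr rfl fun t _ => ?_
      by_cases ht : t ∈ 𝓐.supp i
      · have e1 : (ev : ℂ) * ((𝓐.supp i).card * (‖a i t‖ : ℂ) ^ 2) =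
            star (a i t) * (((𝓐.supp i).card : ℝ) : ℂ) * (ev * a i t) := by
          rw [← Complex.conj_mul', RCLike.star_def]; push_cast; ring
        rw [e1, hag i t ht, Finset.mul_sum]
        refine Finset.sum_congr rfl fun k _ => ?_
        have := hcq i k
        linear_combination (star (a i t) * star (g k t)) * this
      · simp [ha0 i t ht]
    have r : ∀ k t, ((𝓑.supp k).card : ℂ) * (‖g k t‖ : ℂ) ^ 2 =
        ∑ i, ((𝓑.supp k).card : ℂ) * (star (a i t) * (c (i, k) * q i) * star (g k t)) := by
      intro k t
      rw [← Finset.mul_sum, ← Finset.sum_mul, ← hgk, RCLike.star_def, Complex.mul_conj']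
    push_cast
    simp only [Finset.mul_sum, l, r]
    rw [Finset.sum_comm]
    conv_rhs => rw [Finset.sum_comm]
    refine Finset.sum_congr rfl fun t _ => ?_
    rw [Finset.sum_comm]
  rw [Complex.ofReal_inj] at key
  rw [key]
  -- Cauchy–Schwarz in `i`: the factor d_k cancels the normalization 1/d_i, leaving the product of
  -- the squared norms of `u` and `c`.
  calc ∑ k, ∑ t, (𝓑.supp k).card * ‖g k t‖ ^ 2
      ≤ ∑ k, ∑ t, (∑ i, ‖a i t‖ ^ 2) * ∑ i, ‖c (i, k)‖ ^ 2 := by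
        refine Finset.sum_le_sum fun k _ => Finset.sum_le_sum fun t _ => ?_
        rw [hgk]
        have h1 := norm_sum_mul_sq_le Finset.univ (fun i => star (a i t))
          fun i => c (i, k) * (q i : ℂ)
        simp only [norm_star, norm_mul, mul_pow, Complex.norm_real, Real.norm_eq_abs, sq_abs] at h1
        calc ((𝓑.supp k).card : ℝ) * ‖∑ i, star (a i t) * (c (i, k) * q i)‖ ^ 2
            ≤ (𝓑.supp k).card * ((∑ i, ‖a i t‖ ^ 2) * ∑ i, ‖c (i, k)‖ ^ 2 * q i ^ 2) := by gcongr
          _ = (∑ i, ‖a i t‖ ^ 2) * ∑ i, (𝓑.supp k).card * ‖c (i, k)‖ ^ 2 * q i ^ 2 := by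
            simp only [mul_assoc, ← Finset.mul_sum]; ring
          _ ≤ _ := by
            gcongr with i _
            exact hcq' i k
    _ = 1 := by
        rw [← Finset.sum_comm]
        simp only [← Finset.mul_sum, ← Finset.sum_mul]
        rw [Finset.sum_comm, 𝓐.sum_norm_sq, hu1, one_mul, Finset.sum_comm,
          ← Fintype.sum_prod_type (f := fun s : I × K => ‖c s‖ ^ 2), hc1]

/-- The left side is the expectation of log D in the reduced matrix, where D is d_i on sector i. In
an eigenvector of eigenvalue p > 0 the mean of D is at most 1/p, so by concavity the mean of log D
is at most -log p. -/
theorem sum_norm_sq_mul_log_le_pureEntanglement (hc : ∀ s, W.w s = 0 → c s = 0)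
    (hc1 : ∑ s, ‖c s‖ ^ 2 = 1) :
    ∑ s, ‖c s‖ ^ 2 * Real.log (𝓐.dim s) ≤ pureEntanglement (W.superposition c) := by
  set R := partialTraceB (pureState (W.superposition c)) with hR
  have hpsd : R.PosSemidef := posSemidef_partialTraceB_pureState _
  obtain ⟨ev, u, hu, hu1, h1, hf⟩ := exists_eigenbasis hpsd.isHermitian
  rw [pureEntanglement, entropy_eq_sum hu1 hf]
  -- The expectation of log D is computed first in the sector basis and then in the eigenbasis of
  -- `R`.
  have e1 : ∑ s, ‖c s‖ ^ 2 * Real.log (𝓐.dim s) =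
      ∑ n, ev n * ∑ i, ∑ t ∈ 𝓐.supp i,
        ‖star (𝓐.vec i t) ⬝ᵥ u n‖ ^ 2 * Real.log ((𝓐.supp i).card) := by
    simp only [Finset.mul_sum]
    rw [Finset.sum_comm, Fintype.sum_prod_type]
    refine Finset.sum_congr rfl fun i _ => ?_
    rw [Finset.sum_comm]
    have h : ∀ t ∈ 𝓐.supp i, ∑ n, ev n * (‖star (𝓐.vec i t) ⬝ᵥ u n‖ ^ 2 *
        Real.log ((𝓐.supp i).card)) =
        (∑ k, ‖c (i, k)‖ ^ 2 / (𝓐.supp i).card) * Real.log ((𝓐.supp i).card) := by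
      intro t ht
      have e := W.expect_vec_reduced hc ht
      rw [← hR, eq_sum_of_cfc hpsd.isHermitian hf, dotProduct_sum_smul_mulVec] at e
      simp only [expect_pureState, ← Complex.ofReal_mul, ← Complex.ofReal_sum,
        Complex.ofReal_inj] at e
      rw [← e, Finset.sum_mul]
      exact Finset.sum_congr rfl fun n _ => by ring
    rw [Finset.sum_congr rfl h, Finset.sum_const, nsmul_eq_mul, ← Finset.sum_div]
    simp only [SectorBasis.dim, ← Finset.sum_mul]
    rcases Nat.eq_zero_or_pos (𝓐.supp i).card with h0 | h0
    · simp [h0]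
    · have : ((𝓐.supp i).card : ℝ) ≠ 0 := by positivity
      field_simp
  rw [e1]
  refine Finset.sum_le_sum fun n _ => ?_
  have hev : 0 ≤ ev n := eigenvalue_nonneg hpsd (hu n) (hu1 n)
  rcases hev.eq_or_lt with h0 | h0
  · simp [← h0]
  have hle := W.eigenvalue_mul_sum_le hc hc1 (hu n) (hu1 n)
  have hs := 𝓐.sum_supp_norm_sq (u n)
  rw [hu1] at hs
  rw [Real.negMulLog, neg_mul_comm]
  refine mul_le_mul_of_nonneg_left ?_ h0.le
  -- Jensen's inequality in tangent form: log(p d) ≤ p d - 1, with p the eigenvalue.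
  have hb : ∀ i, ∀ t ∈ 𝓐.supp i,
      ‖star (𝓐.vec i t) ⬝ᵥ u n‖ ^ 2 * Real.log ((𝓐.supp i).card) ≤
      ‖star (𝓐.vec i t) ⬝ᵥ u n‖ ^ 2 * (- Real.log (ev n) - 1) +
        ev n * ((𝓐.supp i).card * ‖star (𝓐.vec i t) ⬝ᵥ u n‖ ^ 2) := by
    intro i t ht
    have hd : (0 : ℝ) < (𝓐.supp i).card := by exact_mod_cast Finset.card_pos.2 ⟨t, ht⟩
    have h2 := Real.log_le_sub_one_of_pos (mul_pos h0 hd)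
    rw [Real.log_mul h0.ne' hd.ne'] at h2
    have h3 : 0 ≤ ‖star (𝓐.vec i t) ⬝ᵥ u n‖ ^ 2 := by positivity
    nlinarith
  have hsum := Finset.sum_le_sum fun i (_ : i ∈ Finset.univ) => Finset.sum_le_sum (hb i)
  simp only [Finset.sum_add_distrib, ← Finset.sum_mul, ← Finset.mul_sum] at hsum hle ⊢
  rw [hs] at hsum
  linarith

theorem superposition_single (s : I × K) : W.superposition (Pi.single s 1) = 𝓐.ent 𝓑 s := by
  rw [superposition, Finset.sum_eq_single s] <;> simp +contextual

/-- The state is a superposition with a single coefficient, so the formulas for superpositions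
apply; a nonzero spectrum concentrated at 1/d with total 1 has entropy log d. -/
theorem pureEntanglement_ent {s : I × K} (hs : W.w s ≠ 0) :
    pureEntanglement (𝓐.ent 𝓑 s) = Real.log (𝓐.dim s) := by
  have hc : ∀ s', W.w s' = 0 → (Pi.single s 1 : I × K → ℂ) s' = 0 := by
    intro s' h
    rw [Pi.single_apply, if_neg]
    rintro rfl; exact hs h
  rw [← W.superposition_single s]
  set R := partialTraceB (pureState (W.superposition (Pi.single s 1))) with hR
  have hpsd : R.PosSemidef := posSemidef_partialTraceB_pureState _
  obtain ⟨ev, u, hu, hu1, h1, hf⟩ := exists_eigenbasis hpsd.isHermitian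
  have htr : ∑ n, ev n = 1 := by
    have e := sum_expect_eq_trace h1 R
    rw [Finset.sum_congr rfl fun n _ => expect_eigenvector (hu n) (hu1 n),
      trace_partialTraceB_pureState, W.superposition_single,
      (isUnitVector_iff _).1 (W.isUnitVector_ent hs)] at e
    exact_mod_cast e
  rw [pureEntanglement, entropy_eq_sum hu1 hf]
  have hd : (0 : ℝ) < 𝓐.dim s := by exact_mod_cast W.dim_pos hs
  suffices h : ∀ n, Real.negMulLog (ev n) = ev n * Real.log (𝓐.dim s) by
    simp only [h, ← Finset.sum_mul, htr, one_mul]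
  intro n
  -- The reduced matrix is 1/d on the sector `s.1` and 0 elsewhere; for any other eigenvalue all
  -- components of `u n` would vanish.
  have hev : ev n = 0 ∨ ev n = 1 / 𝓐.dim s := by
    by_contra! hne
    have ha : ∀ i t, star (𝓐.vec i t) ⬝ᵥ u n = 0 := by
      intro i t
      by_cases ht : t ∈ 𝓐.supp i
      swap
      · simp [𝓐.vec_eq_zero ht]
      have e := W.inner_vec_reduced_mulVec hc ht (u n)
      rw [← hR, hu, dotProduct_smul, smul_eq_mul] at e
      by_cases hi : i = s.1
      · subst hi
        rw [Finset.sum_eq_single s.2 (fun k _ hk => by simp [Prod.ext_iff, hk]) (by simp),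
          W.inner_superposition hc, Finset.sum_eq_single s.1
            (fun k _ hk => by simp [Prod.ext_iff, hk]) (by simp)] at e
        simp only [Prod.mk.eta, Pi.single_eq_same, one_mul, star_mul', star_star] at e
        rw [RCLike.star_def, Complex.conj_ofReal] at e
        have e2 : (((1 / √((𝓐.supp s.1).card : ℝ) : ℝ) : ℂ)) *
            (((1 / √((𝓐.supp s.1).card : ℝ) : ℝ) : ℂ)) = ((1 / 𝓐.dim s : ℝ) : ℂ) := by
          rw [← Complex.ofReal_mul, div_mul_div_comm, one_mul,
            Real.mul_self_sqrt (Nat.cast_nonneg _), SectorBasis.dim]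
        have e3 : ((ev n : ℂ) - ((1 / 𝓐.dim s : ℝ) : ℂ)) * (star (𝓐.vec s.1 t) ⬝ᵥ u n) = 0 := by
          rw [← e2]; linear_combination e
        rcases mul_eq_zero.1 e3 with h | h
        · exact absurd (by exact_mod_cast sub_eq_zero.1 h) hne.2
        · exact h
      · rw [Finset.sum_eq_zero fun k _ => by simp [Prod.ext_iff, hi]] at e
        rcases mul_eq_zero.1 e with h | h
        · exact absurd (by exact_mod_cast h) hne.1
        · exact h
    have := 𝓐.sum_norm_sq (u n)
    simp [ha, hu1] at this
  rcases hev with h | h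
  · simp [h]
  · rw [h, Real.negMulLog, one_div, Real.log_inv]; ring

end SectorWeights

end Sectors

end SpinEntanglement

namespace SpinEntanglement

/-! ### Kraus operators that transfer orthonormal families -/

section Transfer

variable {α α' T : Type} [Fintype α] [Fintype α'] [DecidableEq T]

/-- The operator `∑ t ∈ s, |g t⟩⟨h t|`. -/
noncomputable def transfer (s : Finset T) (g : T → α' → ℂ) (h : T → α → ℂ) : Matrix α' α ℂ :=
  ∑ t ∈ s, Matrix.vecMulVec (g t) (star (h t))

omit [Fintype α'] [DecidableEq T] in
theorem transfer_mulVec (s : Finset T) (g : T → α' → ℂ) (h : T → α → ℂ) (v : α → ℂ) :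
    transfer s g h *ᵥ v = ∑ t ∈ s, (star (h t) ⬝ᵥ v) • g t := by
  rw [transfer, Matrix.sum_mulVec]
  refine Finset.sum_congr rfl fun t _ => ?_
  rw [Matrix.vecMulVec_mulVec]; ext; simp [mul_comm]

omit [Fintype α] in
theorem transfer_conjTranspose_mul_self (s : Finset T) (g : T → α' → ℂ) (h : T → α → ℂ)
    (hg : ∀ t ∈ s, ∀ t' ∈ s, star (g t) ⬝ᵥ g t' = if t = t' then 1 else 0) :
    (transfer s g h)ᴴ * transfer s g h = ∑ t ∈ s, pureState (h t) := by
  rw [transfer, Matrix.conjTranspose_sum, Matrix.sum_mul]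
  refine Finset.sum_congr rfl fun t ht => ?_
  rw [Matrix.mul_sum, Finset.sum_eq_single t]
  · rw [Matrix.conjTranspose_vecMulVec, star_star, Matrix.vecMulVec_mul_vecMulVec, hg t ht t ht,
      if_pos rfl, one_smul, pureState]
  · intro t' ht' hne
    rw [Matrix.conjTranspose_vecMulVec, star_star, Matrix.vecMulVec_mul_vecMulVec, hg t ht t' ht',
      if_neg hne.symm, zero_smul, Matrix.vecMulVec_zero]
  · exact fun h' => absurd ht h'

end Transfer

section Sectors

variable {α β I K T : Type} [Fintype α] [DecidableEq α] [Fintype β] [DecidableEq β]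
  [Fintype I] [DecidableEq I] [Fintype K] [DecidableEq K] [Fintype T] [DecidableEq T]

/-! ### Local projections onto the sectors. -/

namespace SectorBasis

variable (𝓐 : SectorBasis α I T)

/-- The projection onto a sector. -/
noncomputable def proj (i : I) : Matrix α α ℂ :=
  transfer (𝓐.supp i) (𝓐.vec i) (𝓐.vec i)

theorem inner_vec_of_mem {i : I} {t t' : T} (h : t ∈ 𝓐.supp i) :
    star (𝓐.vec i t) ⬝ᵥ 𝓐.vec i t' = if t = t' then 1 else 0 := by
  rw [𝓐.inner_vec]; simp [h]

theorem sum_supp_pureState : ∑ i, ∑ t ∈ 𝓐.supp i, pureState (𝓐.vec i t) = 1 := by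
  rw [← 𝓐.complete, Fintype.sum_prod_type]
  refine Finset.sum_congr rfl fun i _ => Finset.sum_subset (Finset.subset_univ _) fun t _ ht => ?_
  rw [𝓐.vec_eq_zero ht, pureState_zero]

theorem sum_proj : ∑ i, (𝓐.proj i)ᴴ * 𝓐.proj i = 1 := by
  rw [← 𝓐.sum_supp_pureState]
  refine Finset.sum_congr rfl fun i _ => ?_
  exact transfer_conjTranspose_mul_self _ _ _ fun t ht t' _ => 𝓐.inner_vec_of_mem ht

theorem proj_mulVec (i i' : I) (t : T) :
    𝓐.proj i *ᵥ 𝓐.vec i' t = if i = i' then 𝓐.vec i' t else 0 := by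
  rw [proj, transfer_mulVec]
  simp only [𝓐.inner_vec]
  split_ifs with h
  · subst h
    by_cases ht : t ∈ 𝓐.supp i
    · rw [Finset.sum_eq_single t]
      · simp [ht]
      · intro t' _ hne; simp [hne]
      · exact fun h => absurd ht h
    · rw [𝓐.vec_eq_zero ht]
      refine Finset.sum_eq_zero fun t' ht' => ?_
      rw [if_neg, zero_smul]
      rintro ⟨-, rfl, -⟩; exact ht ht'
  · refine Finset.sum_eq_zero fun t' _ => ?_
    simp [h]

theorem kronecker_proj_mulVec_ent (𝓑 : SectorBasis β K T) (i : I) (k : K) (s : I × K) :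
    (𝓐.proj i ⊗ₖ 𝓑.proj k) *ᵥ 𝓐.ent 𝓑 s = if s = (i, k) then 𝓐.ent 𝓑 s else 0 := by
  rw [ent, Matrix.mulVec_smul, Matrix.mulVec_sum]
  simp only [kronecker_mulVec_tensorVec, proj_mulVec]
  by_cases h : s = (i, k)
  · subst h; simp
  · rw [if_neg h, Finset.sum_eq_zero, smul_zero]
    intro t _
    by_cases h1 : i = s.1
    · have h2 : k ≠ s.2 := fun h2 => h (Prod.ext h1.symm h2.symm)
      rw [if_neg h2]; ext; simp [tensorVec]
    · rw [if_neg h1]; ext; simp [tensorVec]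

end SectorBasis

namespace SectorWeights

variable {𝓐 : SectorBasis α I T} {𝓑 : SectorBasis β K T} (W : SectorWeights 𝓐 𝓑)

theorem mixture_eq_sum_support :
    W.mixture = ∑ s : W.support, (W.w s : ℂ) • pureState (𝓐.ent 𝓑 s) := by
  rw [Finset.sum_coe_sort W.support fun s => (W.w s : ℂ) • pureState (𝓐.ent 𝓑 s),
    W.sum_support _ fun s hs => by simp [hs], mixture]

theorem value_eq_sum_support :
    W.value = ∑ s : W.support, W.w s * pureEntanglement (𝓐.ent 𝓑 s) := by
  rw [Finset.sum_coe_sort W.support fun s => W.w s * pureEntanglement (𝓐.ent 𝓑 s),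
    Finset.sum_congr rfl fun s hs => by rw [W.pureEntanglement_ent (W.mem_support.1 hs)],
    W.sum_support (fun s => W.w s * Real.log (𝓐.dim s)) fun s hs => by simp [hs], value]

theorem sum_w_support : ∑ s : W.support, W.w s = 1 := by
  rw [Finset.sum_coe_sort W.support W.w, W.sum_support _ fun s hs => hs, W.sum_eq_one]

/-! ### Entanglement of formation -/

/-- Each `ψ i` lies in the range of the mixture, hence is a superposition of its maximally entangled
vectors, and the squared coefficients average to the weights. The entropy bound for superpositions
does the rest. -/
theorem value_le_of_decomposition {n : ℕ} {p : Fin n → ℝ} {ψ : Fin n → α × β → ℂ}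
    (hp : ∀ i, 0 < p i) (hp1 : ∑ i, p i = 1) (hψ : ∀ i, IsUnitVector (ψ i))
    (hρ : W.mixture = ∑ i, (p i : ℂ) • pureState (ψ i)) :
    W.value ≤ ∑ i, p i * pureEntanglement (ψ i) := by
  -- Coefficients are cut off where the weight is zero, since there the two supports may differ and
  -- `ent` need not be a unit vector.
  set c : Fin n → I × K → ℂ := fun i s =>
    if s ∈ W.support then star (𝓐.ent 𝓑 s) ⬝ᵥ ψ i else 0 with hc
  have hc0 : ∀ i s, W.w s = 0 → c i s = 0 := by
    intro i s h; simp [hc, W.mem_support, h]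
  have hcw : ∀ s, ∑ i, p i * ‖c i s‖ ^ 2 = W.w s := by
    intro s
    by_cases h : W.w s = 0
    · simp [hc0 _ _ h, h]
    · have e := W.expect_mixture h
      rw [hρ, dotProduct_sum_smul_mulVec] at e
      simp only [expect_pureState, ← Complex.ofReal_mul, ← Complex.ofReal_sum,
        Complex.ofReal_inj] at e
      simpa only [hc, W.mem_support, ne_eq, h, not_false_eq_true, if_true] using e
  have hcle : ∀ i, ∑ s, ‖c i s‖ ^ 2 = ∑ s ∈ W.support, ‖star (𝓐.ent 𝓑 s) ⬝ᵥ ψ i‖ ^ 2 := by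
    intro i
    rw [← W.sum_support (fun s => ‖c i s‖ ^ 2) fun s h => by simp [hc0 _ _ h]]
    exact Finset.sum_congr rfl fun s hs => by simp [hc, hs]
  have hψ1 : ∀ i, sqNorm (ψ i) = 1 := fun i => (isUnitVector_iff _).1 (hψ i)
  have hc1 : ∀ i, ∑ s, ‖c i s‖ ^ 2 = 1 := by
    have hle : ∀ i, ∑ s, ‖c i s‖ ^ 2 ≤ 1 := fun i => by
      rw [hcle, ← hψ1 i]; exact W.bessel _ subset_rfl
    -- The nonnegative Bessel defects have mean zero because the weights sum to 1; as every `p i` is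
    -- positive, each defect vanishes.
    have hsum : ∑ i, p i * (1 - ∑ s, ‖c i s‖ ^ 2) = 0 := by
      simp only [mul_sub, mul_one, Finset.sum_sub_distrib, hp1, Finset.mul_sum]
      rw [Finset.sum_comm]
      simp [hcw, W.sum_eq_one]
    intro i
    have := (Finset.sum_eq_zero_iff_of_nonneg fun i _ =>
      mul_nonneg (hp i).le (sub_nonneg.2 (hle i))).1 hsum i (Finset.mem_univ i)
    rcases mul_eq_zero.1 this with h | h
    · exact absurd h (hp i).ne'
    · linarith
  have hsup : ∀ i, ψ i = W.superposition (c i) := by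
    intro i
    have h := sqNorm_sub_sum W.support (𝓐.ent 𝓑)
      (fun s hs s' _ => W.inner_ent (W.mem_support.1 hs) s') (ψ i)
    rw [← hcle, hc1, hψ1, sub_self] at h
    rw [sub_eq_zero.1 (sqNorm_eq_zero h), superposition,
      ← W.sum_support (fun s => c i s • 𝓐.ent 𝓑 s) fun s hs => by simp [hc0 _ _ hs]]
    refine Finset.sum_congr rfl fun s hs => ?_
    simp only [hc, hs, if_true]
  calc W.value = ∑ i, p i * ∑ s, ‖c i s‖ ^ 2 * Real.log (𝓐.dim s) := by
        simp only [Finset.mul_sum, ← mul_assoc]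
        rw [Finset.sum_comm]
        simp only [← Finset.sum_mul, hcw, value]
    _ ≤ _ := by
        refine Finset.sum_le_sum fun i _ => mul_le_mul_of_nonneg_left ?_ (hp i).le
        rw [hsup i]
        exact W.sum_norm_sq_mul_log_le_pureEntanglement (hc0 i) (hc1 i)

theorem isLeast_formationValues : IsLeast (formationValues W.mixture) W.value := by
  constructor
  · rw [W.mixture_eq_sum_support, W.value_eq_sum_support]
    exact mem_formationValues (fun s : W.support => W.w s) (fun s : W.support => 𝓐.ent 𝓑 s)
      (fun s => W.pos (W.mem_support.1 s.2)) W.sum_w_support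
      fun s => W.isUnitVector_ent (W.mem_support.1 s.2)
  · rintro r ⟨n, p, ψ, hp, hp1, hψ, hρ, rfl⟩
    exact W.value_le_of_decomposition hp hp1 hψ hρ

/-! ### Entanglement monotones -/

/-- Convexity gives the upper bound. For the lower one both parties measure their sectors, which
leaves the pure state `ent s` with probability w_s. -/
theorem measure_eq_value
    (E : ∀ {α β : Type} [Fintype α] [DecidableEq α] [Fintype β] [DecidableEq β],
      Matrix (α × β) (α × β) ℂ → ℝ) (hE : IsEntanglementMeasure E) :
    E W.mixture = W.value := by
  apply le_antisymm
  · rw [W.mixture_eq_sum_support, W.value_eq_sum_support]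
    exact hE.sum_le (fun s : W.support => W.w s) (fun s : W.support => 𝓐.ent 𝓑 s)
      (fun s => W.nonneg s) W.sum_w_support fun s => W.isUnitVector_ent (W.mem_support.1 s.2)
  · have h := hE.locc_le W.mixture _ _ W.isState_mixture
      (isLOCC_measurements 𝓐.proj 𝓐.sum_proj (fun _ => 𝓑.proj) fun _ => 𝓑.sum_proj)
    refine le_trans (le_of_eq ?_) h
    have hb : ∀ i k, branch (𝓐.proj i) (𝓑.proj k) W.mixture =
        (W.w (i, k) : ℂ) • pureState (𝓐.ent 𝓑 (i, k)) := by
      intro i k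
      rw [mixture, branch_sum_smul, Finset.sum_eq_single (i, k)]
      · rw [branch_pureState, SectorBasis.kronecker_proj_mulVec_ent, if_pos rfl]
      · intro s _ hne
        rw [branch_pureState, SectorBasis.kronecker_proj_mulVec_ent, if_neg hne, pureState_zero,
          smul_zero]
      · simp
    simp only [Fintype.sum_prod_type, hb, Finset.univ_unique, Finset.sum_singleton]
    rw [value, Fintype.sum_prod_type]
    refine Finset.sum_congr rfl fun i _ => Finset.sum_congr rfl fun k _ => ?_
    -- For an outcome of probability zero the measure is evaluated at the zero operator, but with
    -- factor zero.
    by_cases h0 : W.w (i, k) = 0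
    · simp [h0]
    · have h1 : (W.w (i, k) : ℂ) ≠ 0 := by exact_mod_cast h0
      rw [Matrix.trace_smul, trace_pureState, (isUnitVector_iff _).1 (W.isUnitVector_ent h0),
        Complex.ofReal_one, smul_eq_mul, mul_one, Complex.ofReal_re, smul_smul,
        inv_mul_cancel₀ h1, one_smul, hE.pure_eq _ (W.isUnitVector_ent h0),
        W.pureEntanglement_ent h0]

/-! ### Relative entropy of entanglement -/

theorem trace_mixture_mul (X : Matrix (α × β) (α × β) ℂ) :
    (W.mixture * X).trace = ∑ s, (W.w s : ℂ) * (star (𝓐.ent 𝓑 s) ⬝ᵥ (X *ᵥ 𝓐.ent 𝓑 s)) := by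
  rw [mixture, Matrix.sum_mul, Matrix.trace_sum]
  refine Finset.sum_congr rfl fun s _ => ?_
  rw [Matrix.smul_mul, Matrix.trace_smul, trace_pureState_mul, smul_eq_mul]

/-- Each occurring `ent s` is an eigenvector of the mixture with eigenvalue w_s, so log ρ acts on it
as log w_s. -/
theorem relativeEntropy_eq (X : Matrix (α × β) (α × β) ℂ) :
    ((W.mixture * (cfc Real.log W.mixture - X)).trace).re =
      ∑ s, W.w s * (Real.log (W.w s) - (star (𝓐.ent 𝓑 s) ⬝ᵥ (X *ᵥ 𝓐.ent 𝓑 s)).re) := by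
  rw [trace_mixture_mul, Complex.re_sum]
  refine Finset.sum_congr rfl fun s _ => ?_
  by_cases h : W.w s = 0
  · simp [h]
  · rw [Matrix.sub_mulVec, dotProduct_sub, cfc_mulVec_eigenvector W.posSemidef_mixture.isHermitian
      Real.log (W.mixture_mulVec_ent h), dotProduct_smul, W.inner_ent h, if_pos rfl,
      Complex.re_ofReal_mul]
    simp

/-- The dephased mixture, which is the closest separable state. -/
noncomputable def dephased : Matrix (α × β) (α × β) ℂ :=
  ∑ x : W.support.sigma fun s => 𝓐.supp s.1, ((W.w x.1.1 / 𝓐.dim x.1.1 : ℝ) : ℂ) •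
    (pureState (𝓐.vec x.1.1.1 x.1.2) ⊗ₖ pureState (𝓑.vec x.1.1.2 x.1.2))

theorem dephased_eq : W.dephased = ∑ s ∈ W.support, ∑ t ∈ 𝓐.supp s.1,
    ((W.w s / 𝓐.dim s : ℝ) : ℂ) • pureState (tensorVec (𝓐.vec s.1 t) (𝓑.vec s.2 t)) := by
  simp only [pureState_tensorVec]
  rw [dephased, Finset.sum_sigma']
  exact Finset.sum_coe_sort (W.support.sigma fun s => 𝓐.supp s.1) fun x =>
    ((W.w x.1 / 𝓐.dim x.1 : ℝ) : ℂ) •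
      (pureState (𝓐.vec x.1.1 x.2) ⊗ₖ pureState (𝓑.vec x.1.2 x.2))

theorem isSeparable_dephased : IsSeparable W.dephased := by
  have hmem : ∀ x : W.support.sigma fun s => 𝓐.supp s.1,
      W.w x.1.1 ≠ 0 ∧ x.1.2 ∈ 𝓐.supp x.1.1.1 := fun x => by
    have := Finset.mem_sigma.1 x.2
    exact ⟨W.mem_support.1 this.1, this.2⟩
  refine isSeparable_sum _ _ _ (fun x => ?_) ?_ (fun x => ?_) fun x => ?_
  · have := W.pos (hmem x).1
    have : (0 : ℝ) < 𝓐.dim x.1.1 := by exact_mod_cast W.dim_pos (hmem x).1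
    positivity
  · rw [Finset.sum_coe_sort (W.support.sigma fun s => 𝓐.supp s.1)
      fun x => W.w x.1 / 𝓐.dim x.1, Finset.sum_sigma, ← W.sum_eq_one,
      ← W.sum_support W.w fun s hs => hs]
    refine Finset.sum_congr rfl fun s hs => ?_
    have : (𝓐.dim s : ℝ) ≠ 0 := by exact_mod_cast (W.dim_pos (W.mem_support.1 hs)).ne'
    simp only [Finset.sum_const, nsmul_eq_mul]
    rw [← SectorBasis.dim]
    field_simp
  · exact isState_pureState ((isUnitVector_iff _).2 (𝓐.sqNorm_vec (hmem x).2))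
  · exact isState_pureState ((isUnitVector_iff _).2
      (𝓑.sqNorm_vec (W.supp_eq _ (hmem x).1 ▸ (hmem x).2)))

theorem posSemidef_dephased : W.dephased.PosSemidef := by
  rw [dephased_eq]
  refine Matrix.posSemidef_sum _ fun s _ => Matrix.posSemidef_sum _ fun t _ =>
    (posSemidef_pureState _).smul ?_
  exact_mod_cast div_nonneg (W.nonneg s) (Nat.cast_nonneg _)

/-- The d_s product vectors of the pair occur with equal weight w_s/d_s, so the dephased state is
scalar on their span, which contains `ent s`. -/
theorem dephased_mulVec_ent {s : I × K} (hs : W.w s ≠ 0) :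
    W.dephased *ᵥ 𝓐.ent 𝓑 s = ((W.w s / 𝓐.dim s : ℝ) : ℂ) • 𝓐.ent 𝓑 s := by
  rw [dephased_eq, Matrix.sum_mulVec, Finset.sum_eq_single s]
  · conv_rhs => rw [SectorBasis.ent]
    rw [Matrix.sum_mulVec, Finset.smul_sum, Finset.smul_sum]
    refine Finset.sum_congr rfl fun t ht => ?_
    rw [Matrix.smul_mulVec, pureState_mulVec, W.inner_tensorVec_ent hs, if_pos ⟨rfl, rfl, ht⟩]
  · intro s' _ hne
    rw [Matrix.sum_mulVec]
    refine Finset.sum_eq_zero fun t _ => ?_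
    rw [Matrix.smul_mulVec, pureState_mulVec, W.inner_tensorVec_ent hs,
      if_neg fun h => hne h.1.symm, zero_smul, smul_zero]
  · exact fun h => absurd (W.mem_support.2 hs) h

/-- A vector killed by a positive combination of projections is orthogonal to each of the product
vectors, hence to their sums `ent s`. -/
theorem mixture_mulVec_eq_zero {v : α × β → ℂ} (hv : W.dephased *ᵥ v = 0) :
    W.mixture *ᵥ v = 0 := by
  have h : star v ⬝ᵥ (W.dephased *ᵥ v) = 0 := by rw [hv, dotProduct_zero]
  rw [dephased_eq, Matrix.sum_mulVec, dotProduct_sum] at h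
  simp only [dotProduct_sum_smul_mulVec, expect_pureState, ← Complex.ofReal_mul,
    ← Complex.ofReal_sum, Complex.ofReal_eq_zero] at h
  have hnn : ∀ s, ∀ t : T, 0 ≤ W.w s / 𝓐.dim s *
      ‖star v ⬝ᵥ tensorVec (𝓐.vec s.1 t) (𝓑.vec s.2 t)‖ ^ 2 := fun s t =>
    mul_nonneg (div_nonneg (W.nonneg s) (Nat.cast_nonneg _)) (by positivity)
  rw [mixture, Matrix.sum_mulVec]
  refine Finset.sum_eq_zero fun s _ => ?_
  by_cases hs : W.w s = 0
  · simp [hs]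
  have h1 := (Finset.sum_eq_zero_iff_of_nonneg fun s _ =>
    Finset.sum_nonneg fun t _ => hnn s t).1 h s (W.mem_support.2 hs)
  rw [Matrix.smul_mulVec, pureState_mulVec, SectorBasis.star_ent_dotProduct, Finset.sum_eq_zero,
    mul_zero, zero_smul, smul_zero]
  intro t ht
  have h2 := (Finset.sum_eq_zero_iff_of_nonneg fun t _ => hnn s t).1 h1 t ht
  have h3 : W.w s / 𝓐.dim s ≠ 0 :=
    div_ne_zero hs (by exact_mod_cast (W.dim_pos hs).ne')
  have h4 := (mul_eq_zero.1 h2).resolve_left h3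
  rw [norm_dotProduct_comm] at h4
  simpa using h4

end SectorWeights

end Sectors

/-! ### Separable states and the lower bound on the relative entropy. -/

theorem exists_decomposition {α : Type} [Fintype α] [DecidableEq α] {ρ : Matrix α α ℂ}
    (h : IsState ρ) : ∃ (p : α → ℝ) (u : α → α → ℂ), (∀ i, 0 ≤ p i) ∧ ∑ i, p i = 1 ∧
      (∀ i, sqNorm (u i) = 1) ∧ ρ = ∑ i, (p i : ℂ) • pureState (u i) := by
  obtain ⟨ev, u, hu, hu1, h1, hf⟩ := exists_eigenbasis h.1.isHermitian
  refine ⟨ev, u, fun i => eigenvalue_nonneg h.1 (hu i) (hu1 i), ?_, hu1,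
    eq_sum_of_cfc h.1.isHermitian hf⟩
  have e := sum_expect_eq_trace h1 ρ
  rw [Finset.sum_congr rfl fun n _ => expect_eigenvector (hu n) (hu1 n), h.2] at e
  exact_mod_cast e

theorem IsSeparable.posSemidef {α β : Type} [Fintype α] [Fintype β]
    {σ : Matrix (α × β) (α × β) ℂ} (h : IsSeparable σ) : σ.PosSemidef := by
  classical
  obtain ⟨n, p, σA, σB, hp, -, hA, hB, rfl⟩ := h
  exact Matrix.posSemidef_sum _ fun i _ =>
    ((hA i).1.kronecker (hB i).1).smul (by exact_mod_cast (hp i).le)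

section Sectors

variable {α β I K T : Type} [Fintype α] [DecidableEq α] [Fintype β] [DecidableEq β]
  [Fintype I] [DecidableEq I] [Fintype K] [DecidableEq K] [Fintype T] [DecidableEq T]
  {𝓐 : SectorBasis α I T} {𝓑 : SectorBasis β K T}

/-- A separable state is a mixture of pure product states, for each of which this is
`sum_dim_mul_norm_sq_le`. -/
theorem IsSeparable.sum_dim_mul_expect_le (𝓐 : SectorBasis α I T) (𝓑 : SectorBasis β K T)
    {σ : Matrix (α × β) (α × β) ℂ} (h : IsSeparable σ) :
    ∑ s, 𝓐.dim s * (star (𝓐.ent 𝓑 s) ⬝ᵥ (σ *ᵥ 𝓐.ent 𝓑 s)).re ≤ 1 := by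
  obtain ⟨n, p, σA, σB, hp, hp1, hA, hB, rfl⟩ := h
  have key : ∀ i, ∑ s, 𝓐.dim s *
      (star (𝓐.ent 𝓑 s) ⬝ᵥ ((σA i ⊗ₖ σB i) *ᵥ 𝓐.ent 𝓑 s)).re ≤ 1 := by
    intro i
    obtain ⟨a, u, ha, ha1, hu, hAi⟩ := exists_decomposition (hA i)
    obtain ⟨b, v, hb, hb1, hv, hBi⟩ := exists_decomposition (hB i)
    have e : σA i ⊗ₖ σB i = ∑ x : α × β, ((a x.1 * b x.2 : ℝ) : ℂ) •
        pureState (tensorVec (u x.1) (v x.2)) := by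
      rw [hAi, hBi]
      ext x y
      simp only [pureState_tensorVec, Matrix.kroneckerMap_apply, Matrix.sum_apply,
        Matrix.smul_apply, smul_eq_mul, Finset.sum_mul_sum, Fintype.sum_prod_type]
      push_cast
      exact Finset.sum_congr rfl fun _ _ => Finset.sum_congr rfl fun _ _ => by ring
    rw [e]
    simp only [dotProduct_sum_smul_mulVec, expect_pureState, ← Complex.ofReal_mul,
      ← Complex.ofReal_sum, Complex.ofReal_re, Finset.mul_sum]
    rw [Finset.sum_comm]
    calc _ ≤ ∑ x : α × β, a x.1 * b x.2 := by
          refine Finset.sum_le_sum fun x _ => ?_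
          have h1 := 𝓐.sum_dim_mul_norm_sq_le 𝓑 (u x.1) (v x.2)
          rw [hu, hv, one_mul] at h1
          calc _ = a x.1 * b x.2 * ∑ s : I × K, 𝓐.dim s *
                ‖star (𝓐.ent 𝓑 s) ⬝ᵥ tensorVec (u x.1) (v x.2)‖ ^ 2 := by
                rw [Finset.mul_sum]
                exact Finset.sum_congr rfl fun s _ => by ring
            _ ≤ _ := mul_le_of_le_one_right (mul_nonneg (ha _) (hb _)) h1
      _ = 1 := by rw [Fintype.sum_prod_type, ← Finset.sum_mul_sum, ha1, hb1, one_mul]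
  simp only [dotProduct_sum_smul_mulVec, Complex.re_sum, Complex.re_ofReal_mul, Finset.mul_sum]
  rw [Finset.sum_comm, ← hp1]
  refine Finset.sum_le_sum fun i _ => ?_
  have := mul_le_mul_of_nonneg_left (key i) (hp i).le
  rw [mul_one, Finset.mul_sum] at this
  refine le_trans (le_of_eq (Finset.sum_congr rfl fun s _ => ?_)) this
  ring

/-- The tangent line bound for the logarithm of a positive semidefinite matrix. -/
theorem expect_log_le {α : Type} [Fintype α] [DecidableEq α] {σ : Matrix α α ℂ}
    (hσ : σ.PosSemidef) {ψ : α → ℂ} (hψ : sqNorm ψ = 1)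
    (hker : ∀ u, σ *ᵥ u = 0 → star u ⬝ᵥ ψ = 0) {y : ℝ} (hy : 0 < y) :
    (star ψ ⬝ᵥ (cfc Real.log σ *ᵥ ψ)).re ≤
      Real.log y - 1 + (star ψ ⬝ᵥ (σ *ᵥ ψ)).re / y := by
  obtain ⟨ev, u, hu, hu1, h1, hf⟩ := exists_eigenbasis hσ.isHermitian
  have hs := sum_norm_dotProduct_sq h1 ψ
  have e : star ψ ⬝ᵥ (σ *ᵥ ψ) = ((∑ i, ev i * ‖star (u i) ⬝ᵥ ψ‖ ^ 2 : ℝ) : ℂ) := by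
    conv_lhs => rw [eq_sum_of_cfc hσ.isHermitian hf]
    rw [dotProduct_sum_smul_mulVec]
    simp only [expect_pureState, norm_dotProduct_comm ψ]
    push_cast; rfl
  rw [e, hf, dotProduct_sum_smul_mulVec]
  simp only [expect_pureState, norm_dotProduct_comm ψ, ← Complex.ofReal_mul, ← Complex.ofReal_sum,
    Complex.ofReal_re]
  rw [hψ] at hs
  calc _ ≤ ∑ i, ((Real.log y - 1) * ‖star (u i) ⬝ᵥ ψ‖ ^ 2 +
        ev i * ‖star (u i) ⬝ᵥ ψ‖ ^ 2 / y) := by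
        refine Finset.sum_le_sum fun i _ => ?_
        have hev : 0 ≤ ev i := eigenvalue_nonneg hσ (hu i) (hu1 i)
        rcases hev.eq_or_lt with h0 | h0
        -- Here log 0 is 0 by convention rather than -∞; orthogonality of `ψ` to the kernel removes
        -- the term.
        · rw [hker (u i) (by rw [hu, ← h0]; simp)]; simp
        · have h2 := Real.log_le_sub_one_of_pos (div_pos h0 hy)
          rw [Real.log_div h0.ne' hy.ne'] at h2
          have h3 : 0 ≤ ‖star (u i) ⬝ᵥ ψ‖ ^ 2 := by positivity
          have h4 : ev i * ‖star (u i) ⬝ᵥ ψ‖ ^ 2 / y = ev i / y * ‖star (u i) ⬝ᵥ ψ‖ ^ 2 := by ring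
          rw [h4]
          nlinarith
    _ = _ := by rw [Finset.sum_add_distrib, ← Finset.mul_sum, hs, mul_one, Finset.sum_div]

namespace SectorWeights

variable (W : SectorWeights 𝓐 𝓑)

theorem isLeast_relativeEntropyValues : IsLeast (relativeEntropyValues W.mixture) W.value := by
  constructor
  · refine ⟨W.dephased, W.isSeparable_dephased, fun v => W.mixture_mulVec_eq_zero, ?_⟩
    rw [relativeEntropy_eq, value]
    refine Finset.sum_congr rfl fun s _ => ?_
    by_cases h : W.w s = 0
    · simp [h]
    · have hd : (𝓐.dim s : ℝ) ≠ 0 := by exact_mod_cast (W.dim_pos h).ne'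
      rw [cfc_mulVec_eigenvector W.posSemidef_dephased.isHermitian Real.log
        (W.dephased_mulVec_ent h), dotProduct_smul, W.inner_ent h, if_pos rfl, smul_eq_mul,
        mul_one, Complex.ofReal_re, Real.log_div h hd]
      ring
  · rintro r ⟨σ, hσ, hker, rfl⟩
    rw [relativeEntropy_eq]
    have hpsd := hσ.posSemidef
    have hW := hσ.sum_dim_mul_expect_le 𝓐 𝓑
    -- The tangent is taken at w_s/d_s, the value attained by the dephased state. Summed over s, the
    -- corrections w_s and -d_s⟨s|σ|s⟩ contribute a nonnegative total.
    have hb : ∀ s, W.w s * Real.log (𝓐.dim s) + W.w s -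
        𝓐.dim s * (star (𝓐.ent 𝓑 s) ⬝ᵥ (σ *ᵥ 𝓐.ent 𝓑 s)).re ≤
        W.w s * (Real.log (W.w s) -
          (star (𝓐.ent 𝓑 s) ⬝ᵥ (cfc Real.log σ *ᵥ 𝓐.ent 𝓑 s)).re) := by
      intro s
      by_cases h : W.w s = 0
      · have h1 := (Complex.le_def.1 (hpsd.dotProduct_mulVec_nonneg (𝓐.ent 𝓑 s))).1
        have : (0 : ℝ) ≤ 𝓐.dim s := Nat.cast_nonneg _
        simp only [Complex.zero_re] at h1
        rw [h]; nlinarith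
      · have hd : (0 : ℝ) < 𝓐.dim s := by exact_mod_cast W.dim_pos h
        have hw := W.pos h
        have h1 := expect_log_le hpsd ((isUnitVector_iff _).1 (W.isUnitVector_ent h))
          (fun u hu => ?_) (div_pos hw hd)
        · rw [Real.log_div h hd.ne'] at h1
          have h2 := mul_le_mul_of_nonneg_left h1 hw.le
          have h3 : W.w s * (Real.log (W.w s) - Real.log (𝓐.dim s) - 1 +
              (star (𝓐.ent 𝓑 s) ⬝ᵥ (σ *ᵥ 𝓐.ent 𝓑 s)).re / (W.w s / 𝓐.dim s)) =
              W.w s * (Real.log (W.w s) - Real.log (𝓐.dim s) - 1) +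
              𝓐.dim s * (star (𝓐.ent 𝓑 s) ⬝ᵥ (σ *ᵥ 𝓐.ent 𝓑 s)).re := by
            field_simp
          rw [h3] at h2
          linarith
        -- Kernel vectors of `σ` are killed by the mixture, hence orthogonal to its eigenvector `ent
        -- s` of nonzero eigenvalue.
        · have h2 := hker u hu
          have h3 : star (𝓐.ent 𝓑 s) ⬝ᵥ (W.mixture *ᵥ u) = W.w s * (star (𝓐.ent 𝓑 s) ⬝ᵥ u) := by
            rw [Matrix.dotProduct_mulVec, ← W.posSemidef_mixture.isHermitian.eq,
              ← Matrix.star_mulVec, W.mixture_mulVec_ent h, star_smul, smul_dotProduct]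
            simp
          rw [h2, dotProduct_zero, eq_comm, mul_eq_zero] at h3
          have h4 := h3.resolve_left (by exact_mod_cast h)
          rw [Matrix.star_dotProduct, h4, star_zero]
    have hsum := Finset.sum_le_sum fun s (_ : s ∈ Finset.univ) => hb s
    rw [Finset.sum_sub_distrib, Finset.sum_add_distrib, W.sum_eq_one] at hsum
    rw [value]
    linarith

end SectorWeights

end Sectors

end SpinEntanglement

namespace SpinEntanglement

/-! ### The maximally entangled vector -/

theorem maxEntangled_eq (M : ℕ) : maxEntangled M = ((1 / √(M : ℝ) : ℝ) : ℂ) •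
    ∑ m : Fin M, tensorVec (Pi.single m 1) (Pi.single m 1) := by
  ext x
  simp only [maxEntangled, tensorVec, Pi.smul_apply, Finset.sum_apply, Pi.single_apply,
    smul_eq_mul, mul_ite, mul_one, mul_zero]
  rw [Finset.sum_eq_single x.1]
  · by_cases h : x.1 = x.2 <;> simp [h, eq_comm]
  · intro m _ hne; simp [hne.symm]
  · simp

theorem star_maxEntangled_dotProduct_tensorVec (M : ℕ) (a b : Fin M → ℂ) :
    star (maxEntangled M) ⬝ᵥ tensorVec a b = ((1 / √(M : ℝ) : ℝ) : ℂ) * ∑ m, a m * b m := by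
  rw [maxEntangled_eq, star_smul, smul_dotProduct, star_sum, sum_dotProduct]
  simp only [star_tensorVec_dotProduct, RCLike.star_def, Complex.conj_ofReal, smul_eq_mul]
  congr 1
  refine Finset.sum_congr rfl fun m _ => ?_
  rw [show star (Pi.single m 1 : Fin M → ℂ) = Pi.single m 1 by
    rw [Pi.star_single, star_one], single_one_dotProduct, single_one_dotProduct]

theorem sqNorm_single {α : Type} [Fintype α] [DecidableEq α] (a : α) :
    sqNorm (Pi.single a 1 : α → ℂ) = 1 := by
  rw [sqNorm, Finset.sum_eq_single a] <;> simp +contextual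

theorem star_single_dotProduct {α : Type} [Fintype α] [DecidableEq α] (a : α) (v : α → ℂ) :
    star (Pi.single a 1 : α → ℂ) ⬝ᵥ v = v a := by
  rw [Pi.star_single, star_one, single_one_dotProduct]

theorem sum_pureState_single {α : Type} [Fintype α] [DecidableEq α] :
    ∑ a : α, pureState (Pi.single a 1 : α → ℂ) = 1 := by
  ext i j
  simp only [Matrix.sum_apply, pureState, Matrix.vecMulVec_apply, Pi.star_apply, Pi.single_apply,
    Matrix.one_apply]
  rw [Finset.sum_eq_single i]
  · by_cases h : i = j <;> simp [h, eq_comm]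
  · intro a _ hne; simp [hne.symm]
  · simp

/-- Cauchy–Schwarz: a product vector overlaps a maximally entangled vector by at most 1/M, and
product Kraus operators keep product vectors product. -/
theorem norm_maxEntangled_tensorVec_sq_le (M : ℕ) (a b : Fin M → ℂ) :
    ‖star (maxEntangled M) ⬝ᵥ tensorVec a b‖ ^ 2 ≤ 1 / M * (sqNorm a * sqNorm b) := by
  rw [star_maxEntangled_dotProduct_tensorVec, norm_mul, mul_pow, SectorBasis.norm_inv_sqrt_sq]
  gcongr
  exact norm_sum_mul_sq_le _ _ _

theorem norm_dotProduct_sq_le {α : Type} [Fintype α] (a b : α → ℂ) :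
    ‖star a ⬝ᵥ b‖ ^ 2 ≤ sqNorm a * sqNorm b := by
  have := norm_sum_mul_sq_le Finset.univ (star a) b
  simpa only [dotProduct, sqNorm, Pi.star_apply, norm_star] using this

theorem sqNorm_maxEntangled {M : ℕ} (hM : 0 < M) : sqNorm (maxEntangled M) = 1 := by
  have h := star_dotProduct_self (maxEntangled M)
  nth_rw 2 [maxEntangled_eq] at h
  rw [dotProduct_smul, dotProduct_sum] at h
  simp only [star_maxEntangled_dotProduct_tensorVec, Pi.single_apply, mul_ite, mul_one, mul_zero,
    Finset.sum_ite_eq', Finset.mem_univ, if_true, Finset.sum_const, Finset.card_univ,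
    Fintype.card_fin] at h
  have hM' : (0 : ℝ) < M := by exact_mod_cast hM
  have e : (1 / √(M : ℝ)) * (M * (1 / √(M : ℝ))) = 1 := by
    have := Real.mul_self_sqrt hM'.le
    have h0 : √(M : ℝ) ≠ 0 := (Real.sqrt_pos.2 hM').ne'
    field_simp; nlinarith
  rw [smul_eq_mul, nsmul_eq_mul, ← Complex.ofReal_natCast, ← Complex.ofReal_mul,
    ← Complex.ofReal_mul, e] at h
  exact_mod_cast h.symm

section Sectors

variable {α β I K T : Type} [Fintype α] [DecidableEq α] [Fintype β] [DecidableEq β]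
  [Fintype I] [DecidableEq I] [Fintype K] [DecidableEq K] [Fintype T] [DecidableEq T]

namespace SectorWeights

variable {𝓐 : SectorBasis α I T} {𝓑 : SectorBasis β K T} (W : SectorWeights 𝓐 𝓑)

/-! ### Converse bounds for single protocols -/

theorem expect_sum_branch {α' β' ι : Type} [Fintype α'] [Fintype β'] [Fintype ι]
    (A : ι → Matrix α' α ℂ) (B : ι → Matrix β' β ℂ) (φ : α' × β' → ℂ) :
    (star φ ⬝ᵥ ((∑ i, branch (A i) (B i) W.mixture) *ᵥ φ)).re =
      ∑ s, W.w s * ∑ i, ‖star φ ⬝ᵥ ((A i ⊗ₖ B i) *ᵥ 𝓐.ent 𝓑 s)‖ ^ 2 := by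
  rw [Matrix.sum_mulVec, dotProduct_sum, Complex.re_sum]
  simp only [mixture, branch_sum_smul, branch_pureState, dotProduct_sum_smul_mulVec,
    expect_pureState, ← Complex.ofReal_mul, ← Complex.ofReal_sum, Complex.ofReal_re,
    Finset.mul_sum]
  rw [Finset.sum_comm]

/-- The fidelity with a maximally entangled state of Schmidt rank `M` that is reached from the
mixture. -/
theorem fidelity_le {M : ℕ} (hM : 0 < M) {τ : Matrix (Fin M × Fin M) (Fin M × Fin M) ℂ}
    (h : LOCCConvertible W.mixture τ) :
    (star (maxEntangled M) ⬝ᵥ (τ *ᵥ maxEntangled M)).re ≤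
      ∑ s, W.w s * min 1 ((𝓐.dim s : ℝ) / M) := by
  obtain ⟨ι, _, A, B, hAB, rfl⟩ := h
  rw [expect_sum_branch]
  refine Finset.sum_le_sum fun s _ => ?_
  by_cases hs : W.w s = 0
  · simp [hs]
  refine mul_le_mul_of_nonneg_left (le_min ?_ ?_) (W.nonneg s)
  · rw [← (isUnitVector_iff _).1 (W.isUnitVector_ent hs), ← hAB.sum_sqNorm]
    refine Finset.sum_le_sum fun i _ => (norm_dotProduct_sq_le _ _).trans ?_
    rw [sqNorm_maxEntangled hM, one_mul]
  · have hd : (0 : ℝ) < 𝓐.dim s := by exact_mod_cast W.dim_pos hs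
    -- `ent s` is a sum of d_s product vectors with amplitude d_s^{-1/2}, so its fidelity is at most
    -- the sum of theirs, each bounded by 1/M on average over the records.
    calc _ ≤ ∑ i, ∑ t ∈ 𝓐.supp s.1, 1 / (M : ℝ) *
          sqNorm ((A i ⊗ₖ B i) *ᵥ tensorVec (𝓐.vec s.1 t) (𝓑.vec s.2 t)) := by
          refine Finset.sum_le_sum fun i _ => ?_
          rw [SectorBasis.ent, Matrix.mulVec_smul, dotProduct_smul, Matrix.mulVec_sum,
            dotProduct_sum, smul_eq_mul, norm_mul, mul_pow, SectorBasis.norm_inv_sqrt_sq]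
          calc _ ≤ 1 / (𝓐.dim s : ℝ) * (𝓐.dim s * ∑ t ∈ 𝓐.supp s.1,
                ‖star (maxEntangled M) ⬝ᵥ
                  ((A i ⊗ₖ B i) *ᵥ tensorVec (𝓐.vec s.1 t) (𝓑.vec s.2 t))‖ ^ 2) := by
                gcongr
                exact norm_sum_sq_le _ _
            _ = ∑ t ∈ 𝓐.supp s.1, ‖star (maxEntangled M) ⬝ᵥ
                  ((A i ⊗ₖ B i) *ᵥ tensorVec (𝓐.vec s.1 t) (𝓑.vec s.2 t))‖ ^ 2 := by
                field_simp
            _ ≤ _ := by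
                refine Finset.sum_le_sum fun _ _ => ?_
                rw [kronecker_mulVec_tensorVec, sqNorm_tensorVec]
                exact norm_maxEntangled_tensorVec_sq_le _ _ _
      _ = (𝓐.dim s : ℝ) / M := by
          rw [Finset.sum_comm]
          simp only [← Finset.mul_sum, hAB.sum_sqNorm]
          rw [Finset.sum_congr rfl fun t ht => by
            rw [sqNorm_tensorVec, 𝓐.sqNorm_vec ht, 𝓑.sqNorm_vec (W.supp_eq s hs ▸ ht), mul_one]]
          rw [Finset.sum_const, nsmul_eq_mul, mul_one, SectorBasis.dim]
          ring

end SectorWeights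

/-- What LOCC produces from a maximally entangled state of Schmidt rank `M` has small overlap with
maximally entangled states of larger Schmidt rank. -/
theorem sum_dim_mul_expect_le_of_convertible (𝓐 : SectorBasis α I T) (𝓑 : SectorBasis β K T)
    {M : ℕ} (hM : 0 < M) {τ : Matrix (α × β) (α × β) ℂ}
    (h : LOCCConvertible (pureState (maxEntangled M)) τ) :
    ∑ s, 𝓐.dim s * (star (𝓐.ent 𝓑 s) ⬝ᵥ (τ *ᵥ 𝓐.ent 𝓑 s)).re ≤ M := by
  obtain ⟨ι, _, A, B, hAB, rfl⟩ := h
  have hM' : (0 : ℝ) < M := by exact_mod_cast hM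
  -- The images of the M product terms of the maximally entangled vector stay product vectors. Over
  -- all records their squared norms sum to M.
  set φ : ι → Fin M → α × β → ℂ := fun i m => tensorVec (A i *ᵥ Pi.single m 1)
    (B i *ᵥ Pi.single m 1) with hφ
  have hle : ∀ s, (star (𝓐.ent 𝓑 s) ⬝ᵥ ((∑ i, branch (A i) (B i)
      (pureState (maxEntangled M))) *ᵥ 𝓐.ent 𝓑 s)).re ≤
      ∑ i, ∑ m, ‖star (𝓐.ent 𝓑 s) ⬝ᵥ φ i m‖ ^ 2 := by
    intro s
    rw [Matrix.sum_mulVec, dotProduct_sum, Complex.re_sum]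
    refine Finset.sum_le_sum fun i _ => ?_
    rw [branch_pureState, expect_pureState, Complex.ofReal_re, maxEntangled_eq,
      Matrix.mulVec_smul, dotProduct_smul, Matrix.mulVec_sum, dotProduct_sum, smul_eq_mul, norm_mul,
      mul_pow, SectorBasis.norm_inv_sqrt_sq]
    simp only [kronecker_mulVec_tensorVec]
    have := norm_sum_sq_le Finset.univ fun m => star (𝓐.ent 𝓑 s) ⬝ᵥ φ i m
    rw [Finset.card_univ, Fintype.card_fin] at this
    calc _ ≤ 1 / (M : ℝ) * (M * ∑ m, ‖star (𝓐.ent 𝓑 s) ⬝ᵥ φ i m‖ ^ 2) := by gcongr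
      _ = _ := by field_simp
  calc _ ≤ ∑ s, 𝓐.dim s * ∑ i, ∑ m, ‖star (𝓐.ent 𝓑 s) ⬝ᵥ φ i m‖ ^ 2 :=
        Finset.sum_le_sum fun s _ => mul_le_mul_of_nonneg_left (hle s) (Nat.cast_nonneg _)
    _ = ∑ m, ∑ i, ∑ s, 𝓐.dim s * ‖star (𝓐.ent 𝓑 s) ⬝ᵥ φ i m‖ ^ 2 := by
        simp only [Finset.mul_sum]
        rw [Finset.sum_comm, Finset.sum_congr rfl fun i _ => Finset.sum_comm, Finset.sum_comm]
    _ ≤ ∑ m : Fin M, ∑ i, sqNorm (φ i m) := by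
        refine Finset.sum_le_sum fun m _ => Finset.sum_le_sum fun i _ => ?_
        rw [hφ, sqNorm_tensorVec]
        exact 𝓐.sum_dim_mul_norm_sq_le 𝓑 _ _
    _ = M := by
        simp only [hφ, ← kronecker_mulVec_tensorVec, hAB.sum_sqNorm, sqNorm_tensorVec,
          sqNorm_single]
        simp

/-! ### Distillation by measuring blocks -/

omit [Fintype T] in
-- The enumeration depends on the set alone, so two parties with equal supports number their basis
-- vectors identically.
theorem exists_enumeration (D : Finset T) :
    ∃ f : T → ℕ, Set.InjOn f D ∧ ∀ t ∈ D, f t < D.card := by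
  refine ⟨fun t => if h : t ∈ D then D.equivFin ⟨t, h⟩ else 0, ?_, ?_⟩
  · intro t ht t' ht' he
    simp only [Finset.mem_coe] at ht ht'
    simp only [ht, ht', dif_pos] at he
    simpa using D.equivFin.injective (Fin.ext he)
  · intro t ht
    simp only [ht, dif_pos]
    exact (D.equivFin ⟨t, ht⟩).2

/-- An enumeration of a finite set. -/
noncomputable def enumeration (D : Finset T) : T → ℕ := (exists_enumeration D).choose

omit [Fintype T] in
theorem enumeration_injOn (D : Finset T) : Set.InjOn (enumeration D) D :=
  (exists_enumeration D).choose_spec.1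

omit [Fintype T] in
theorem enumeration_lt {D : Finset T} {t : T} (ht : t ∈ D) : enumeration D t < D.card :=
  (exists_enumeration D).choose_spec.2 t ht

/-- The `b`-th block of `M` consecutive elements in the enumeration of a finite set. -/
noncomputable def block (M : ℕ) (D : Finset T) (b : ℕ) : Finset T :=
  D.filter fun t => enumeration D t / M = b

omit [Fintype T] in
theorem sum_block {R : Type} [AddCommMonoid R] (M : ℕ) (D : Finset T) {N : ℕ}
    (hN : (D.card - 1) / M < N) (f : T → R) :
    ∑ b ∈ Finset.range N, ∑ t ∈ block M D b, f t = ∑ t ∈ D, f t :=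
  Finset.sum_fiberwise_of_maps_to (fun _ ht => Finset.mem_range.2
    ((Nat.div_le_div_right (Nat.le_sub_one_of_lt (enumeration_lt ht))).trans_lt hN)) f

omit [Fintype T] in
-- A block with n_b elements contributes fidelity n_b²/(dM). As the n_b sum to d, Cauchy–Schwarz
-- over the number of blocks gives the bound.
theorem card_div_le_sum_block {M : ℕ} (hM : 0 < M) {D : Finset T} (hD : D.Nonempty) :
    (D.card : ℝ) / (D.card + (M - 1)) ≤
      ∑ b ∈ Finset.range ((D.card - 1) / M + 1),
        ((block M D b).card : ℝ) ^ 2 / (D.card * M) := by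
  have hd : (0 : ℝ) < D.card := by exact_mod_cast hD.card_pos
  have hm : (0 : ℝ) < M := by exact_mod_cast hM
  have hm1 : (1 : ℝ) ≤ M := by exact_mod_cast hM
  have h1 : ∑ b ∈ Finset.range ((D.card - 1) / M + 1), ((block M D b).card : ℝ) = D.card := by
    have := sum_block M D (Nat.lt_succ_self ((D.card - 1) / M)) fun _ => (1 : ℝ)
    simpa using this
  have h2 := sq_sum_le_card_mul_sum_sq (s := Finset.range ((D.card - 1) / M + 1))
    (f := fun b => ((block M D b).card : ℝ))
  rw [h1, Finset.card_range] at h2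
  -- The number of blocks is ⌈d/M⌉. Keeping M - 1 instead of M makes the final bound equal to 1 for
  -- M = 1.
  have h3 : (((D.card - 1) / M + 1 : ℕ) : ℝ) ≤ (D.card + (M - 1)) / M := by
    rw [le_div_iff₀ hm]
    have h4 : (D.card - 1) / M * M ≤ D.card - 1 := Nat.div_mul_le_self _ _
    have h5 := hD.card_pos
    have h : ((((D.card - 1) / M + 1) * M + 1 : ℕ) : ℝ) ≤ ((D.card + M : ℕ) : ℝ) := by
      exact_mod_cast (by rw [add_mul]; omega : ((D.card - 1) / M + 1) * M + 1 ≤ D.card + M)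
    push_cast at h ⊢
    linarith
  have hp : (0 : ℝ) < D.card + (M - 1) := by linarith
  rw [← Finset.sum_div, div_le_div_iff₀ hp (by positivity)]
  set S := ∑ b ∈ Finset.range ((D.card - 1) / M + 1), ((block M D b).card : ℝ) ^ 2
  have hS : 0 ≤ S := Finset.sum_nonneg fun _ _ => by positivity
  have h4 : (D.card : ℝ) ^ 2 ≤ (D.card + (M - 1)) / M * S := h2.trans (by gcongr)
  rw [div_mul_eq_mul_div, le_div_iff₀ hm] at h4
  nlinarith

namespace SectorBasis

variable (𝓐 : SectorBasis α I T) {M : ℕ} (hM : 0 < M)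

/-- The position of a basis vector in its block. -/
noncomputable def blockPos (i : I) (t : T) : Fin M :=
  ⟨enumeration (𝓐.supp i) t % M, Nat.mod_lt _ hM⟩

/-- The measurement of the sector and of the block of length `M` in it. -/
noncomputable def blockKraus (x : I × Fin (Fintype.card T + 1)) : Matrix (Fin M) α ℂ :=
  transfer (block M (𝓐.supp x.1) x.2) (fun t => Pi.single (𝓐.blockPos hM x.1 t) 1) (𝓐.vec x.1)

theorem sum_blockKraus : ∑ x, (𝓐.blockKraus hM x)ᴴ * 𝓐.blockKraus hM x = 1 := by
  rw [← 𝓐.sum_supp_pureState, Fintype.sum_prod_type]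
  refine Finset.sum_congr rfl fun i _ => ?_
  -- The bound `Fintype.card T + 1` on the number of blocks serves all sectors at once; surplus
  -- blocks are empty and give zero Kraus operators.
  rw [← sum_block M (𝓐.supp i) (N := Fintype.card T + 1)
    (Nat.lt_succ_of_le ((Nat.div_le_self _ _).trans
      ((Nat.sub_le _ _).trans (Finset.card_le_univ _)))),
    Finset.sum_range]
  refine Finset.sum_congr rfl fun b _ => ?_
  refine transfer_conjTranspose_mul_self _ _ _ fun t ht t' ht' => ?_
  rw [star_single_dotProduct, Pi.single_apply]
  congr 1
  simp only [block, Finset.mem_filter] at ht ht'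
  rw [eq_iff_iff]
  refine ⟨fun h => enumeration_injOn _ ht.1 ht'.1 ?_, fun h => by rw [h]⟩
  have h1 := congrArg Fin.val h
  simp only [blockPos] at h1
  rw [← Nat.div_add_mod (enumeration (𝓐.supp i) t) M, ht.2, h1, ← ht'.2, Nat.div_add_mod]

theorem blockKraus_mulVec (i : I) (b : Fin (Fintype.card T + 1)) (t : T) :
    𝓐.blockKraus hM (i, b) *ᵥ 𝓐.vec i t =
      if t ∈ block M (𝓐.supp i) b then Pi.single (𝓐.blockPos hM i t) 1 else 0 := by
  rw [blockKraus, transfer_mulVec]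
  simp only [𝓐.inner_vec]
  split_ifs with ht
  · rw [Finset.sum_eq_single t]
    · simp [(Finset.mem_filter.1 ht).1]
    · intro t' _ hne; simp [hne]
    · exact fun h => absurd ht h
  · refine Finset.sum_eq_zero fun t' ht' => ?_
    rw [if_neg, zero_smul]
    rintro ⟨-, rfl, -⟩; exact ht ht'

end SectorBasis

namespace SectorWeights

variable {𝓐 : SectorBasis α I T} {𝓑 : SectorBasis β K T} (W : SectorWeights 𝓐 𝓑)

theorem maxEntangled_blockKraus {M : ℕ} (hM : 0 < M) {s : I × K} (hs : W.w s ≠ 0)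
    (b : Fin (Fintype.card T + 1)) :
    star (maxEntangled M) ⬝ᵥ
      ((𝓐.blockKraus hM (s.1, b) ⊗ₖ 𝓑.blockKraus hM (s.2, b)) *ᵥ 𝓐.ent 𝓑 s) =
      ((1 / √(𝓐.dim s : ℝ) : ℝ) : ℂ) * (((1 / √(M : ℝ) : ℝ) : ℂ) *
        (block M (𝓐.supp s.1) b).card) := by
  rw [SectorBasis.ent, Matrix.mulVec_smul, dotProduct_smul, Matrix.mulVec_sum, dotProduct_sum,
    smul_eq_mul]
  congr 1
  have hpos : ∀ t, 𝓑.blockPos hM s.2 t = 𝓐.blockPos hM s.1 t := fun t => by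
    simp only [SectorBasis.blockPos, W.supp_eq s hs]
  have h : ∀ t ∈ 𝓐.supp s.1, star (maxEntangled M) ⬝ᵥ
      ((𝓐.blockKraus hM (s.1, b) ⊗ₖ 𝓑.blockKraus hM (s.2, b)) *ᵥ
        tensorVec (𝓐.vec s.1 t) (𝓑.vec s.2 t)) =
      if enumeration (𝓐.supp s.1) t / M = b then ((1 / √(M : ℝ) : ℝ) : ℂ) else 0 := by
    intro t ht
    rw [kronecker_mulVec_tensorVec, star_maxEntangled_dotProduct_tensorVec,
      SectorBasis.blockKraus_mulVec, SectorBasis.blockKraus_mulVec, ← W.supp_eq s hs, hpos]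
    have hb : t ∈ block M (𝓐.supp s.1) b ↔ enumeration (𝓐.supp s.1) t / M = b := by
      simp [block, ht]
    by_cases h : enumeration (𝓐.supp s.1) t / M = b
    · rw [if_pos (hb.2 h), if_pos h, Finset.sum_eq_single (𝓐.blockPos hM s.1 t)] <;> simp +contextual
    · rw [if_neg fun h' => h (hb.1 h'), if_neg h]; simp
  rw [Finset.sum_congr rfl h, ← Finset.sum_filter, Finset.sum_const, nsmul_eq_mul, block, mul_comm]

/-- Both parties measure sector and block independently; for `ent s` with positive weight the block
outcomes coincide, and a complete block is a maximally entangled vector of rank M. -/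
theorem exists_distillation {M : ℕ} (hM : 0 < M) :
    ∃ τ : Matrix (Fin M × Fin M) (Fin M × Fin M) ℂ, LOCCConvertible W.mixture τ ∧
      ∑ s, W.w s * ((𝓐.dim s : ℝ) / (𝓐.dim s + (M - 1))) ≤
        (star (maxEntangled M) ⬝ᵥ (τ *ᵥ maxEntangled M)).re := by
  refine ⟨_, loccConvertible_measurements (𝓐.blockKraus hM) (𝓐.sum_blockKraus hM)
    (fun _ => 𝓑.blockKraus hM) (fun _ => 𝓑.sum_blockKraus hM) W.mixture, ?_⟩
  rw [← Fintype.sum_prod_type' (f := fun x y => branch (𝓐.blockKraus hM x) (𝓑.blockKraus hM y)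
    W.mixture), W.expect_sum_branch (ι := (I × Fin (Fintype.card T + 1)) × (K × Fin (Fintype.card T + 1)))
      (fun z => 𝓐.blockKraus hM z.1) (fun z => 𝓑.blockKraus hM z.2) (maxEntangled M)]
  refine Finset.sum_le_sum fun s _ => ?_
  by_cases hs : W.w s = 0
  · simp [hs]
  refine mul_le_mul_of_nonneg_left ?_ (W.nonneg s)
  refine (card_div_le_sum_block hM (W.supp_nonempty s hs)).trans ?_
  -- Only records with sectors `s` and equal blocks are kept; all others contribute nonnegatively to
  -- the fidelity.
  set g : Fin (Fintype.card T + 1) → (I × Fin (Fintype.card T + 1)) ×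
    (K × Fin (Fintype.card T + 1)) := fun b => ((s.1, b), (s.2, b)) with hg
  have hinj : Function.Injective g := fun b b' h => by simpa [hg] using h
  have hle : ((𝓐.supp s.1).card - 1) / M + 1 ≤ Fintype.card T + 1 :=
    Nat.succ_le_succ ((Nat.div_le_self _ _).trans
      ((Nat.sub_le _ _).trans (Finset.card_le_univ _)))
  calc _ ≤ ∑ b ∈ Finset.range (Fintype.card T + 1), ((block M (𝓐.supp s.1) b).card : ℝ) ^ 2 /
        ((𝓐.supp s.1).card * M) :=
        Finset.sum_le_sum_of_subset_of_nonneg (Finset.range_subset_range.2 hle)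
          fun _ _ _ => by positivity
    _ = ∑ b, ‖star (maxEntangled M) ⬝ᵥ ((𝓐.blockKraus hM (g b).1 ⊗ₖ
          𝓑.blockKraus hM (g b).2) *ᵥ 𝓐.ent 𝓑 s)‖ ^ 2 := by
        rw [Finset.sum_range]
        refine Finset.sum_congr rfl fun b _ => ?_
        rw [hg, W.maxEntangled_blockKraus hM hs, norm_mul, norm_mul, mul_pow, mul_pow,
          SectorBasis.norm_inv_sqrt_sq, SectorBasis.norm_inv_sqrt_sq, SectorBasis.dim,
          Complex.norm_natCast]
        ring
    _ ≤ _ := by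
        rw [← Finset.sum_image (s := Finset.univ) (g := g) (f := fun z =>
          ‖star (maxEntangled M) ⬝ᵥ ((𝓐.blockKraus hM z.1 ⊗ₖ
          𝓑.blockKraus hM z.2) *ᵥ 𝓐.ent 𝓑 s)‖ ^ 2) fun b _ b' _ h => hinj h]
        exact Finset.sum_le_sum_of_subset_of_nonneg (Finset.subset_univ _)
          fun _ _ _ => by positivity

end SectorWeights

end Sectors

end SpinEntanglement

namespace SpinEntanglement

/-! ### Preparation by measuring blocks of a maximally entangled state -/

/-- One numbering `f` of the common support is used by both parties, which preserves their
correlation. Beyond the cardinality its value is an arbitrary default. -/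
theorem exists_decoding {T : Type} {D : Finset T} (hD : D.Nonempty) :
    ∃ f : ℕ → T, (∀ n < D.card, f n ∈ D) ∧ (∀ n < D.card, ∀ m < D.card, f n = f m → n = m) ∧
      ∀ {R : Type} [AddCommMonoid R] (g : T → R),
        ∑ n ∈ Finset.range D.card, g (f n) = ∑ t ∈ D, g t := by
  obtain ⟨t₀, -⟩ := id hD
  set f : ℕ → T := fun n => if h : n < D.card then D.equivFin.symm ⟨n, h⟩ else t₀ with hf
  have hfn : ∀ n (h : n < D.card), f n = D.equivFin.symm ⟨n, h⟩ := fun n h => by simp [hf, h]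
  refine ⟨f, fun n hn => ?_, fun n hn m hm h => ?_, fun g => ?_⟩
  · rw [hfn n hn]; exact (D.equivFin.symm _).2
  · rw [hfn n hn, hfn m hm] at h
    simpa using D.equivFin.symm.injective (Subtype.ext h)
  · rw [Finset.sum_range, ← Finset.sum_coe_sort D g,
      ← D.equivFin.symm.sum_comp (fun x => g x)]
    exact Finset.sum_congr rfl fun n _ => by rw [hfn n n.2]

/-- The `b`-th block of `D` consecutive elements of `Fin M`. -/
def finBlock (M D b : ℕ) : Finset (Fin M) := Finset.univ.filter fun m => m.val / D = b

theorem mem_finBlock {M D b : ℕ} {m : Fin M} : m ∈ finBlock M D b ↔ m.val / D = b := by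
  simp [finBlock]

theorem mod_injOn_div {D m m' b : ℕ} (hm : m / D = b) (hm' : m' / D = b) (h : m % D = m' % D) :
    m = m' := by
  rw [← Nat.div_add_mod m D, ← Nat.div_add_mod m' D, hm, hm', h]

theorem sum_mod_of_div_eq {R : Type} [AddCommMonoid R] {M D b : ℕ} (hD : 0 < D) (hb : b < M / D)
    (g : ℕ → R) : ∑ m ∈ finBlock M D b, g (m % D) = ∑ n ∈ Finset.range D, g n := by
  have hbD : (b + 1) * D ≤ M := (Nat.mul_le_mul_right D hb).trans (Nat.div_mul_le_self M D)
  refine Finset.sum_bij (fun m _ => (m : ℕ) % D) (fun m _ => Finset.mem_range.2 (Nat.mod_lt _ hD))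
    (fun m hm m' hm' h => ?_) (fun n hn => ?_) fun _ _ => rfl
  · rw [mem_finBlock] at hm hm'
    exact Fin.ext (mod_injOn_div hm hm' h)
  · have hn' := Finset.mem_range.1 hn
    refine ⟨⟨D * b + n, by nlinarith⟩, ?_, ?_⟩
    · rw [mem_finBlock]; simp [Nat.mul_add_div hD, Nat.div_eq_of_lt hn']
    · simp [Nat.mod_eq_of_lt hn']

section Sectors

variable {α β I K T : Type} [Fintype α] [DecidableEq α] [Fintype β] [DecidableEq β]
  [Fintype I] [DecidableEq I] [Fintype K] [DecidableEq K] [Fintype T] [DecidableEq T]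

namespace SectorBasis

variable (𝓐 : SectorBasis α I T)

/-- The measurement of the block of length `D`, followed by an embedding into sector `i`. -/
noncomputable def embedKraus (M D : ℕ) (f : ℕ → T) (i : I) (b : ℕ) : Matrix α (Fin M) ℂ :=
  transfer (finBlock M D b)
    (fun m => 𝓐.vec i (f (m % D))) fun m => Pi.single m 1

theorem sum_embedKraus {M : ℕ} {f : ℕ → T} {i : I} (hD : 0 < (𝓐.supp i).card)
    (hf : ∀ n < (𝓐.supp i).card, f n ∈ 𝓐.supp i)
    (hinj : ∀ n < (𝓐.supp i).card, ∀ m < (𝓐.supp i).card, f n = f m → n = m) :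
    ∑ b : Fin (M + 1), (𝓐.embedKraus M (𝓐.supp i).card f i b)ᴴ *
      𝓐.embedKraus M (𝓐.supp i).card f i b = 1 := by
  rw [← sum_pureState_single]
  have h : ∀ b : ℕ, (𝓐.embedKraus M (𝓐.supp i).card f i b)ᴴ *
      𝓐.embedKraus M (𝓐.supp i).card f i b =
      ∑ m ∈ finBlock M (𝓐.supp i).card b, pureState (Pi.single m 1 : Fin M → ℂ) := by
    intro b
    refine transfer_conjTranspose_mul_self _ _ _ fun m hm m' hm' => ?_
    rw [𝓐.inner_vec_of_mem (hf _ (Nat.mod_lt _ hD))]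
    congr 1
    rw [eq_iff_iff]
    rw [mem_finBlock] at hm hm'
    refine ⟨fun he => Fin.ext (mod_injOn_div hm hm' ?_), fun he => by rw [he]⟩
    exact hinj _ (Nat.mod_lt _ hD) _ (Nat.mod_lt _ hD) he
  simp only [h]
  rw [← Finset.sum_range fun b => ∑ m ∈ finBlock M (𝓐.supp i).card b,
    pureState (Pi.single m 1 : Fin M → ℂ)]
  refine Finset.sum_fiberwise_of_maps_to (fun m _ => Finset.mem_range.2 ?_) _
  exact Nat.lt_succ_of_le ((Nat.div_le_self _ _).trans m.2.le)

theorem embedKraus_mulVec (M D : ℕ) (f : ℕ → T) (i : I) (b : ℕ) (m : Fin M) :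
    𝓐.embedKraus M D f i b *ᵥ Pi.single m 1 =
      if (m : ℕ) / D = b then 𝓐.vec i (f (m % D)) else 0 := by
  rw [embedKraus, transfer_mulVec]
  simp only [star_single_dotProduct, Pi.single_apply, ite_smul, one_smul, zero_smul]
  rw [Finset.sum_ite_eq']
  simp [mem_finBlock]

/-- The vector that is prepared from block `b` of a maximally entangled state. -/
noncomputable def prepared (𝓑 : SectorBasis β K T) (M D : ℕ) (f : ℕ → T) (s : I × K) (b : ℕ) :
    α × β → ℂ :=
  ((1 / √(M : ℝ) : ℝ) : ℂ) • ∑ m ∈ finBlock M D b,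
    tensorVec (𝓐.vec s.1 (f (m % D))) (𝓑.vec s.2 (f (m % D)))

theorem embedKraus_mulVec_maxEntangled (𝓑 : SectorBasis β K T) (M D : ℕ) (f : ℕ → T) (s : I × K)
    (b b' : ℕ) : (𝓐.embedKraus M D f s.1 b ⊗ₖ 𝓑.embedKraus M D f s.2 b') *ᵥ maxEntangled M =
      if b = b' then 𝓐.prepared 𝓑 M D f s b else 0 := by
  rw [maxEntangled_eq, Matrix.mulVec_smul, Matrix.mulVec_sum]
  simp only [kronecker_mulVec_tensorVec, embedKraus_mulVec]
  split_ifs with h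
  · subst h
    rw [prepared, finBlock, Finset.sum_filter]
    congr 1
    refine Finset.sum_congr rfl fun m _ => ?_
    split_ifs
    · rfl
    · ext; simp [tensorVec]
  · rw [Finset.sum_eq_zero, smul_zero]
    intro m _
    split_ifs with h1 h2
    · exact absurd (h1.symm.trans h2) h
    all_goals ext; simp [tensorVec]

end SectorBasis

namespace SectorWeights

variable {𝓐 : SectorBasis α I T} {𝓑 : SectorBasis β K T} (W : SectorWeights 𝓐 𝓑)

/-- A complete block runs once through the support, so it yields `ent s` exactly, with probability
d/M. -/
theorem prepared_eq {s : I × K} (hs : W.w s ≠ 0) {M b : ℕ} (hb : b < M / 𝓐.dim s) {f : ℕ → T}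
    (hsum : ∀ g : T → α × β → ℂ,
      ∑ n ∈ Finset.range (𝓐.dim s), g (f n) = ∑ t ∈ 𝓐.supp s.1, g t) :
    𝓐.prepared 𝓑 M (𝓐.dim s) f s b =
      ((√(𝓐.dim s : ℝ) / √(M : ℝ) : ℝ) : ℂ) • 𝓐.ent 𝓑 s := by
  rw [SectorBasis.prepared, sum_mod_of_div_eq (W.dim_pos hs) hb fun n =>
      tensorVec (𝓐.vec s.1 (f n)) (𝓑.vec s.2 (f n)),
    hsum fun t => tensorVec (𝓐.vec s.1 t) (𝓑.vec s.2 t), SectorBasis.ent, smul_smul,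
    ← Complex.ofReal_mul]
  congr 2
  have hd : (0 : ℝ) < 𝓐.dim s := by exact_mod_cast W.dim_pos hs
  have h0 : √(𝓐.dim s : ℝ) ≠ 0 := (Real.sqrt_pos.2 hd).ne'
  field_simp

/-- A block has at most min(M, d) elements, and contributes orthonormal product vectors of weight
1/M. The case of interest is the incomplete last block. -/
theorem sqNorm_prepared_le {s : I × K} (hs : W.w s ≠ 0) {M : ℕ} (hM : 0 < M) (b : ℕ) {f : ℕ → T}
    (hf : ∀ n < 𝓐.dim s, f n ∈ 𝓐.supp s.1)
    (hinj : ∀ n < 𝓐.dim s, ∀ m < 𝓐.dim s, f n = f m → n = m) :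
    sqNorm (𝓐.prepared 𝓑 M (𝓐.dim s) f s b) ≤ min 1 ((𝓐.dim s : ℝ) / M) := by
  have hM' : (0 : ℝ) < M := by exact_mod_cast hM
  set S : Finset (Fin M) := finBlock M (𝓐.dim s) b with hS
  have hd := W.dim_pos hs
  have hSD : S.card ≤ 𝓐.dim s := by
    rw [← Finset.card_range (𝓐.dim s)]
    refine Finset.card_le_card_of_injOn (fun m => (m : ℕ) % 𝓐.dim s)
      (fun m _ => by simpa using Nat.mod_lt _ hd) fun m hm m' hm' h => ?_
    rw [hS, Finset.mem_coe, mem_finBlock] at hm hm'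
    exact Fin.ext (mod_injOn_div hm hm' h)
  have hSM : S.card ≤ M := (Finset.card_le_univ S).trans (by simp)
  have hnorm : sqNorm (∑ m ∈ S, tensorVec (𝓐.vec s.1 (f (m % 𝓐.dim s)))
      (𝓑.vec s.2 (f (m % 𝓐.dim s)))) = S.card := by
    have e := star_dotProduct_self (∑ m ∈ S, tensorVec (𝓐.vec s.1 (f (m % 𝓐.dim s)))
      (𝓑.vec s.2 (f (m % 𝓐.dim s))))
    rw [star_sum, sum_dotProduct, Finset.sum_congr rfl (g := fun _ => (1 : ℂ))] at e
    · simp only [Finset.sum_const, nsmul_eq_mul, mul_one] at e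
      exact_mod_cast e.symm
    · intro m hm
      rw [dotProduct_sum, Finset.sum_eq_single m]
      · have hmem := hf _ (Nat.mod_lt (m : ℕ) hd)
        rw [star_tensorVec_dotProduct, 𝓐.inner_vec_of_mem hmem,
          𝓑.inner_vec_of_mem (W.supp_eq s hs ▸ hmem)]
        simp
      · intro m' hm' hne
        have hmem := hf _ (Nat.mod_lt (m : ℕ) hd)
        rw [star_tensorVec_dotProduct, 𝓐.inner_vec_of_mem hmem, if_neg, zero_mul]
        intro h
        rw [hS, mem_finBlock] at hm hm'
        exact hne (Fin.ext (mod_injOn_div hm' hm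
          (hinj _ (Nat.mod_lt _ hd) _ (Nat.mod_lt _ hd) h.symm)))
      · exact fun h => absurd hm h
  rw [SectorBasis.prepared, sqNorm_smul, SectorBasis.norm_inv_sqrt_sq, ← hS, hnorm,
    div_mul_eq_mul_div, one_mul]
  refine le_min ?_ ?_
  · rw [div_le_one hM']; exact_mod_cast hSM
  · gcongr

/-- The complete blocks are those with index below ⌊M/d⌋; block ⌊M/d⌋ is the remainder, and later
ones are empty. If d > M, the remainder is everything. -/
theorem sum_pureState_prepared {s : I × K} (hs : W.w s ≠ 0) {M : ℕ} {f : ℕ → T}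
    (hsum : ∀ g : T → α × β → ℂ,
      ∑ n ∈ Finset.range (𝓐.dim s), g (f n) = ∑ t ∈ 𝓐.supp s.1, g t) :
    ∑ b ∈ Finset.range (M + 1), pureState (𝓐.prepared 𝓑 M (𝓐.dim s) f s b) =
      ((M / 𝓐.dim s * 𝓐.dim s : ℕ) / M : ℝ) • pureState (𝓐.ent 𝓑 s) +
        pureState (𝓐.prepared 𝓑 M (𝓐.dim s) f s (M / 𝓐.dim s)) := by
  have hq : M / 𝓐.dim s + 1 ≤ M + 1 := Nat.succ_le_succ (Nat.div_le_self _ _)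
  rw [← Finset.sum_subset (Finset.range_subset_range.2 hq), Finset.sum_range_succ]
  · congr 1
    rw [Finset.sum_congr rfl fun b hb => by
      rw [W.prepared_eq hs (Finset.mem_range.1 hb) hsum, pureState_smul, Complex.norm_real,
        Real.norm_eq_abs, sq_abs, div_pow, Real.sq_sqrt (Nat.cast_nonneg _),
        Real.sq_sqrt (Nat.cast_nonneg _)], Finset.sum_const, Finset.card_range]
    ext i j
    simp only [Matrix.smul_apply, nsmul_eq_mul, smul_eq_mul, Complex.real_smul]
    push_cast; ring
  · intro b _ hb
    have hb' : M / 𝓐.dim s < b := by simpa using hb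
    rw [SectorBasis.prepared, Finset.sum_eq_zero, smul_zero, pureState_zero]
    intro m hm
    rw [mem_finBlock] at hm
    exact absurd (Nat.div_le_div_right (c := 𝓐.dim s) m.2.le) (by omega)

/-- Alice draws `s` with probability w_s, then both measure a block of length d_s and embed it into
their sectors. The remainder blocks and the missing weight of the complete ones each cost at most
min(1, d_s/M) in trace. -/
theorem exists_preparation {M : ℕ} (hM : 0 < M) :
    ∃ τ : Matrix (α × β) (α × β) ℂ, LOCCConvertible (pureState (maxEntangled M)) τ ∧
      traceNorm (τ - W.mixture) ≤ 2 * ∑ s, W.w s * min 1 ((𝓐.dim s : ℝ) / M) := by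
  have hM' : (0 : ℝ) < M := by exact_mod_cast hM
  have hne : ∀ s : W.support, W.w s ≠ 0 := fun s => W.mem_support.1 s.2
  choose f hf hinj hsum using fun s : W.support => exists_decoding (W.supp_nonempty s (hne s))
  -- The factor √w_s makes the drawing of `s` part of Alice's measurement; the record then tells Bob
  -- which sector to prepare.
  set A : W.support × Fin (M + 1) → Matrix α (Fin M) ℂ := fun x =>
    ((√(W.w x.1) : ℝ) : ℂ) • 𝓐.embedKraus M (𝓐.dim x.1.1) (f x.1) x.1.1.1 x.2 with hA
  set B : W.support × Fin (M + 1) → Fin (M + 1) → Matrix β (Fin M) ℂ := fun x b =>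
    𝓑.embedKraus M (𝓐.dim x.1.1) (f x.1) x.1.1.2 b with hB
  have hA1 : ∑ x, (A x)ᴴ * A x = 1 := by
    rw [Fintype.sum_prod_type]
    have h : ∀ s : W.support, ∑ b, (A (s, b))ᴴ * A (s, b) = (W.w s : ℂ) • 1 := by
      intro s
      rw [← 𝓐.sum_embedKraus (W.dim_pos (hne s)) (hf s) (hinj s) (M := M), Finset.smul_sum]
      refine Finset.sum_congr rfl fun b _ => ?_
      simp only [hA, Matrix.conjTranspose_smul, Matrix.smul_mul, Matrix.mul_smul, smul_smul,
        RCLike.star_def, Complex.conj_ofReal, ← Complex.ofReal_mul,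
        Real.mul_self_sqrt (W.nonneg _)]
      rfl
    simp only [h, ← Finset.sum_smul]
    rw [← Complex.ofReal_sum, W.sum_w_support, Complex.ofReal_one, one_smul]
  have hB1 : ∀ x, ∑ b, (B x b)ᴴ * B x b = 1 := by
    intro x
    have e : 𝓐.dim x.1.1 = (𝓑.supp x.1.1.2).card := by
      rw [SectorBasis.dim, W.supp_eq _ (hne x.1)]
    have e' := W.supp_eq _ (hne x.1)
    simp only [hB, e]
    refine 𝓑.sum_embedKraus ?_ ?_ ?_
    · rw [← e]; exact W.dim_pos (hne x.1)
    · rw [← e']; exact hf x.1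
    · rw [← e']; exact hinj x.1
  refine ⟨_, loccConvertible_measurements A hA1 B hB1 _, ?_⟩
  set q : I × K → ℝ := fun s => (M / 𝓐.dim s * 𝓐.dim s : ℕ) / M with hq
  set R : W.support → Matrix (α × β) (α × β) ℂ := fun s =>
    pureState (𝓐.prepared 𝓑 M (𝓐.dim s.1) (f s) s (M / 𝓐.dim s.1)) with hR
  have hτ : ∑ x, ∑ b, branch (A x) (B x b) (pureState (maxEntangled M)) =
      ∑ s : W.support, (W.w s : ℂ) • ((q s : ℂ) • pureState (𝓐.ent 𝓑 s) + R s) := by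
    rw [Fintype.sum_prod_type]
    refine Finset.sum_congr rfl fun s _ => ?_
    have h1 := W.sum_pureState_prepared (hne s) (M := M) (f := f s) (hsum s)
    rw [Finset.sum_range] at h1
    have h2 : ((q s : ℂ) • pureState (𝓐.ent 𝓑 s.1)) = q s • pureState (𝓐.ent 𝓑 s.1) := by
      ext; simp
    rw [h2, ← h1, Finset.smul_sum]
    refine Finset.sum_congr rfl fun b _ => ?_
    rw [Finset.sum_eq_single b]
    · rw [branch_pureState, hA, hB, Matrix.smul_kronecker, Matrix.smul_mulVec,
        SectorBasis.embedKraus_mulVec_maxEntangled, if_pos rfl, pureState_smul,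
        Complex.norm_real, Real.norm_eq_abs, sq_abs, Real.sq_sqrt (W.nonneg _)]
    · intro b' _ hbb
      rw [branch_pureState, hA, hB, Matrix.smul_kronecker, Matrix.smul_mulVec,
        SectorBasis.embedKraus_mulVec_maxEntangled, if_neg fun h => hbb (Fin.ext h).symm, smul_zero,
        pureState_zero]
    · simp
  have hq1 : ∀ s : W.support, 0 ≤ 1 - q s ∧ 1 - q s ≤ min 1 ((𝓐.dim s.1 : ℝ) / M) := by
    intro s
    have h1 : ((M / 𝓐.dim s.1 * 𝓐.dim s.1 : ℕ) : ℝ) ≤ M := by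
      exact_mod_cast Nat.div_mul_le_self M (𝓐.dim s.1)
    have h2 : (M : ℝ) ≤ ((M / 𝓐.dim s.1 * 𝓐.dim s.1 : ℕ) : ℝ) + 𝓐.dim s.1 := by
      have := Nat.div_add_mod' M (𝓐.dim s.1)
      have := Nat.mod_lt M (W.dim_pos (hne s))
      exact_mod_cast (by omega : M ≤ M / 𝓐.dim s.1 * 𝓐.dim s.1 + 𝓐.dim s.1)
    have h0 : 0 ≤ q s := by positivity
    refine ⟨?_, le_min (by linarith) ?_⟩
    · rw [sub_nonneg, hq]; exact (div_le_one hM').2 h1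
    · rw [le_div_iff₀ hM', sub_mul, hq]
      simp only
      rw [div_mul_cancel₀ _ hM'.ne']
      linarith
  -- Both remaining sums are positive semidefinite, so `traceNorm_sub_le` reduces the error to
  -- traces.
  have hsub : ∑ s : W.support, (W.w s : ℂ) • ((q s : ℂ) • pureState (𝓐.ent 𝓑 s) + R s) -
      W.mixture = ∑ s : W.support, (W.w s : ℂ) • R s -
        ∑ s : W.support, ((W.w s * (1 - q s) : ℝ) : ℂ) • pureState (𝓐.ent 𝓑 s) := by
    rw [W.mixture_eq_sum_support, ← Finset.sum_sub_distrib, ← Finset.sum_sub_distrib]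
    refine Finset.sum_congr rfl fun s _ => ?_
    push_cast
    module
  rw [hτ, hsub]
  refine (traceNorm_sub_le (Matrix.posSemidef_sum _ fun s _ => (posSemidef_pureState _).smul ?_)
    (Matrix.posSemidef_sum _ fun s _ => (posSemidef_pureState _).smul ?_)).trans ?_
  · exact_mod_cast W.nonneg s
  · exact_mod_cast mul_nonneg (W.nonneg s) (hq1 s).1
  · rw [Matrix.trace_sum, Matrix.trace_sum, Complex.re_sum, Complex.re_sum,
      ← Finset.sum_add_distrib, Finset.mul_sum,
      ← W.sum_support (fun s => 2 * (W.w s * min 1 ((𝓐.dim s : ℝ) / M))) fun s hs => by simp [hs],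
      ← Finset.sum_coe_sort W.support]
    refine Finset.sum_le_sum fun s _ => ?_
    rw [Matrix.trace_smul, Matrix.trace_smul, trace_pureState, trace_pureState,
      (isUnitVector_iff _).1 (W.isUnitVector_ent (hne s)), smul_eq_mul, smul_eq_mul,
      Complex.re_ofReal_mul, Complex.re_ofReal_mul, Complex.ofReal_re, Complex.ofReal_re, mul_one]
    have h1 := mul_le_mul_of_nonneg_left
      (W.sqNorm_prepared_le (hne s) hM (M / 𝓐.dim s.1) (hf s) (hinj s)) (W.nonneg s)
    have h2 := mul_le_mul_of_nonneg_left (hq1 s).2 (W.nonneg s)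
    linarith

end SectorWeights

end Sectors

end SpinEntanglement

namespace SpinEntanglement

/-! ### Product distributions -/

theorem sum_prod_eq_prod_sum {n : ℕ} {X R : Type} [Fintype X] [DecidableEq X] [CommSemiring R]
    (f : Fin n → X → R) : ∑ p : Fin n → X, ∏ τ, f τ (p τ) = ∏ τ, ∑ x, f τ x := by
  rw [Finset.prod_univ_sum, Fintype.piFinset_univ]

theorem sum_pairs {n : ℕ} {I K R : Type} [Fintype I] [DecidableEq I] [Fintype K] [DecidableEq K]
    [AddCommMonoid R] (F : (Fin n → I × K) → R) :
    ∑ s : (Fin n → I) × (Fin n → K), F (fun τ => (s.1 τ, s.2 τ)) = ∑ p, F p :=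
  Fintype.sum_equiv (Equiv.arrowProdEquivProdArrow (Fin n) (fun _ => I) (fun _ => K)).symm _ _
    fun _ => rfl

/-- Mean and variance of a sum of independent centred random variables. -/
theorem sum_prod_moments {S : Type} [Fintype S] [DecidableEq S] (w y : S → ℝ)
    (hw : ∑ s, w s = 1) (hy : ∑ s, w s * y s = 0) (n : ℕ) :
    (∑ p : Fin n → S, ∏ τ, w (p τ)) = 1 ∧
    (∑ p : Fin n → S, (∏ τ, w (p τ)) * ∑ τ, y (p τ)) = 0 ∧
    (∑ p : Fin n → S, (∏ τ, w (p τ)) * (∑ τ, y (p τ)) ^ 2) = n * ∑ s, w s * y s ^ 2 := by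
  have h1 : ∀ n : ℕ, (∑ p : Fin n → S, ∏ τ, w (p τ)) = 1 := fun n => by
    rw [sum_prod_eq_prod_sum fun _ => w, hw]; simp
  refine ⟨h1 n, ?_⟩
  induction n with
  | zero => simp
  | succ n ih =>
    obtain ⟨ih1, ih2⟩ := ih
    -- Split off the first copy; the cross terms vanish because `y` is centred.
    have hcons : ∀ F : (Fin (n + 1) → S) → ℝ,
        ∑ p, F p = ∑ a, ∑ q : Fin n → S, F (Fin.cons a q) := fun F => by
      rw [← (Fin.consEquiv fun _ => S).sum_comp F, Fintype.sum_prod_type]; rfl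
    rw [hcons, hcons]
    simp only [Fin.prod_univ_succ, Fin.sum_univ_succ, Fin.cons_zero, Fin.cons_succ]
    constructor
    · have e : ∀ a, ∑ q : Fin n → S, w a * (∏ τ, w (q τ)) * (y a + ∑ τ, y (q τ)) =
          w a * y a := by
        intro a
        have : ∀ q : Fin n → S, w a * (∏ τ, w (q τ)) * (y a + ∑ τ, y (q τ)) =
            w a * y a * (∏ τ, w (q τ)) + w a * ((∏ τ, w (q τ)) * ∑ τ, y (q τ)) := fun q => by ring
        simp only [this, Finset.sum_add_distrib, ← Finset.mul_sum, h1, ih1]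
        ring
      simp only [e, hy]
    · have e : ∀ a, ∑ q : Fin n → S, w a * (∏ τ, w (q τ)) * (y a + ∑ τ, y (q τ)) ^ 2 =
          w a * y a ^ 2 + w a * (n * ∑ s, w s * y s ^ 2) := by
        intro a
        have : ∀ q : Fin n → S, w a * (∏ τ, w (q τ)) * (y a + ∑ τ, y (q τ)) ^ 2 =
            w a * y a ^ 2 * (∏ τ, w (q τ)) + 2 * w a * y a * ((∏ τ, w (q τ)) * ∑ τ, y (q τ)) +
            w a * ((∏ τ, w (q τ)) * (∑ τ, y (q τ)) ^ 2) := fun q => by ring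
        simp only [this, Finset.sum_add_distrib, ← Finset.mul_sum, h1, ih1, ih2]
        ring
      simp only [e, Finset.sum_add_distrib, ← Finset.sum_mul, hw]
      push_cast; ring

/-! ### Powers -/

section Sectors

variable {α β I K T : Type} [Fintype α] [DecidableEq α] [Fintype β] [DecidableEq β]
  [Fintype I] [DecidableEq I] [Fintype K] [DecidableEq K] [Fintype T] [DecidableEq T]

/-- The product basis of `n` copies. -/
noncomputable def SectorBasis.pow (𝓐 : SectorBasis α I T) (n : ℕ) :
    SectorBasis (Fin n → α) (Fin n → I) (Fin n → T) where
  vec i t x := ∏ τ, 𝓐.vec (i τ) (t τ) (x τ)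
  supp i := Fintype.piFinset fun τ => 𝓐.supp (i τ)
  inner_vec i t i' t' := by
    have h : star (fun x : Fin n → α => ∏ τ, 𝓐.vec (i τ) (t τ) (x τ)) ⬝ᵥ
        (fun x => ∏ τ, 𝓐.vec (i' τ) (t' τ) (x τ)) =
        ∏ τ, star (𝓐.vec (i τ) (t τ)) ⬝ᵥ 𝓐.vec (i' τ) (t' τ) := by
      simp only [dotProduct, Pi.star_apply, star_prod, ← Finset.prod_mul_distrib]
      exact sum_prod_eq_prod_sum fun τ x => star (𝓐.vec (i τ) (t τ) x) * 𝓐.vec (i' τ) (t' τ) x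
    rw [h]
    simp only [𝓐.inner_vec]
    rw [Fintype.prod_ite_zero, Finset.prod_const_one]
    congr 1
    simp only [funext_iff, Fintype.mem_piFinset, eq_iff_iff]
    exact ⟨fun h => ⟨fun τ => (h τ).1, fun τ => (h τ).2.1, fun τ => (h τ).2.2⟩,
      fun h τ => ⟨h.1 τ, h.2.1 τ, h.2.2 τ⟩⟩
  complete := by
    ext x y
    have h1 := fun τ : Fin n => congrFun (congrFun 𝓐.complete (x τ)) (y τ)
    simp only [Matrix.sum_apply, pureState, Matrix.vecMulVec_apply, Pi.star_apply] at h1 ⊢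
    rw [sum_pairs fun p : Fin n → I × T => (∏ τ, 𝓐.vec (p τ).1 (p τ).2 (x τ)) *
      star (∏ τ, 𝓐.vec (p τ).1 (p τ).2 (y τ))]
    simp only [star_prod, ← Finset.prod_mul_distrib]
    rw [sum_prod_eq_prod_sum fun τ (z : I × T) => 𝓐.vec z.1 z.2 (x τ) * star (𝓐.vec z.1 z.2 (y τ))]
    simp only [h1, Matrix.one_apply]
    rw [Fintype.prod_ite_zero, Finset.prod_const_one]
    congr 1
    rw [funext_iff]

omit [Fintype K] [DecidableEq K] in
theorem SectorBasis.dim_pow (𝓐 : SectorBasis α I T) (n : ℕ) (s : (Fin n → I) × (Fin n → K)) :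
    (𝓐.pow n).dim s = ∏ τ, 𝓐.dim (s.1 τ, s.2 τ) :=
  Fintype.card_piFinset _

variable {𝓐 : SectorBasis α I T} {𝓑 : SectorBasis β K T}

/-- A product of maximally entangled vectors is maximally entangled: expanding the product of sums
gives the sum over the product support, and the normalizations multiply. -/
theorem SectorBasis.ent_pow (𝓐 : SectorBasis α I T) (𝓑 : SectorBasis β K T) (n : ℕ)
    (s : (Fin n → I) × (Fin n → K))
    (x : (Fin n → α) × (Fin n → β)) :
    (𝓐.pow n).ent (𝓑.pow n) s x = ∏ τ, 𝓐.ent 𝓑 (s.1 τ, s.2 τ) (x.1 τ, x.2 τ) := by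
  simp only [SectorBasis.ent, Pi.smul_apply, Finset.sum_apply, smul_eq_mul,
    Finset.prod_mul_distrib, tensorVec]
  rw [Finset.prod_univ_sum]
  congr 1
  · rw [SectorBasis.dim_pow, Nat.cast_prod, Real.sqrt_prod _ fun _ _ => Nat.cast_nonneg _]
    push_cast
    rw [Finset.prod_div_distrib, Finset.prod_const_one]
  · exact Finset.sum_congr rfl fun t _ => Finset.prod_mul_distrib.symm

namespace SectorWeights

/-- The weights of `n` independent copies. -/
noncomputable def pow (W : SectorWeights 𝓐 𝓑) (n : ℕ) : SectorWeights (𝓐.pow n) (𝓑.pow n) where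
  w s := ∏ τ, W.w (s.1 τ, s.2 τ)
  nonneg s := Finset.prod_nonneg fun _ _ => W.nonneg _
  sum_eq_one := by
    rw [sum_pairs fun p : Fin n → I × K => ∏ τ, W.w (p τ), sum_prod_eq_prod_sum fun _ => W.w,
      W.sum_eq_one, Finset.prod_const_one]
  supp_eq s hs := by
    have h : ∀ τ, 𝓐.supp (s.1 τ) = 𝓑.supp (s.2 τ) := fun τ =>
      W.supp_eq (s.1 τ, s.2 τ) (Finset.prod_ne_zero_iff.1 hs τ (Finset.mem_univ τ))
    simp only [SectorBasis.pow, h]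
  supp_nonempty s hs := Fintype.piFinset_nonempty.2 fun τ =>
    W.supp_nonempty (s.1 τ, s.2 τ) (Finset.prod_ne_zero_iff.1 hs τ (Finset.mem_univ τ))

variable (W : SectorWeights 𝓐 𝓑)

theorem copies_mixture (n : ℕ) : copies W.mixture n = (W.pow n).mixture := by
  ext x y
  simp only [copies, Matrix.of_apply, mixture, Matrix.sum_apply, Matrix.smul_apply, pureState,
    Matrix.vecMulVec_apply, Pi.star_apply, SectorBasis.ent_pow, smul_eq_mul, star_prod, pow,
    Complex.ofReal_prod, ← Finset.prod_mul_distrib]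
  rw [← sum_prod_eq_prod_sum, ← sum_pairs]

theorem w_ne_zero_of_pow {n : ℕ} {s : (Fin n → I) × (Fin n → K)} (hs : (W.pow n).w s ≠ 0)
    (τ : Fin n) : W.w (s.1 τ, s.2 τ) ≠ 0 :=
  Finset.prod_ne_zero_iff.1 (show ∏ τ, W.w (s.1 τ, s.2 τ) ≠ 0 from hs) τ (Finset.mem_univ τ)

theorem log_dim_pow {n : ℕ} {s : (Fin n → I) × (Fin n → K)} (hs : (W.pow n).w s ≠ 0) :
    Real.log ((𝓐.pow n).dim s) = ∑ τ, Real.log (𝓐.dim (s.1 τ, s.2 τ)) := by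
  rw [SectorBasis.dim_pow, Nat.cast_prod, Real.log_prod]
  intro τ _
  have := W.dim_pos (W.w_ne_zero_of_pow hs τ)
  exact_mod_cast this.ne'

/-- A crude bound, linear in n, which controls the atypical sectors in the converse for the cost. -/
theorem log_dim_pow_le {n : ℕ} {s : (Fin n → I) × (Fin n → K)} (hs : (W.pow n).w s ≠ 0) :
    Real.log ((𝓐.pow n).dim s) ≤ n * Real.log (Fintype.card T) := by
  rw [W.log_dim_pow hs]
  refine (Finset.sum_le_card_nsmul _ _ (Real.log (Fintype.card T)) fun τ _ => ?_).trans (by simp)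
  have := W.dim_pos (W.w_ne_zero_of_pow hs τ)
  refine Real.log_le_log (by exact_mod_cast this) ?_
  exact_mod_cast Finset.card_le_univ _

/-- The variance of the degree of entanglement in the mixture. -/
noncomputable def variance : ℝ := ∑ s, W.w s * (Real.log (𝓐.dim s) - W.value) ^ 2

theorem sum_w_mul_sub_value : ∑ s, W.w s * (Real.log (𝓐.dim s) - W.value) = 0 := by
  simp only [mul_sub, Finset.sum_sub_distrib, ← Finset.sum_mul, W.sum_eq_one]
  rw [value]; ring

theorem log_dim_pow_sub {n : ℕ} {s : (Fin n → I) × (Fin n → K)} (hs : (W.pow n).w s ≠ 0) :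
    Real.log ((𝓐.pow n).dim s) - n * W.value =
      ∑ τ, (Real.log (𝓐.dim (s.1 τ, s.2 τ)) - W.value) := by
  rw [W.log_dim_pow hs, Finset.sum_sub_distrib]; simp

theorem value_pow (n : ℕ) : (W.pow n).value = n * W.value := by
  have h : ∑ s, (W.pow n).w s * (Real.log ((𝓐.pow n).dim s) - n * W.value) = 0 := by
    have h1 := (sum_prod_moments W.w _ W.sum_eq_one W.sum_w_mul_sub_value n).2.1
    rw [← sum_pairs] at h1
    rw [← h1]
    refine Finset.sum_congr rfl fun s _ => ?_
    by_cases hs : (W.pow n).w s = 0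
    · rw [hs, zero_mul, show ∏ τ, W.w (s.1 τ, s.2 τ) = 0 from hs, zero_mul]
    · rw [W.log_dim_pow_sub hs]; rfl
  simp only [mul_sub, Finset.sum_sub_distrib, ← Finset.sum_mul, (W.pow n).sum_eq_one] at h
  rw [value]; linarith

theorem variance_pow (n : ℕ) :
    ∑ s, (W.pow n).w s * (Real.log ((𝓐.pow n).dim s) - n * W.value) ^ 2 = n * W.variance := by
  have h1 := (sum_prod_moments W.w _ W.sum_eq_one W.sum_w_mul_sub_value n).2.2
  rw [← sum_pairs] at h1
  rw [variance, ← h1]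
  refine Finset.sum_congr rfl fun s _ => ?_
  by_cases hs : (W.pow n).w s = 0
  · rw [hs, zero_mul, show ∏ τ, W.w (s.1 τ, s.2 τ) = 0 from hs, zero_mul]
  · rw [W.log_dim_pow_sub hs]; rfl

theorem value_nonneg : 0 ≤ W.value :=
  Finset.sum_nonneg fun s _ => mul_nonneg (W.nonneg s) (Real.log_natCast_nonneg _)

end SectorWeights

end Sectors

end SpinEntanglement

namespace SpinEntanglement

open Filter Topology

section Sectors

variable {α β I K T : Type} [Fintype α] [DecidableEq α] [Fintype β] [DecidableEq β]
  [Fintype I] [DecidableEq I] [Fintype K] [DecidableEq K] [Fintype T] [DecidableEq T]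
  {𝓐 : SectorBasis α I T} {𝓑 : SectorBasis β K T}

namespace SectorWeights

variable (W : SectorWeights 𝓐 𝓑)

/-! ### Distillable entanglement -/

theorem sum_mul_add (a b : ℝ) (f : I × K → ℝ) :
    ∑ s, W.w s * (a + b * f s) = a + b * ∑ s, W.w s * f s := by
  simp only [mul_add, Finset.sum_add_distrib, ← Finset.sum_mul, W.sum_eq_one, one_mul,
    Finset.mul_sum]
  congr 1
  exact Finset.sum_congr rfl fun s _ => by ring

/-- Log d is bounded below by log(M/2) times 2 min(1, d/M) - 1: for d ≥ M/2 by monotonicity,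
otherwise because that factor is at most 0. Averaging turns the fidelity into a bound on the value.
-/
theorem value_ge_of_fidelity {M : ℕ} (hM : 0 < M) {ε : ℝ} (hε : ε < 1 / 2)
    (h : 1 - ε ≤ ∑ s, W.w s * min 1 ((𝓐.dim s : ℝ) / M)) :
    (Real.log M - Real.log 2) * (1 - 2 * ε) ≤ W.value := by
  have hM' : (0 : ℝ) < M := by exact_mod_cast hM
  -- The maximum with 0 covers M = 1, where log(M/2) is negative.
  set y := max (Real.log M - Real.log 2) 0 with hy
  have hy0 : 0 ≤ y := le_max_right _ _
  have hb : ∀ s, W.w s * (-y + 2 * y * min 1 ((𝓐.dim s : ℝ) / M)) ≤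
      W.w s * Real.log (𝓐.dim s) := by
    intro s
    by_cases hs : W.w s = 0
    · simp [hs]
    refine mul_le_mul_of_nonneg_left ?_ (W.nonneg s)
    have hd : (0 : ℝ) < 𝓐.dim s := by exact_mod_cast W.dim_pos hs
    have hl : 0 ≤ Real.log (𝓐.dim s) := Real.log_natCast_nonneg _
    rcases le_or_gt ((M : ℝ) / 2) (𝓐.dim s) with h1 | h1
    · have h2 : min 1 ((𝓐.dim s : ℝ) / M) ≤ 1 := min_le_left _ _
      have h3 : y ≤ Real.log (𝓐.dim s) := by
        refine max_le ?_ hl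
        rw [← Real.log_div hM'.ne' two_ne_zero]
        exact Real.log_le_log (by positivity) h1
      nlinarith
    · have h2 : min 1 ((𝓐.dim s : ℝ) / M) ≤ 1 / 2 := by
        refine (min_le_right _ _).trans ?_
        rw [div_le_iff₀ hM']; linarith
      nlinarith
  have hsum := Finset.sum_le_sum fun s (_ : s ∈ Finset.univ) => hb s
  rw [W.sum_mul_add] at hsum
  calc _ ≤ y * (1 - 2 * ε) := mul_le_mul_of_nonneg_right (le_max_left _ _) (by linarith)
    _ ≤ -y + 2 * y * ∑ s, W.w s * min 1 ((𝓐.dim s : ℝ) / M) := by nlinarith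
    _ ≤ _ := hsum

theorem tendsto_const_div_natCast (c : ℝ) : Tendsto (fun n : ℕ => c / (n : ℝ)) atTop (𝓝 0) :=
  tendsto_const_nhds.div_atTop tendsto_natCast_atTop_atTop

/-- Apply the one-shot bound to n copies, divide by n, let n tend to infinity, and only then let ε
tend to 0. -/
theorem le_value_of_mem_distillationRates {r : ℝ} (hr : r ∈ distillationRates W.mixture) :
    r ≤ W.value := by
  have h1 : ∀ ε : ℝ, 0 < ε → ε < 1 / 2 → (r - ε) * (1 - 2 * ε) ≤ W.value := by
    intro ε h0 h2
    have hlim : Tendsto (fun n : ℕ => (r - ε - Real.log 2 / n) * (1 - 2 * ε)) atTop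
        (𝓝 ((r - ε - 0) * (1 - 2 * ε))) :=
      (tendsto_const_nhds.sub (tendsto_const_div_natCast _)).mul_const _
    rw [sub_zero] at hlim
    refine le_of_tendsto hlim ?_
    filter_upwards [hr ε h0, eventually_gt_atTop 0] with n ⟨M, hM, hlog, τ, hτ, hF⟩ hn
    have hn' : (0 : ℝ) < n := by exact_mod_cast hn
    rw [W.copies_mixture] at hτ
    have h3 := (W.pow n).value_ge_of_fidelity hM h2
      (hF.trans ((W.pow n).fidelity_le hM hτ))
    rw [W.value_pow] at h3
    have h4 : (n * (r - ε) - Real.log 2) * (1 - 2 * ε) ≤ n * W.value :=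
      (mul_le_mul_of_nonneg_right (by linarith) (by linarith)).trans h3
    have h5 : (r - ε - Real.log 2 / n) * (1 - 2 * ε) =
        (n * (r - ε) - Real.log 2) * (1 - 2 * ε) / n := by field_simp
    rw [h5, div_le_iff₀ hn']
    linarith
  have hlim : Tendsto (fun ε : ℝ => (r - ε) * (1 - 2 * ε)) (𝓝[>] 0)
      (𝓝 ((r - 0) * (1 - 2 * 0))) := by
    refine Tendsto.mono_left (Continuous.tendsto ?_ 0) nhdsWithin_le_nhds
    fun_prop
  rw [show (r - 0) * (1 - 2 * 0) = r by ring] at hlim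
  refine le_of_tendsto hlim ?_
  filter_upwards [Ioo_mem_nhdsGT (show (0 : ℝ) < 1 / 2 by norm_num)] with ε hε
  exact h1 ε hε.1 hε.2

theorem tendsto_exp_neg_mul {ε : ℝ} (hε : 0 < ε) :
    Tendsto (fun n : ℕ => Real.exp (-(n * ε))) atTop (𝓝 0) :=
  Real.tendsto_exp_neg_atTop_nhds_zero.comp (tendsto_natCast_atTop_atTop.atTop_mul_const hε)

/-- Chebyshev's bound for the average of a quantity that is small on typical sector strings. -/
theorem sum_pow_le {n : ℕ} (hn : 0 < n) {δ c : ℝ} (hδ : 0 < δ) (hc : 0 ≤ c)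
    (F : (Fin n → I) × (Fin n → K) → ℝ) (hF1 : ∀ s, (W.pow n).w s ≠ 0 → F s ≤ 1)
    (hF : ∀ s, (W.pow n).w s ≠ 0 → |Real.log ((𝓐.pow n).dim s) - n * W.value| ≤ n * δ → F s ≤ c) :
    ∑ s, (W.pow n).w s * F s ≤ c + W.variance / δ ^ 2 / n := by
  have hn' : (0 : ℝ) < n := by exact_mod_cast hn
  -- Chebyshev pointwise: off the typical set the squared relative deviation is at least 1 and
  -- dominates `F`.
  have hb : ∀ s, (W.pow n).w s * F s ≤ (W.pow n).w s *
      (c + 1 / (n * δ) ^ 2 * (Real.log ((𝓐.pow n).dim s) - n * W.value) ^ 2) := by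
    intro s
    by_cases hs : (W.pow n).w s = 0
    · simp [hs]
    refine mul_le_mul_of_nonneg_left ?_ ((W.pow n).nonneg s)
    rcases le_or_gt |Real.log ((𝓐.pow n).dim s) - n * W.value| (n * δ) with h | h
    · have := hF s hs h
      have : 0 ≤ 1 / (n * δ) ^ 2 * (Real.log ((𝓐.pow n).dim s) - n * W.value) ^ 2 := by positivity
      linarith
    · have h1 : (n * δ) ^ 2 ≤ (Real.log ((𝓐.pow n).dim s) - n * W.value) ^ 2 := by
        rw [← sq_abs (Real.log _ - _)]
        have : 0 ≤ n * δ := by positivity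
        gcongr
      have h2 : 1 ≤ 1 / (n * δ) ^ 2 * (Real.log ((𝓐.pow n).dim s) - n * W.value) ^ 2 := by
        rw [one_div_mul_eq_div, le_div_iff₀ (by positivity)]; linarith
      linarith [hF1 s hs]
  refine (Finset.sum_le_sum fun s _ => hb s).trans (le_of_eq ?_)
  rw [(W.pow n).sum_mul_add, W.variance_pow]
  field_simp

/-- With log M about n(E - ε) and typical log d at least n(E - ε/2), the infidelity (M-1)/(d+M-1) of
a typical sector is at most exp(-nε/2). -/
theorem value_mem_distillationRates : W.value ∈ distillationRates W.mixture := by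
  intro ε hε
  have hlim : Tendsto (fun n : ℕ => Real.exp (-(n * (ε / 2))) + W.variance / (ε / 2) ^ 2 / n) atTop
      (𝓝 (0 + 0)) :=
    (tendsto_exp_neg_mul (half_pos hε)).add (tendsto_const_div_natCast _)
  rw [add_zero] at hlim
  filter_upwards [hlim.eventually (gt_mem_nhds hε), eventually_gt_atTop 0] with n hle hn
  -- Rounding up keeps the rate and gives M > 0 even when E < ε; the distillation bound involves
  -- only M - 1, so the rounding costs nothing.
  set M := ⌈Real.exp (n * (W.value - ε))⌉₊ with hMdef
  have hM : 0 < M := Nat.ceil_pos.2 (Real.exp_pos _)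
  have hM' : (1 : ℝ) ≤ M := by exact_mod_cast hM
  have hM1 : (M : ℝ) - 1 ≤ Real.exp (n * (W.value - ε)) := by
    have := Nat.ceil_lt_add_one (Real.exp_pos (n * (W.value - ε))).le
    linarith
  refine ⟨M, hM, ?_, ?_⟩
  · rw [Real.le_log_iff_exp_le (by linarith)]
    exact Nat.le_ceil _
  rw [W.copies_mixture]
  obtain ⟨τ, hτ, hF⟩ := (W.pow n).exists_distillation hM
  refine ⟨τ, hτ, le_trans ?_ hF⟩
  have hcheb := W.sum_pow_le hn (half_pos hε) (Real.exp_pos (-(n * (ε / 2)))).le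
    (fun s => 1 + -1 * (((𝓐.pow n).dim s : ℝ) / ((𝓐.pow n).dim s + (M - 1)))) ?_ ?_
  · rw [(W.pow n).sum_mul_add] at hcheb
    linarith
  · intro s hs
    have h1 : (0 : ℝ) < (𝓐.pow n).dim s := by exact_mod_cast (W.pow n).dim_pos hs
    have h2 : (0 : ℝ) ≤ ((𝓐.pow n).dim s : ℝ) / ((𝓐.pow n).dim s + (M - 1)) :=
      div_nonneg h1.le (by linarith)
    linarith
  · intro s hs habs
    have hd : (0 : ℝ) < (𝓐.pow n).dim s := by exact_mod_cast (W.pow n).dim_pos hs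
    have h1 := (abs_le.1 habs).1
    have h2 : Real.exp (n * (W.value - ε / 2)) ≤ (𝓐.pow n).dim s := by
      rw [← Real.le_log_iff_exp_le hd]; linarith
    have h3 : (M : ℝ) - 1 ≤ Real.exp (-(n * (ε / 2))) * (𝓐.pow n).dim s := by
      refine hM1.trans ?_
      calc Real.exp (n * (W.value - ε)) =
            Real.exp (-(n * (ε / 2))) * Real.exp (n * (W.value - ε / 2)) := by
            rw [← Real.exp_add]; congr 1; ring
        _ ≤ _ := by gcongr
    have h4 : (0 : ℝ) < (𝓐.pow n).dim s + (M - 1) := by linarith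
    have h5 : 1 + -1 * (((𝓐.pow n).dim s : ℝ) / ((𝓐.pow n).dim s + (M - 1))) =
        (M - 1) / ((𝓐.pow n).dim s + (M - 1)) := by field_simp; ring
    rw [h5, div_le_iff₀ h4]
    have h6 : 0 ≤ Real.exp (-(n * (ε / 2))) * (M - 1) :=
      mul_nonneg (Real.exp_pos _).le (by linarith)
    linarith

theorem isLUB_distillationRates : IsLUB (distillationRates W.mixture) W.value :=
  ⟨fun _ hr => W.le_value_of_mem_distillationRates hr,
    fun _ hb => hb W.value_mem_distillationRates⟩

/-! ### Entanglement cost -/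

/-- With log M about n(E + ε) and typical log d at most n(E + ε/2), the preparation error d/M is
exponentially small. -/
theorem value_mem_costRates : W.value ∈ costRates W.mixture := by
  intro ε hε
  have hlim : Tendsto (fun n : ℕ => 2 * (2 * Real.exp (-(n * (ε / 2))) +
      W.variance / (ε / 2) ^ 2 / n)) atTop (𝓝 (2 * (2 * 0 + 0))) :=
    (((tendsto_exp_neg_mul (half_pos hε)).const_mul 2).add (tendsto_const_div_natCast _)).const_mul 2
  rw [show (2 : ℝ) * (2 * 0 + 0) = 0 by norm_num] at hlim
  filter_upwards [hlim.eventually (gt_mem_nhds hε), eventually_gt_atTop 0] with n hle hn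
  have hn' : (0 : ℝ) < n := by exact_mod_cast hn
  set x := Real.exp (n * (W.value + ε)) with hx
  have hx1 : 1 ≤ x := Real.one_le_exp (mul_nonneg hn'.le (by linarith [W.value_nonneg]))
  set M := ⌊x⌋₊ with hMdef
  have hM : 0 < M := Nat.floor_pos.2 hx1
  have hM' : (0 : ℝ) < M := by exact_mod_cast hM
  have hM1 : (1 : ℝ) ≤ M := by exact_mod_cast hM
  -- Rounding down loses at most a factor 2, which is where the 2 in the error bound comes from.
  have hMx : x ≤ 2 * M := by
    have := Nat.lt_floor_add_one x
    linarith
  refine ⟨M, hM, ?_, ?_⟩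
  · rw [Real.log_le_iff_le_exp hM']
    exact Nat.floor_le (by linarith)
  rw [W.copies_mixture]
  obtain ⟨τ, hτ, hF⟩ := (W.pow n).exists_preparation hM
  refine ⟨τ, hτ, hF.trans ?_⟩
  have hcheb := W.sum_pow_le hn (half_pos hε)
    (mul_nonneg zero_le_two (Real.exp_pos (-(n * (ε / 2)))).le)
    (fun s => min 1 (((𝓐.pow n).dim s : ℝ) / M)) (fun s _ => min_le_left _ _) ?_
  · linarith
  · intro s hs habs
    have hd : (0 : ℝ) < (𝓐.pow n).dim s := by exact_mod_cast (W.pow n).dim_pos hs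
    have h1 := (abs_le.1 habs).2
    have h2 : ((𝓐.pow n).dim s : ℝ) ≤ Real.exp (n * (W.value + ε / 2)) := by
      rw [← Real.log_le_iff_le_exp hd]; linarith
    refine (min_le_right _ _).trans ?_
    rw [div_le_iff₀ hM']
    calc ((𝓐.pow n).dim s : ℝ) ≤ Real.exp (n * (W.value + ε / 2)) := h2
      _ = Real.exp (-(n * (ε / 2))) * x := by rw [hx, ← Real.exp_add]; congr 1; ring
      _ ≤ Real.exp (-(n * (ε / 2))) * (2 * M) := by gcongr
      _ = _ := by ring

/-- A state near the mixture that is prepared from a maximally entangled state of Schmidt rank `M`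
bounds the value from above. -/
theorem value_le_of_preparation {M : ℕ} (hM : 0 < M) {ε C : ℝ} (hε : 0 < ε) (hε1 : ε ≤ 1)
    (hC : 0 ≤ C) (hdim : ∀ s, W.w s ≠ 0 → Real.log (𝓐.dim s) ≤ C)
    {τ : Matrix (α × β) (α × β) ℂ} (hτ : LOCCConvertible (pureState (maxEntangled M)) τ)
    (htr : traceNorm (τ - W.mixture) ≤ ε) :
    W.value ≤ Real.log M - Real.log ε + 2 * ε * C := by
  have hM' : (0 : ℝ) < M := by exact_mod_cast hM
  have hpsd := hτ.posSemidef (posSemidef_pureState _)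
  have hnn : ∀ s, 0 ≤ (star (𝓐.ent 𝓑 s) ⬝ᵥ (τ *ᵥ 𝓐.ent 𝓑 s)).re := fun s =>
    (Complex.le_def.1 (hpsd.dotProduct_mulVec_nonneg _)).1
  -- The sectors with d ≥ M/ε: the prepared state has weight at most ε on them, so the mixture has
  -- at most 2ε.
  set G := W.support.filter fun s => (M : ℝ) ≤ ε * 𝓐.dim s with hG
  have hGs : G ⊆ W.support := Finset.filter_subset _ _
  have hsmall : ∑ s ∈ G, (star (𝓐.ent 𝓑 s) ⬝ᵥ (τ *ᵥ 𝓐.ent 𝓑 s)).re ≤ ε := by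
    have h1 : ∀ s ∈ G, (star (𝓐.ent 𝓑 s) ⬝ᵥ (τ *ᵥ 𝓐.ent 𝓑 s)).re ≤
        ε / M * (𝓐.dim s * (star (𝓐.ent 𝓑 s) ⬝ᵥ (τ *ᵥ 𝓐.ent 𝓑 s)).re) := by
      intro s hs
      have h2 : 1 ≤ ε * 𝓐.dim s / M := (one_le_div hM').2 (Finset.mem_filter.1 hs).2
      calc _ ≤ ε * 𝓐.dim s / M * (star (𝓐.ent 𝓑 s) ⬝ᵥ (τ *ᵥ 𝓐.ent 𝓑 s)).re :=
            le_mul_of_one_le_left (hnn s) h2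
        _ = _ := by ring
    refine (Finset.sum_le_sum h1).trans ?_
    rw [← Finset.mul_sum]
    calc _ ≤ ε / M * ∑ s, 𝓐.dim s * (star (𝓐.ent 𝓑 s) ⬝ᵥ (τ *ᵥ 𝓐.ent 𝓑 s)).re := by
          refine mul_le_mul_of_nonneg_left ?_ (by positivity)
          exact Finset.sum_le_sum_of_subset_of_nonneg (Finset.subset_univ _)
            fun s _ _ => mul_nonneg (Nat.cast_nonneg _) (hnn s)
      _ ≤ ε / M * M := by
          gcongr
          exact sum_dim_mul_expect_le_of_convertible 𝓐 𝓑 hM hτ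
      _ = ε := by field_simp
  have hGw : ∑ s ∈ G, W.w s ≤ 2 * ε := by
    have h1 := sum_expect_le_traceNorm (hpsd.isHermitian.sub W.posSemidef_mixture.isHermitian) G
      (𝓐.ent 𝓑) fun φ => W.bessel φ hGs
    have h2 : ∑ s ∈ G, (star (𝓐.ent 𝓑 s) ⬝ᵥ ((τ - W.mixture) *ᵥ 𝓐.ent 𝓑 s)).re =
        ∑ s ∈ G, (star (𝓐.ent 𝓑 s) ⬝ᵥ (τ *ᵥ 𝓐.ent 𝓑 s)).re - ∑ s ∈ G, W.w s := by
      rw [← Finset.sum_sub_distrib]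
      refine Finset.sum_congr rfl fun s hs => ?_
      rw [Matrix.sub_mulVec, dotProduct_sub, W.expect_mixture (W.mem_support.1 (hGs hs)),
        Complex.sub_re, Complex.ofReal_re]
    linarith
  have hlogε : Real.log ε ≤ 0 := Real.log_nonpos hε.le hε1
  have hlogM : 0 ≤ Real.log M := Real.log_natCast_nonneg _
  -- Outside `G`, log d is below log(M/ε). Inside, the crude bound `C` is enough, since log(M/ε) ≥ 0
  -- by ε ≤ 1.
  have hb : ∀ s ∈ W.support, W.w s * Real.log (𝓐.dim s) ≤
      W.w s * (Real.log M - Real.log ε) + if (M : ℝ) ≤ ε * 𝓐.dim s then W.w s * C else 0 := by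
    intro s hs
    have hs' := W.mem_support.1 hs
    have hw := W.nonneg s
    have hd : (0 : ℝ) < 𝓐.dim s := by exact_mod_cast W.dim_pos hs'
    split_ifs with h
    · have := mul_le_mul_of_nonneg_left (hdim s hs') hw
      nlinarith
    · rw [add_zero]
      refine mul_le_mul_of_nonneg_left ?_ hw
      rw [← Real.log_div hM'.ne' hε.ne']
      refine Real.log_le_log hd ?_
      rw [le_div_iff₀ hε]
      linarith [not_le.1 h]
  have hsum := Finset.sum_le_sum hb
  rw [Finset.sum_add_distrib, ← Finset.sum_mul, W.sum_support W.w fun s hs => hs, W.sum_eq_one,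
    one_mul, ← Finset.sum_filter, ← hG, ← Finset.sum_mul,
    W.sum_support (fun s => W.w s * Real.log (𝓐.dim s)) fun s hs => by simp [hs]] at hsum
  have := mul_le_mul_of_nonneg_right hGw hC
  rw [value]
  linarith

/-- For n copies `C` grows linearly, so after division by n its contribution is 2ε log |T|, which
disappears as ε tends to 0. -/
theorem value_le_of_mem_costRates {r : ℝ} (hr : r ∈ costRates W.mixture) : W.value ≤ r := by
  set C := Real.log (Fintype.card T) with hC
  have hC0 : 0 ≤ C := Real.log_natCast_nonneg _
  have h1 : ∀ ε : ℝ, 0 < ε → ε ≤ 1 → W.value ≤ r + ε + 2 * ε * C := by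
    intro ε h0 h2
    have hlim : Tendsto (fun n : ℕ => r + ε + (-Real.log ε) / n + 2 * ε * C) atTop
        (𝓝 (r + ε + 0 + 2 * ε * C)) :=
      (tendsto_const_nhds.add (tendsto_const_div_natCast _)).add_const _
    rw [add_zero] at hlim
    refine ge_of_tendsto hlim ?_
    filter_upwards [hr ε h0, eventually_gt_atTop 0] with n ⟨M, hM, hlog, τ, hτ, htr⟩ hn
    have hn' : (0 : ℝ) < n := by exact_mod_cast hn
    rw [W.copies_mixture] at htr
    have h3 := (W.pow n).value_le_of_preparation hM h0 h2 (mul_nonneg hn'.le hC0)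
      (fun s hs => W.log_dim_pow_le hs) hτ htr
    rw [W.value_pow] at h3
    have h4 : r + ε + (-Real.log ε) / n + 2 * ε * C =
        (n * (r + ε) - Real.log ε + 2 * ε * (n * C)) / n := by field_simp; ring
    rw [h4, le_div_iff₀ hn']
    linarith
  have hlim : Tendsto (fun ε : ℝ => r + ε + 2 * ε * C) (𝓝[>] 0) (𝓝 (r + 0 + 2 * 0 * C)) := by
    refine Tendsto.mono_left (Continuous.tendsto ?_ 0) nhdsWithin_le_nhds
    fun_prop
  rw [show r + 0 + 2 * 0 * C = r by ring] at hlim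
  refine ge_of_tendsto hlim ?_
  filter_upwards [Ioo_mem_nhdsGT (show (0 : ℝ) < 1 by norm_num)] with ε hε
  exact h1 ε hε.1 hε.2.le

theorem isGLB_costRates : IsGLB (costRates W.mixture) W.value :=
  ⟨fun _ hr => W.value_le_of_mem_costRates hr, fun _ hb => hb W.value_mem_costRates⟩

end SectorWeights

end Sectors

end SpinEntanglement

namespace SpinEntanglement

/-! ### Angular momentum bases -/

namespace AngularMomentumBasis

variable {k l : ℕ} (𝓐 : AngularMomentumBasis k) (𝓑 : AngularMomentumBasis l)

theorem linearIndependent : LinearIndependent ℂ 𝓐.vec := by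
  rw [linearIndependent_iff']
  intro s g hg i hi
  have h := congrArg (fun v => star (𝓐.vec i) ⬝ᵥ v) hg
  simp only [dotProduct_sum, dotProduct_smul, 𝓐.orthonormal, dotProduct_zero, smul_eq_mul, mul_ite,
    mul_one, mul_zero, Finset.sum_ite_eq, hi, if_true] at h
  exact h

/-- An orthonormal family in finite dimension is finite, so only finitely many spins occur. A cutoff
makes the sector index sets finite; its size is immaterial. -/
theorem exists_bound : ∃ N, ∀ j, N ≤ j → 𝓐.mult j = 0 := by
  have hfin : Finite (Σ j : ℕ, Fin (2 * j + 1) × Fin (𝓐.mult j)) := 𝓐.linearIndependent.finite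
  obtain ⟨N, hN⟩ := (Set.finite_range
    (Sigma.fst : (Σ j : ℕ, Fin (2 * j + 1) × Fin (𝓐.mult j)) → ℕ)).bddAbove
  refine ⟨N + 1, fun j hj => ?_⟩
  by_contra h
  have := hN ⟨⟨j, 0, ⟨0, Nat.pos_of_ne_zero h⟩⟩, rfl⟩
  simp only at this
  omega

/-- The values of the third component of the spin, in the index set of the sector basis. -/
def spinSupp (N : ℕ) (j : Fin N) : Finset (Fin (2 * N + 1)) :=
  Finset.univ.map (Fin.castLEEmb (by omega : 2 * (j : ℕ) + 1 ≤ 2 * N + 1))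

theorem mem_spinSupp {N : ℕ} {j : Fin N} {t : Fin (2 * N + 1)} :
    t ∈ spinSupp N j ↔ (t : ℕ) < 2 * j + 1 := by
  simp only [spinSupp, Finset.mem_map, Finset.mem_univ, true_and]
  constructor
  · rintro ⟨i, rfl⟩; exact i.2
  · intro h; exact ⟨⟨t, h⟩, Fin.ext rfl⟩

theorem card_spinSupp {N : ℕ} (j : Fin N) : (spinSupp N j).card = 2 * j + 1 := by
  simp [spinSupp]

/-- The vectors of an angular momentum basis, permuted within the multiplets and multiplied by
phases. -/
noncomputable def sectorVec (π : ∀ j, Equiv.Perm (Fin (2 * j + 1))) (c : ∀ j, Fin (2 * j + 1) → ℂ)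
    (j : ℕ) (a : Fin (𝓐.mult j)) (t : ℕ) : Qubits (2 * k) → ℂ :=
  if h : t < 2 * j + 1 then c j ⟨t, h⟩ • 𝓐.vec ⟨j, π j ⟨t, h⟩, a⟩ else 0

/-- The sectors of an angular momentum basis are the irreducible subspaces. -/
noncomputable def toSectorBasis (N : ℕ) (hN : ∀ j, N ≤ j → 𝓐.mult j = 0)
    (π : ∀ j, Equiv.Perm (Fin (2 * j + 1))) (c : ∀ j, Fin (2 * j + 1) → ℂ)
    (hc : ∀ j i, star (c j i) * c j i = 1) :
    SectorBasis (Qubits (2 * k)) (Σ j : Fin N, Fin (𝓐.mult j)) (Fin (2 * N + 1)) :=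
  have inner : ∀ (i : Σ j : Fin N, Fin (𝓐.mult j)) (t : Fin (2 * N + 1))
      (i' : Σ j : Fin N, Fin (𝓐.mult j)) (t' : Fin (2 * N + 1)),
      star (𝓐.sectorVec π c i.1 i.2 t) ⬝ᵥ 𝓐.sectorVec π c i'.1 i'.2 t' =
        if i = i' ∧ t = t' ∧ t ∈ spinSupp N i.1 then 1 else 0 := by
    rintro ⟨j, a⟩ t ⟨j', a'⟩ t'
    simp only [sectorVec, mem_spinSupp]
    by_cases h : (t : ℕ) < 2 * j + 1
    swap
    · simp [h]
    by_cases h' : (t' : ℕ) < 2 * j' + 1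
    swap
    · rw [dif_neg h', dotProduct_zero, if_neg]
      rintro ⟨h1, rfl, -⟩
      obtain rfl : j = j' := congrArg Sigma.fst h1
      exact h' h
    rw [dif_pos h, dif_pos h', star_smul, smul_dotProduct, dotProduct_smul, 𝓐.orthonormal]
    by_cases hj : j = j'
    · subst hj
      by_cases ht : t = t'
      · subst ht
        by_cases ha : a = a'
        · subst ha
          simpa [h] using hc _ _
        · simp [ha]
      · have : (⟨t, h⟩ : Fin (2 * (j : ℕ) + 1)) ≠ ⟨t', h'⟩ := fun e => ht (Fin.ext (by
          simpa using e))
        simp [ht, this]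
    · rw [if_neg fun e => hj (Fin.ext (congrArg Sigma.fst e)),
        if_neg fun e => hj (congrArg Sigma.fst e.1)]
      simp
  { vec := fun i t => 𝓐.sectorVec π c i.1 i.2 t
    supp := fun i => spinSupp N i.1
    inner_vec := inner
    complete := by
      set P := ∑ x : (Σ j : Fin N, Fin (𝓐.mult j)) × Fin (2 * N + 1),
        pureState (𝓐.sectorVec π c x.1.1 x.1.2 x.2) with hP
      -- `P` fixes every basis vector, because each is a nonzero multiple of a sector vector; as
      -- these span the space, `P` is the identity.
      have hfix : ∀ s, P *ᵥ 𝓐.vec s = 𝓐.vec s := by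
        rintro ⟨j, i, a⟩
        have hj : j < N := by
          by_contra h
          have := a.2
          have := hN j (not_lt.1 h)
          omega
        set t : Fin (2 * N + 1) := ⟨(π j).symm i, by have := ((π j).symm i).2; omega⟩ with ht
        set z : Σ j : Fin N, Fin (𝓐.mult j) := ⟨⟨j, hj⟩, a⟩ with hz
        have h1 : 𝓐.sectorVec π c z.1 z.2 t = c j ((π j).symm i) • 𝓐.vec ⟨j, i, a⟩ := by
          have h0 : (t : ℕ) < 2 * (z.1 : ℕ) + 1 := ((π j).symm i).2
          rw [sectorVec, dif_pos h0]
          change c j ((π j).symm i) • 𝓐.vec ⟨j, π j ((π j).symm i), a⟩ = _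
          rw [Equiv.apply_symm_apply]
        have h2 : P *ᵥ 𝓐.sectorVec π c z.1 z.2 t = 𝓐.sectorVec π c z.1 z.2 t := by
          rw [hP, Matrix.sum_mulVec, Finset.sum_eq_single (z, t)]
          · have hmem : t ∈ spinSupp N z.1 := mem_spinSupp.2 ((π j).symm i).2
            rw [pureState_mulVec, inner, if_pos ⟨rfl, rfl, hmem⟩, one_smul]
          · intro x _ hne
            rw [pureState_mulVec, inner, if_neg, zero_smul]
            exact fun h => hne (Prod.ext h.1 h.2.1)
          · simp
        have hc0 : c j ((π j).symm i) ≠ 0 := fun h0 => by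
          have := hc j ((π j).symm i); simp [h0] at this
        rw [h1, Matrix.mulVec_smul] at h2
        exact smul_right_injective _ hc0 h2
      have hlin : P.mulVecLin = LinearMap.id := by
        refine LinearMap.ext_on_range (v := 𝓐.vec) 𝓐.complete fun s => ?_
        simpa using hfix s
      have h3 : P.mulVecLin = (1 : Matrix (Qubits (2 * k)) (Qubits (2 * k)) ℂ).mulVecLin := by
        rw [hlin, Matrix.mulVecLin_one]
      exact Matrix.toLin'.injective h3 }

/-- Alice's sector basis, with the magnetic quantum number reversed. -/
noncomputable def sectorsA (N : ℕ) (hN : ∀ j, N ≤ j → 𝓐.mult j = 0) :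
    SectorBasis (Qubits (2 * k)) (Σ j : Fin N, Fin (𝓐.mult j)) (Fin (2 * N + 1)) :=
  𝓐.toSectorBasis N hN (fun _ => Fin.revPerm) (fun _ _ => 1) fun _ _ => by simp

/-- Bob's sector basis, which contains the signs of the singlet. -/
noncomputable def sectorsB (N : ℕ) (hN : ∀ j, N ≤ j → 𝓑.mult j = 0) :
    SectorBasis (Qubits (2 * l)) (Σ j : Fin N, Fin (𝓑.mult j)) (Fin (2 * N + 1)) :=
  𝓑.toSectorBasis N hN (fun _ => 1) (fun j i => (-1) ^ (2 * j - (i : ℕ))) fun _ _ => by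
    rw [star_pow, ← mul_pow]; simp

variable {𝓐 𝓑}

theorem dim_sectorsA {N : ℕ} (hA : ∀ j, N ≤ j → 𝓐.mult j = 0) {K : Type}
    (s : (Σ j : Fin N, Fin (𝓐.mult j)) × K) : (𝓐.sectorsA N hA).dim s = 2 * (s.1.1 : ℕ) + 1 :=
  card_spinSupp _

/-- The reversal on Alice's side pairs -m with m, and Bob's phases are the signs of the singlet, so
the sum over `t` is the sum over m. -/
theorem ent_sectors {N : ℕ} (hA : ∀ j, N ≤ j → 𝓐.mult j = 0) (hB : ∀ j, N ≤ j → 𝓑.mult j = 0)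
    (j : Fin N) (a : Fin (𝓐.mult j)) (b : Fin (𝓑.mult j)) :
    (𝓐.sectorsA N hA).ent (𝓑.sectorsB N hB) (⟨j, a⟩, ⟨j, b⟩) = zeroSpin 𝓐 𝓑 j a b := by
  ext x
  rw [SectorBasis.ent, dim_sectorsA, zeroSpin]
  simp only [Pi.smul_apply, Finset.sum_apply, smul_eq_mul, tensorVec]
  congr 1
  · push_cast; rfl
  · change ∑ t ∈ spinSupp N j, 𝓐.sectorVec _ _ j a t x.1 * 𝓑.sectorVec _ _ j b t x.2 = _
    rw [spinSupp, Finset.sum_map]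
    refine Finset.sum_congr rfl fun i _ => ?_
    have hi : ((Fin.castLEEmb (by omega : 2 * (j : ℕ) + 1 ≤ 2 * N + 1) i : Fin (2 * N + 1)) : ℕ) <
        2 * j + 1 := i.2
    rw [sectorVec, sectorVec, dif_pos hi, dif_pos hi]
    simp
    ring

/-- Extension of a function of the labels of zero-spin states to pairs of sectors. -/
noncomputable def extend {R : Type} [Zero R] (N : ℕ)
    (f : (j : ℕ) → Fin (𝓐.mult j) → Fin (𝓑.mult j) → R) :
    (Σ j : Fin N, Fin (𝓐.mult j)) × (Σ j : Fin N, Fin (𝓑.mult j)) → R :=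
  fun s => if h : s.2.1 = s.1.1 then
    if (s.1.1 : ℕ) ≤ min k l then f s.1.1 s.1.2 (h ▸ s.2.2) else 0 else 0

theorem extend_same {R : Type} [Zero R] {N : ℕ}
    (f : (j : ℕ) → Fin (𝓐.mult j) → Fin (𝓑.mult j) → R) (j : Fin N) (a : Fin (𝓐.mult j))
    (b : Fin (𝓑.mult j)) :
    extend N f (⟨j, a⟩, ⟨j, b⟩) = if (j : ℕ) ≤ min k l then f j a b else 0 := by
  simp [extend]

theorem extend_of_ne {R : Type} [Zero R] {N : ℕ}
    (f : (j : ℕ) → Fin (𝓐.mult j) → Fin (𝓑.mult j) → R)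
    {s : (Σ j : Fin N, Fin (𝓐.mult j)) × (Σ j : Fin N, Fin (𝓑.mult j))} (h : s.2.1 ≠ s.1.1) :
    extend N f s = 0 := by
  simp [extend, h]

theorem sum_extend {R : Type} [AddCommMonoid R] {N : ℕ} (hN : min k l < N)
    (f : (j : ℕ) → Fin (𝓐.mult j) → Fin (𝓑.mult j) → R) :
    ∑ s, extend N f s = ∑ j ∈ Finset.range (min k l + 1), ∑ a, ∑ b, f j a b := by
  have h1 : ∀ (j : Fin N) (a : Fin (𝓐.mult j)),
      ∑ y : Σ j : Fin N, Fin (𝓑.mult j), extend N f (⟨j, a⟩, y) =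
      ∑ b, if (j : ℕ) ≤ min k l then f j a b else 0 := by
    intro j a
    rw [Fintype.sum_sigma, Finset.sum_eq_single j]
    · simp only [extend_same]
    · intro j' _ hne
      exact Finset.sum_eq_zero fun b _ => extend_of_ne f hne
    · simp
  rw [Fintype.sum_prod_type, Fintype.sum_sigma]
  simp only [h1]
  rw [← Finset.sum_range fun j => ∑ a, ∑ b, if j ≤ min k l then f j a b else 0,
    ← Finset.sum_subset (Finset.range_subset_range.2 hN)]
  · refine Finset.sum_congr rfl fun j hj => ?_
    simp only [Nat.lt_succ_iff.1 (Finset.mem_range.1 hj), if_true]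
  · intro j _ hj
    have : ¬ j ≤ min k l := fun h => hj (Finset.mem_range.2 (Nat.lt_succ_of_le h))
    simp only [this, if_false, Finset.sum_const_zero]

theorem exists_eq_of_extend_ne_zero {R : Type} [Zero R] {N : ℕ}
    {f : (j : ℕ) → Fin (𝓐.mult j) → Fin (𝓑.mult j) → R}
    {s : (Σ j : Fin N, Fin (𝓐.mult j)) × (Σ j : Fin N, Fin (𝓑.mult j))} (h : extend N f s ≠ 0) :
    s.1.1 = s.2.1 := by
  by_contra hne
  exact h (extend_of_ne f fun e => hne e.symm)

/-- The weights of the zero-spin states as sector weights. -/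
noncomputable def toSectorWeights {N : ℕ} (hA : ∀ j, N ≤ j → 𝓐.mult j = 0)
    (hB : ∀ j, N ≤ j → 𝓑.mult j = 0) (hN : min k l < N)
    (w : (j : ℕ) → Fin (𝓐.mult j) → Fin (𝓑.mult j) → ℝ) (hw : ∀ j a b, 0 ≤ w j a b)
    (hw1 : ∑ j ∈ Finset.range (min k l + 1), ∑ a, ∑ b, w j a b = 1) :
    SectorWeights (𝓐.sectorsA N hA) (𝓑.sectorsB N hB) where
  w := extend N w
  nonneg s := by
    unfold extend
    split_ifs
    · exact hw _ _ _
    · exact le_rfl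
    · exact le_rfl
  sum_eq_one := by rw [sum_extend hN, hw1]
  supp_eq s hs := congrArg (spinSupp N) (exists_eq_of_extend_ne_zero hs)
  supp_nonempty s _ := Finset.card_pos.1 (by
    change 0 < (spinSupp N s.1.1).card
    rw [card_spinSupp]; omega)

theorem mixture_toSectorWeights {N : ℕ} (hA : ∀ j, N ≤ j → 𝓐.mult j = 0)
    (hB : ∀ j, N ≤ j → 𝓑.mult j = 0) (hN : min k l < N)
    (w : (j : ℕ) → Fin (𝓐.mult j) → Fin (𝓑.mult j) → ℝ) (hw : ∀ j a b, 0 ≤ w j a b)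
    (hw1 : ∑ j ∈ Finset.range (min k l + 1), ∑ a, ∑ b, w j a b = 1) :
    (toSectorWeights hA hB hN w hw hw1).mixture = zeroSpinMixture 𝓐 𝓑 w := by
  rw [zeroSpinMixture, ← sum_extend hN, SectorWeights.mixture]
  refine Finset.sum_congr rfl ?_
  rintro ⟨⟨j, a⟩, ⟨j', b⟩⟩ -
  change ((extend N w _ : ℝ) : ℂ) • _ = _
  by_cases h : j = j'
  · subst h
    rw [extend_same, extend_same, ent_sectors]
    split_ifs <;> simp
  · rw [extend_of_ne _ fun e => h e.symm, extend_of_ne _ fun e => h e.symm]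
    simp

theorem value_toSectorWeights {N : ℕ} (hA : ∀ j, N ≤ j → 𝓐.mult j = 0)
    (hB : ∀ j, N ≤ j → 𝓑.mult j = 0) (hN : min k l < N)
    (w : (j : ℕ) → Fin (𝓐.mult j) → Fin (𝓑.mult j) → ℝ) (hw : ∀ j a b, 0 ≤ w j a b)
    (hw1 : ∑ j ∈ Finset.range (min k l + 1), ∑ a, ∑ b, w j a b = 1) :
    (toSectorWeights hA hB hN w hw hw1).value =
      ∑ j ∈ Finset.range (min k l + 1), ∑ a, ∑ b, w j a b * Real.log (2 * (j : ℝ) + 1) := by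
  rw [← sum_extend hN, SectorWeights.value]
  refine Finset.sum_congr rfl ?_
  rintro ⟨⟨j, a⟩, ⟨j', b⟩⟩ -
  change extend N w _ * _ = _
  rw [dim_sectorsA]
  by_cases h : j = j'
  · subst h
    rw [extend_same, extend_same]
    split_ifs <;> simp
  · rw [extend_of_ne _ fun e => h e.symm, extend_of_ne _ fun e => h e.symm]
    simp

end AngularMomentumBasis

end SpinEntanglement

/-! ### The theorem for zero-spin states. -/

open SpinEntanglement in
theorem proposition3 (k l : ℕ) (𝓐 : AngularMomentumBasis k) (𝓑 : AngularMomentumBasis l)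
    (w : (j : ℕ) → Fin (𝓐.mult j) → Fin (𝓑.mult j) → ℝ)
    (hw : ∀ j a b, 0 ≤ w j a b)
    (hw1 : ∑ j ∈ Finset.range (min k l + 1), ∑ a, ∑ b, w j a b = 1)
    (v : ℝ)
    (hv : v = ∑ j ∈ Finset.range (min k l + 1), ∑ a, ∑ b, w j a b * Real.log (2 * (j : ℝ) + 1)) :
    IsLeast (formationValues (zeroSpinMixture 𝓐 𝓑 w)) v ∧
    IsLUB (distillationRates (zeroSpinMixture 𝓐 𝓑 w)) v ∧
    IsGLB (costRates (zeroSpinMixture 𝓐 𝓑 w)) v ∧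
    IsLeast (relativeEntropyValues (zeroSpinMixture 𝓐 𝓑 w)) v ∧
    ∀ E : ∀ {α β : Type} [Fintype α] [DecidableEq α] [Fintype β] [DecidableEq β],
        Matrix (α × β) (α × β) ℂ → ℝ,
      IsEntanglementMeasure E → E (zeroSpinMixture 𝓐 𝓑 w) = v := by
  obtain ⟨NA, hNA⟩ := 𝓐.exists_bound
  obtain ⟨NB, hNB⟩ := 𝓑.exists_bound
  -- A common cutoff: above every spin that occurs on either side, and above min(k,l) so that the
  -- whole range of the sum is included.
  have hA : ∀ j, max (max NA NB) (min k l + 1) ≤ j → 𝓐.mult j = 0 := fun j hj =>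
    hNA j (((le_max_left _ _).trans (le_max_left _ _)).trans hj)
  have hB : ∀ j, max (max NA NB) (min k l + 1) ≤ j → 𝓑.mult j = 0 := fun j hj =>
    hNB j (((le_max_right _ _).trans (le_max_left _ _)).trans hj)
  have hN : min k l < max (max NA NB) (min k l + 1) :=
    lt_of_lt_of_le (Nat.lt_succ_self _) (le_max_right _ _)
  rw [hv, ← AngularMomentumBasis.mixture_toSectorWeights hA hB hN w hw hw1,
    ← AngularMomentumBasis.value_toSectorWeights hA hB hN w hw hw1]
  set W := AngularMomentumBasis.toSectorWeights hA hB hN w hw hw1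
  exact ⟨W.isLeast_formationValues, W.isLUB_distillationRates, W.isGLB_costRates,
    W.isLeast_relativeEntropyValues, fun E hE => W.measure_eq_value E hE⟩
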